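/- For topological spaces $A,B$ let $A*B$ be the topological join, i.e. the quotient of $A\times B\times[0,1]$ by $(a,b,0)\sim(a,b',0)$ and $(a,b,1)\sim(a',b,1)$, and let $\Sigma Y=Y*\{n,p\}$ be the suspension of $Y$, where $\{n,p\}$ is a discrete two-point space; $Y$ is identified with the set of points of $\Sigma Y$ with last coordinate $0$, and the two points with last coordinate $1$, again denoted $n$ and $p$, are the suspension points. Let $C_1,C_2$ be Cantor sets and $Y=C_1*C_2$. (1) Every homeomorphism $f:\Sigma Y\to\Sigma Y$ satisfies $f(\{n,p\})=\{n,p\}$. (2) Suppose that $\Sigma Y$ is also a suspension of a subspace $Z\subset\Sigma Y$, i.e. there is a homeomorphism $h:\Sigma Z\to\Sigma Y$ that restricts to the inclusion on $Z\subset\Sigma Z$. Then $h$ maps the set of suspension points of $\Sigma Z$ onto $\{n,p\}$, and $Z$ is isotopic to $Y$ in $\Sigma Y$: there is a continuous map $F:[0,1]\times\Sigma Y\to\Sigma Y$ such that each $F_t=F(t,\cdot)$ is a homeomorphism of $\Sigma Y$, $F_0=\mathrm{id}$ and $F_1(Z)=Y$. -/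

import Mathlib

open scoped unitInterval

/-- A Cantor set: a space homeomorphic to the standard Cantor space `{0,1}^ℕ`. -/
def IsCantorSet (C : Type*) [TopologicalSpace C] : Prop :=
  Nonempty (C ≃ₜ (ℕ → Bool))

/-- The identifications `(a, b, 0) ∼ (a, c, 0)` and `(a, c, 1) ∼ (b, c, 1)` on `A × B × [0,1]`. -/
inductive JoinRel (A B : Type*) : A × B × I → A × B × I → Prop
  | left (a : A) (b c : B) : JoinRel A B (a, b, 0) (a, c, 0)
  | right (a b : A) (c : B) : JoinRel A B (a, c, 1) (b, c, 1)

/-- The topological join `A * B`: the quotient of `A × B × [0,1]` by the equivalence relation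
generated by `JoinRel`, with the quotient topology. -/
def TopJoin (A B : Type*) : Type _ := Quot (JoinRel A B)

instance (A B : Type*) [TopologicalSpace A] [TopologicalSpace B] :
    TopologicalSpace (TopJoin A B) :=
  inferInstanceAs (TopologicalSpace (Quot (JoinRel A B)))

/-- The point of the join with coordinates `(a, b, t)`. -/
def TopJoin.mk {A B : Type*} (a : A) (b : B) (t : I) : TopJoin A B :=
  Quot.mk (JoinRel A B) (a, b, t)

/-- The suspension `Σ Y`: the join of `Y` with a discrete two-point set. -/
abbrev TopSusp (Y : Type*) : Type _ := TopJoin Y Bool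

/-- The copy of `Y` in `Σ Y`: the points with last coordinate `0`. -/
def TopSusp.base (Y : Type*) : Set (TopSusp Y) :=
  {x | ∃ (y : Y) (b : Bool), x = TopJoin.mk y b 0}

/-- The set of suspension points of `Σ Y`: the points with last coordinate `1`.
For nonempty `Y` these are exactly two points, one for each element of `Bool`. -/
def TopSusp.points (Y : Type*) : Set (TopSusp Y) :=
  {x | ∃ (y : Y) (b : Bool), x = TopJoin.mk y b 1}

/-- A structure on `X` of a suspension of its subspace `Z`: a homeomorphism `Σ Z ≃ₜ X` that
restricts to the inclusion on the copy of `Z` in `Σ Z`. -/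
structure SuspensionStructure {X : Type*} [TopologicalSpace X] (Z : Set X) where
  toHomeo : TopSusp Z ≃ₜ X
  map_base : ∀ (z : Z) (b : Bool), toHomeo (TopJoin.mk z b 0) = z

/-- The suspension points in `X` of a suspension structure on `X`. -/
def SuspensionStructure.points {X : Type*} [TopologicalSpace X] {Z : Set X}
    (S : SuspensionStructure Z) : Set X :=
  S.toHomeo '' TopSusp.points Z

/-- `A` is (ambient) isotopic to `B` in `X`: there is a path of homeomorphisms of `X`, jointly
continuous in time and space, from the identity to a homeomorphism that maps `A` onto `B`. -/
def IsIsotopicIn {X : Type*} [TopologicalSpace X] (A B : Set X) : Prop :=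
  ∃ F : I → (X ≃ₜ X), Continuous (fun q : I × X => F q.1 q.2) ∧
    F 0 = Homeomorph.refl X ∧ F 1 '' A = B

/-! The suspension of `A * B` is a union of diamonds, one for each pair `(a, b)`, namely the
suspension of the segment from `a` to `b`. Two diamonds share their left sides if the first
coordinates agree, their right sides if the second ones agree, and always both suspension points
(`strip_eq_strip_iff`, `isQuotientMap_strip`).

Cantor sets are compact, totally disconnected and without isolated points, so the local topology
sees this decomposition. The suspension points are exactly the points with arbitrarily small
connected neighbourhoods (`connectedImKleinen_univ_iff`). This settles homeomorphisms, and also a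
second suspension structure, because suspension points over a compact base always have such
neighbourhoods. The open diamonds consist of the points that have a neighbourhood in which their
component is locally connected (`hasLocConnectedLeaf_strip_iff`).

Let a second suspension structure be given. Sliding along its lines is a homeomorphism, so the
second invariant is constant on a line; by connectedness the line stays in one diamond, and on a
side if it starts there (`strip_coord_line`, `slope_line_eq`). Each diamond is thus partitioned into
arcs from one suspension point to the other, two of which are the sides. Since each arc separates
the sides, the arcs are linearly ordered, and there is a strictly monotone function of the arcs that
is continuous also in `(a, b)` (`exists_transverse_coordinate`). Together with the height along the
lines it straightens all diamonds compatibly with the gluing (`exists_stripCompatible`).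

Such a family is isotopic to the identity through compatible families
(`StripCompatible.exists_isotopy`): a vertical linear motion accounts for the sides, and the rest
fixes the boundaries and is undone by the Alexander trick. The isotopy descends to the suspension
and carries `Z` to the base. -/

open Set Filter Topology
-- Points of the join and its Hausdorff property
namespace TopJoin
variable {A B : Type*}

/-- The right-hand side is an equivalence relation that contains the generating identifications.
Conversely, the two coordinates can be changed one at a time. -/
theorem mk_eq_mk_iff {a a' : A} {b b' : B} {t t' : I} :
    mk a b t = mk a' b' t' ↔ t = t' ∧ (a = a' ∨ t = 1) ∧ (b = b' ∨ t = 0) := by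
  constructor
  · intro h
    have key : ∀ p p' : A × B × I, Relation.EqvGen (JoinRel A B) p p' →
        p.2.2 = p'.2.2 ∧ (p.1 = p'.1 ∨ p.2.2 = 1) ∧ (p.2.1 = p'.2.1 ∨ p.2.2 = 0) := by
      intro p p' h
      induction h with
      | rel _ _ h => cases h <;> simp
      | refl => simp
      | symm _ _ _ ih => grind
      | trans _ _ _ _ _ ih₁ ih₂ => grind
    exact key (a, b, t) (a', b', t') (Quot.eqvGen_exact h)
  · rintro ⟨rfl, ha, hb⟩
    have h₁ : mk a b t = mk a' b t := by
      rcases ha with rfl | rfl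
      · rfl
      · exact Quot.sound (JoinRel.right _ _ _)
    have h₂ : mk a' b t = mk a' b' t := by
      rcases hb with rfl | rfl
      · rfl
      · exact Quot.sound (JoinRel.left _ _ _)
    exact h₁.trans h₂

theorem exists_mk (x : TopJoin A B) : ∃ a b t, mk a b t = x := by
  obtain ⟨⟨a, b, t⟩, h⟩ := Quot.exists_rep x
  exact ⟨a, b, t, h⟩

variable [TopologicalSpace A] [TopologicalSpace B]

theorem continuous_mk : Continuous fun p : A × B × I => mk p.1 p.2.1 p.2.2 :=
  continuous_quot_mk

theorem continuous_iff {W : Type*} [TopologicalSpace W] {f : TopJoin A B → W} :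
    Continuous f ↔ Continuous fun p : A × B × I => f (mk p.1 p.2.1 p.2.2) :=
  isQuotientMap_quot_mk.continuous_iff

instance [CompactSpace A] [CompactSpace B] : CompactSpace (TopJoin A B) :=
  inferInstanceAs (CompactSpace (Quot _))

/-- The last coordinate of a point of the join. -/
def param : TopJoin A B → ℝ :=
  Quot.lift (fun p => (p.2.2 : ℝ)) (by rintro _ _ (⟨⟩ | ⟨⟩) <;> rfl)

omit [TopologicalSpace A] [TopologicalSpace B] in
@[simp] theorem param_mk (a : A) (b : B) (t : I) : param (mk a b t) = t := rfl

theorem continuous_param : Continuous (param : TopJoin A B → ℝ) :=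
  continuous_iff.2 (by simp only [param_mk]; fun_prop)

/-- The real continuous functions separate points. -/
def _root_.RealSeparated (A : Type*) [TopologicalSpace A] : Prop :=
  ∀ a a' : A, a ≠ a' → ∃ f : A → ℝ, Continuous f ∧ f a ≠ f a'

theorem _root_.RealSeparated.t2Space (h : RealSeparated A) : T2Space A :=
  ⟨fun a a' haa => by
    obtain ⟨f, hf, hne⟩ := h a a' haa
    exact separated_by_continuous hf hne⟩

/-- At a common parameter `t`, functions `t * f b` and `(1 - t) * f a` descend to the join, since
the weight vanishes where the coordinate is collapsed. -/
theorem realSeparated (hA : RealSeparated A) (hB : RealSeparated B) :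
    RealSeparated (TopJoin A B) := by
  intro x y hxy
  obtain ⟨a, b, t, rfl⟩ := exists_mk x
  obtain ⟨a', b', t', rfl⟩ := exists_mk y
  by_cases ht : t = t'
  · subst ht
    rw [Ne, mk_eq_mk_iff] at hxy
    by_cases ha : a = a' ∨ t = 1
    · have hb : ¬ (b = b' ∨ t = 0) := by tauto
      push Not at hb
      obtain ⟨f, hf, hne⟩ := hB _ _ hb.1
      refine ⟨Quot.lift (fun p => (p.2.2 : ℝ) * f p.2.1) ?_, ?_, ?_⟩
      · rintro _ _ (⟨⟩ | ⟨⟩) <;> simp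
      · exact continuous_iff.2 (show Continuous fun p : A × B × I => (p.2.2 : ℝ) * f p.2.1 by
          fun_prop)
      · show (t : ℝ) * f b ≠ t * f b'
        have : (t : ℝ) ≠ 0 := fun h => hb.2 (Subtype.ext h)
        simp [hne, this]
    · push Not at ha
      obtain ⟨f, hf, hne⟩ := hA _ _ ha.1
      refine ⟨Quot.lift (fun p => (1 - (p.2.2 : ℝ)) * f p.1) ?_, ?_, ?_⟩
      · rintro _ _ (⟨⟩ | ⟨⟩) <;> simp
      · exact continuous_iff.2 (show Continuous fun p : A × B × I => (1 - (p.2.2 : ℝ)) * f p.1 by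
          fun_prop)
      · show (1 - (t : ℝ)) * f a ≠ (1 - t) * f a'
        have : (1 - (t : ℝ)) ≠ 0 := fun h => ha.2 (Subtype.ext (by simpa using (sub_eq_zero.1 h).symm))
        simp [hne, this]
  · exact ⟨param, continuous_param, fun h => ht (Subtype.ext h)⟩

end TopJoin

theorem realSeparated_of_compact {A : Type*} [TopologicalSpace A] [CompactSpace A] [T2Space A] :
    RealSeparated A := by
  intro a b hab
  obtain ⟨f, hf, hg, -⟩ := exists_continuous_zero_one_of_isClosed (isClosed_singleton (x := a))
    (isClosed_singleton (x := b)) (by simpa using hab)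
  refine ⟨f, f.continuous, ?_⟩
  rw [hf rfl, hg rfl]; simp

instance TopJoin.t2Space {A B : Type*} [TopologicalSpace A] [TopologicalSpace B]
    [CompactSpace A] [T2Space A] [CompactSpace B] [T2Space B] : T2Space (TopJoin A B) :=
  (TopJoin.realSeparated realSeparated_of_compact realSeparated_of_compact).t2Space

/-! ### Signed height on a suspension -/

namespace TopSusp
open TopJoin
variable {Y : Type*}

/-- The point of the suspension at signed height `s`, `-1 ≤ s ≤ 1`, over `y`. -/
noncomputable def sus (y : Y) (s : ℝ) : TopSusp Y :=
  if 0 ≤ s then mk y true (projIcc 0 1 zero_le_one s) else mk y false (projIcc 0 1 zero_le_one (-s))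

/-- The signed height of a point of the suspension. -/
def ht : TopSusp Y → ℝ :=
  Quot.lift (fun p => if p.2.1 then (p.2.2 : ℝ) else -p.2.2) (by rintro _ _ (⟨⟩ | ⟨⟩) <;> simp)

theorem ht_mk (y : Y) (b : Bool) (t : I) : ht (mk y b t) = if b then (t : ℝ) else -t := rfl

theorem ht_sus (y : Y) {s : ℝ} (hs : |s| ≤ 1) : ht (sus y s) = s := by
  rw [abs_le] at hs
  unfold sus
  split_ifs with h
  · simp [ht_mk, coe_projIcc, h, hs]
  · simp [ht_mk, coe_projIcc, (not_le.1 h).le, show -s ≤ 1 by linarith]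

theorem abs_ht_le (x : TopSusp Y) : |ht x| ≤ 1 := by
  obtain ⟨y, b, t, rfl⟩ := exists_mk x
  rw [ht_mk]
  split_ifs <;> simp [abs_of_nonneg t.2.1, t.2.2]

theorem sus_ht_mk (y : Y) (b : Bool) (t : I) : sus y (ht (mk y b t)) = mk y b t := by
  rw [ht_mk]
  unfold sus
  cases b
  · have := t.2.1
    by_cases h : t = 0
    · subst h; simp [mk_eq_mk_iff]
    · have h' : 0 < (t : ℝ) := lt_of_le_of_ne this (fun e => h (Subtype.ext e.symm))
      simp [h']
  · simp [t.2.1]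

theorem exists_sus (x : TopSusp Y) : ∃ y, sus y (ht x) = x := by
  obtain ⟨y, b, t, rfl⟩ := exists_mk x
  exact ⟨y, sus_ht_mk y b t⟩

theorem sus_eq_sus_iff {y y' : Y} {s s' : ℝ} (hs : |s| ≤ 1) (hs' : |s'| ≤ 1) :
    sus y s = sus y' s' ↔ s = s' ∧ (y = y' ∨ |s| = 1) := by
  constructor
  · intro h
    have h1 : s = s' := by rw [← ht_sus y hs, h, ht_sus y' hs']
    subst h1
    refine ⟨rfl, ?_⟩
    rw [abs_le] at hs
    unfold sus at h
    split_ifs at h with h0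
    · rw [mk_eq_mk_iff] at h
      refine h.2.1.imp id fun h => ?_
      have := congrArg Subtype.val h
      simp [coe_projIcc, h0, hs] at this
      rw [abs_of_nonneg h0, this]
    · rw [mk_eq_mk_iff] at h
      refine h.2.1.imp id fun h => ?_
      have := congrArg Subtype.val h
      simp [coe_projIcc, (not_le.1 h0).le, show -s ≤ 1 by linarith] at this
      rw [abs_of_neg (not_le.1 h0), this]
  · rintro ⟨rfl, h⟩
    rcases h with rfl | h
    · rfl
    · unfold sus
      rcases eq_or_eq_neg_of_abs_eq h with rfl | rfl
      · simp [mk_eq_mk_iff]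
      · simp [mk_eq_mk_iff, show ¬ ((1 : ℝ) ≤ 0) by norm_num]

theorem mem_points_iff {x : TopSusp Y} : x ∈ points Y ↔ |ht x| = 1 := by
  constructor
  · rintro ⟨y, b, rfl⟩
    rw [ht_mk]; split_ifs <;> simp
  · obtain ⟨y, b, t, rfl⟩ := exists_mk x
    intro h
    refine ⟨y, b, ?_⟩
    rw [ht_mk] at h
    have : (t : ℝ) = 1 := by
      split_ifs at h <;> simpa [abs_of_nonneg t.2.1] using h
    rw [show t = 1 from Subtype.ext this]

theorem mem_base_iff {x : TopSusp Y} : x ∈ base Y ↔ ht x = 0 := by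
  constructor
  · rintro ⟨y, b, rfl⟩
    rw [ht_mk]; split_ifs <;> simp
  · obtain ⟨y, b, t, rfl⟩ := exists_mk x
    intro h
    refine ⟨y, b, ?_⟩
    rw [ht_mk] at h
    have : (t : ℝ) = 0 := by
      split_ifs at h <;> simpa using h
    rw [show t = 0 from Subtype.ext this]

variable [TopologicalSpace Y]

theorem continuous_ht : Continuous (ht : TopSusp Y → ℝ) := by
  refine TopJoin.continuous_iff.2 ?_
  have : (fun p : Y × Bool × I => ht (mk p.1 p.2.1 p.2.2)) =
      fun p => (if p.2.1 then (1 : ℝ) else -1) * (p.2.2 : ℝ) := by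
    ext p; rw [ht_mk]; split_ifs <;> simp
  rw [this]
  have h : Continuous fun b : Bool => if b then (1 : ℝ) else -1 := continuous_of_discreteTopology
  exact (h.comp (continuous_fst.comp continuous_snd)).mul (by fun_prop)

theorem continuous_sus : Continuous fun p : Y × ℝ => sus p.1 p.2 := by
  unfold sus
  refine Continuous.if_le ?_ ?_ continuous_const continuous_snd ?_
  · exact continuous_mk.comp (f := fun p : Y × ℝ => (p.1, true, projIcc (0:ℝ) 1 zero_le_one p.2))
      (by fun_prop)
  · exact continuous_mk.comp (f := fun p : Y × ℝ => (p.1, false, projIcc (0:ℝ) 1 zero_le_one (-p.2)))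
      (by fun_prop)
  · intro p hp
    rw [mk_eq_mk_iff]; simp [← hp]

end TopSusp

/-- Serves coordinates such as the slope, which are bounded but discontinuous at the suspension
points: a factor that vanishes there restores continuity. -/
theorem continuous_mul_of_bounded {W : Type*} [TopologicalSpace W] {f φ : W → ℝ} {K : ℝ}
    (hφ : Continuous φ) (hf : ContinuousOn f {w | φ w ≠ 0}) (hb : ∀ w, |f w| ≤ K) :
    Continuous fun w => f w * φ w := by
  rw [continuous_iff_continuousAt]
  intro w
  by_cases hw : φ w = 0
  · rw [ContinuousAt, hw, mul_zero]
    refine squeeze_zero_norm (a := fun w => K * |φ w|) (fun v => ?_) ?_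
    · rw [Real.norm_eq_abs, abs_mul]
      exact mul_le_mul_of_nonneg_right (hb v) (abs_nonneg _)
    · have : Continuous fun w => K * |φ w| := by fun_prop
      simpa [hw] using this.tendsto w
  · have ho : IsOpen {w | φ w ≠ 0} := isOpen_ne_fun hφ continuous_const
    exact (hf.continuousAt (ho.mem_nhds hw)).mul hφ.continuousAt

/-! ### Geometry of the diamond -/

/-- The diamond, i.e. the suspension of an interval, with its straight coordinates. -/
abbrev Dia : Type := {d : ℝ × ℝ // |d.1| + |d.2| ≤ 1}

namespace Dia

theorem abs_fst_le (d : Dia) : |d.1.1| ≤ 1 - |d.1.2| := by linarith [d.2]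
theorem abs_snd_le (d : Dia) : |d.1.2| ≤ 1 := by linarith [d.2, abs_nonneg d.1.1]

instance : CompactSpace Dia := by
  refine isCompact_iff_compactSpace (s := {d : ℝ × ℝ | |d.1| + |d.2| ≤ 1}).1 ?_
  refine IsCompact.of_isClosed_subset (isCompact_Icc (a := ((-1, -1) : ℝ × ℝ)) (b := (1, 1)))
    (isClosed_le (by fun_prop) continuous_const) ?_
  intro d hd
  have hd : |d.1| + |d.2| ≤ 1 := hd
  have h1 := abs_le.1 (show |d.1| ≤ 1 by linarith [abs_nonneg d.2])
  have h2 := abs_le.1 (show |d.2| ≤ 1 by linarith [abs_nonneg d.1])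
  exact ⟨⟨h1.1, h2.1⟩, ⟨h1.2, h2.2⟩⟩

/-- The relative position of a point in its horizontal chord. -/
noncomputable def slope (d : ℝ × ℝ) : ℝ := d.1 / (1 - |d.2|)

theorem abs_slope_le (d : Dia) : |slope d.1| ≤ 1 := by
  unfold slope
  rw [abs_div, abs_of_nonneg (by linarith [d.abs_snd_le] : 0 ≤ 1 - |d.1.2|)]
  exact div_le_one_of_le₀ d.abs_fst_le (by linarith [d.abs_snd_le])

/-- At the suspension points the slope is `0` through division by zero; the identity survives
because the chord has length zero. -/
theorem slope_mul (d : Dia) : slope d.1 * (1 - |d.1.2|) = d.1.1 := by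
  unfold slope
  by_cases h : 1 - |d.1.2| = 0
  · have := d.abs_fst_le
    rw [h] at this ⊢
    simp [abs_nonpos_iff.1 this]
  · field_simp

theorem continuousOn_slope : ContinuousOn slope {d | |d.2| < 1} := by
  unfold slope
  refine ContinuousOn.div (by fun_prop) (by fun_prop) ?_
  intro d hd
  have : |d.2| < 1 := hd
  linarith

/-- The point of height `s` and slope `x`. -/
def chord (x s : ℝ) : ℝ × ℝ := (x * (1 - |s|), s)

theorem chord_mem {x s : ℝ} (hx : |x| ≤ 1) (hs : |s| ≤ 1) :
    |(chord x s).1| + |(chord x s).2| ≤ 1 := by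
  simp only [chord, abs_mul]
  rw [abs_of_nonneg (by linarith : 0 ≤ 1 - |s|)]
  nlinarith [abs_nonneg x]

theorem chord_slope (d : Dia) : chord (slope d.1) d.1.2 = d.1 := by
  ext
  · exact slope_mul d
  · rfl

theorem slope_chord {x s : ℝ} (hs : |s| < 1) : slope (chord x s) = x := by
  unfold slope chord
  have : 1 - |s| ≠ 0 := by linarith
  field_simp

/-- A retraction of the plane onto the diamond. -/
noncomputable def clamp (d : ℝ × ℝ) : Dia :=
  ⟨((max 1 (|d.1| + |d.2|))⁻¹ * d.1, (max 1 (|d.1| + |d.2|))⁻¹ * d.2), by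
    have h : 0 < max 1 (|d.1| + |d.2|) := lt_max_of_lt_left one_pos
    simp only [abs_mul, abs_inv, abs_of_pos h]
    rw [← mul_add, inv_mul_le_iff₀ h, mul_one]
    exact le_max_right _ _⟩

theorem clamp_coe {d : ℝ × ℝ} (h : |d.1| + |d.2| ≤ 1) : clamp d = ⟨d, h⟩ := by
  apply Subtype.ext
  simp [clamp, max_eq_left h]

theorem clamp_val {d : ℝ × ℝ} (h : |d.1| + |d.2| ≤ 1) : (clamp d).1 = d := by rw [clamp_coe h]

theorem clamp_self (d : Dia) : clamp d.1 = d := clamp_coe d.2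

theorem continuous_clamp : Continuous clamp := by
  unfold clamp
  refine Continuous.subtype_mk ?_ _
  have h : ∀ d : ℝ × ℝ, max 1 (|d.1| + |d.2|) ≠ 0 := fun d =>
    (lt_max_of_lt_left one_pos).ne'
  have : Continuous fun d : ℝ × ℝ => (max 1 (|d.1| + |d.2|))⁻¹ :=
    Continuous.inv₀ (by fun_prop) h
  fun_prop

/-- Points of the left side, the two suspension points included. -/
def IsLeft (d : ℝ × ℝ) : Prop := d.1 = -(1 - |d.2|)
/-- Points of the right side, the two suspension points included. -/
def IsRight (d : ℝ × ℝ) : Prop := d.1 = 1 - |d.2|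

theorem isClosed_isLeft : IsClosed {d : ℝ × ℝ | IsLeft d} :=
  isClosed_eq (by fun_prop) (by fun_prop)

theorem isClosed_isRight : IsClosed {d : ℝ × ℝ | IsRight d} :=
  isClosed_eq (by fun_prop) (by fun_prop)

theorem isLeft_iff {d : ℝ × ℝ} (h : |d.2| < 1) : IsLeft d ↔ slope d = -1 := by
  unfold IsLeft slope
  have : 1 - |d.2| ≠ 0 := by linarith
  rw [div_eq_iff this]; constructor <;> intro h <;> linarith

theorem isRight_iff {d : ℝ × ℝ} (h : |d.2| < 1) : IsRight d ↔ slope d = 1 := by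
  unfold IsRight slope
  have : 1 - |d.2| ≠ 0 := by linarith
  rw [div_eq_iff this]; constructor <;> intro h <;> linarith

end Dia

/-! ### The suspension of a join as a quotient of strips -/

section
open TopJoin TopSusp Dia
variable {A B : Type*}

/-- The point of the join with coordinates `a`, `b` and `x ∈ [-1,1]`. -/
noncomputable def jn (a : A) (b : B) (x : ℝ) : TopJoin A B :=
  TopJoin.mk a b (projIcc 0 1 zero_le_one ((x + 1) / 2))

/-- The canonical map onto the suspension of the join from the strips of the pairs `(a, b)`. -/
noncomputable def strip (p : A × B) (d : Dia) : TopSusp (TopJoin A B) :=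
  sus (jn p.1 p.2 (slope d.1)) d.1.2

theorem jn_eq_jn_iff {a a' : A} {b b' : B} {x x' : ℝ} (hx : |x| ≤ 1) (hx' : |x'| ≤ 1) :
    jn a b x = jn a' b' x' ↔ x = x' ∧ (a = a' ∨ x = 1) ∧ (b = b' ∨ x = -1) := by
  rw [abs_le] at hx hx'
  have key : ∀ {y : ℝ}, -1 ≤ y → y ≤ 1 →
      ((projIcc 0 1 zero_le_one ((y + 1) / 2) : I) : ℝ) = (y + 1) / 2 := by
    intro y h1 h2
    rw [projIcc_of_mem zero_le_one ⟨by linarith, by linarith⟩]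
  unfold jn
  rw [mk_eq_mk_iff, ← Subtype.coe_inj, ← Subtype.coe_inj, ← Subtype.coe_inj (b := (0 : I)),
    key hx.1 hx.2, key hx'.1 hx'.2]
  simp only [Icc.coe_one, Icc.coe_zero]
  refine and_congr ⟨fun h => by linarith, fun h => by rw [h]⟩
    (and_congr (or_congr_right ⟨fun h => by linarith, fun h => by rw [h]; norm_num⟩)
    (or_congr_right ⟨fun h => by linarith, fun h => by rw [h]; norm_num⟩))

/-- The join forgets `a` at slope `1` and `b` at slope `-1`. The suspension points lie on both
sides, so one formula also covers the total collapse there. -/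
theorem strip_eq_strip_iff {p p' : A × B} {d d' : Dia} :
    strip p d = strip p' d' ↔
      d = d' ∧ (p.1 = p'.1 ∨ IsRight d.1) ∧ (p.2 = p'.2 ∨ IsLeft d.1) := by
  unfold strip
  rw [sus_eq_sus_iff d.abs_snd_le d'.abs_snd_le, jn_eq_jn_iff d.abs_slope_le d'.abs_slope_le]
  by_cases h : |d.1.2| = 1
  · have h1 : IsLeft d.1 := by
      have := d.abs_fst_le
      rw [h, sub_self, abs_nonpos_iff] at this
      simp [IsLeft, h, this]
    have h2 : IsRight d.1 := by
      have := d.abs_fst_le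
      rw [h, sub_self, abs_nonpos_iff] at this
      simp [IsRight, h, this]
    simp only [h, or_true, and_true, h1, h2]
    refine ⟨fun e => ?_, fun e => by rw [e]⟩
    rw [← Subtype.coe_inj, ← chord_slope d, ← chord_slope d', chord, chord, ← e, h]
    simp
  · have h' := lt_of_le_of_ne d.abs_snd_le h
    rw [isLeft_iff h', isRight_iff h']
    simp only [h, or_false]
    constructor
    · rintro ⟨h1, h2, h3⟩
      refine ⟨?_, h3⟩
      rw [← Subtype.coe_inj, ← chord_slope d, ← chord_slope d', h1, h2]
    · rintro ⟨rfl, h3⟩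
      exact ⟨rfl, rfl, h3⟩

theorem ht_strip (p : A × B) (d : Dia) : ht (strip p d) = d.1.2 := ht_sus _ d.abs_snd_le

theorem exists_strip (x : TopSusp (TopJoin A B)) : ∃ p d, strip p d = x := by
  obtain ⟨y, hy⟩ := exists_sus x
  obtain ⟨a, b, t, rfl⟩ := exists_mk y
  have hx := abs_ht_le x
  have ht' : |2 * (t : ℝ) - 1| ≤ 1 := by
    rw [abs_le]; constructor <;> linarith [t.2.1, t.2.2]
  refine ⟨(a, b), ⟨chord (2 * t - 1) (ht x), chord_mem ht' hx⟩, ?_⟩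
  rcases hx.lt_or_eq with h | h
  · unfold strip jn
    simp only [slope_chord h]
    have : (2 * (t : ℝ) - 1 + 1) / 2 = t := by ring
    rw [this, projIcc_val]
    exact hy
  · unfold strip
    refine Eq.trans ?_ hy
    rw [sus_eq_sus_iff (by simpa [chord] using hx) hx]
    simp [chord, h]

/-- The coordinates in the diamond of a point of the suspension of a join. -/
noncomputable def coord (x : TopSusp (TopJoin A B)) : Dia := (exists_strip x).choose_spec.choose

theorem coord_strip (p : A × B) (d : Dia) : coord (strip p d) = d :=
  (strip_eq_strip_iff.1 (exists_strip (strip p d)).choose_spec.choose_spec).1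

theorem coord_snd (x : TopSusp (TopJoin A B)) : (coord x).1.2 = ht x := by
  obtain ⟨p, d, rfl⟩ := exists_strip x
  rw [coord_strip, ht_strip]

theorem surjective_strip :
    Function.Surjective fun q : (A × B) × Dia => strip q.1 q.2 := fun x => by
  obtain ⟨p, d, h⟩ := exists_strip x
  exact ⟨(p, d), h⟩

variable [TopologicalSpace A] [TopologicalSpace B]

theorem continuous_jn : Continuous fun p : A × B × ℝ => jn p.1 p.2.1 p.2.2 :=
  continuous_mk.comp (f := fun p : A × B × ℝ =>
    (p.1, p.2.1, projIcc (0 : ℝ) 1 zero_le_one ((p.2.2 + 1) / 2))) (by fun_prop)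

variable [CompactSpace A] [T2Space A] [CompactSpace B] [T2Space B]

/-- The slope is discontinuous at the suspension points. Pulled back along the quotient map `κ` from
rectangles in slope and height, `strip` becomes visibly continuous, because the slope does not
matter over the suspension points. -/
theorem continuous_strip :
    Continuous fun q : (A × B) × Dia => strip q.1 q.2 := by
  let J := Icc (-1 : ℝ) 1
  let κ : (A × B) × J × J → (A × B) × Dia := fun q =>
    (q.1, ⟨chord q.2.1 q.2.2, chord_mem (abs_le.2 q.2.1.2) (abs_le.2 q.2.2.2)⟩)
  have hκ : Continuous κ := by
    refine continuous_fst.prodMk (Continuous.subtype_mk ?_ _)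
    unfold chord; fun_prop
  have hs : Function.Surjective κ := by
    rintro ⟨p, d⟩
    refine ⟨(p, ⟨slope d.1, abs_le.1 d.abs_slope_le⟩, ⟨d.1.2, abs_le.1 d.abs_snd_le⟩), ?_⟩
    exact Prod.ext rfl (Subtype.ext (chord_slope d))
  have hq : IsQuotientMap κ := hκ.isClosedMap.isQuotientMap hκ hs
  rw [hq.continuous_iff]
  have : (fun q : (A × B) × Dia => strip q.1 q.2) ∘ κ = fun q =>
      sus (jn q.1.1 q.1.2 q.2.1) (q.2.2 : ℝ) := by
    ext ⟨p, x, s⟩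
    have hs1 : |(s : ℝ)| ≤ 1 := abs_le.2 s.2
    simp only [Function.comp, strip, κ]
    rw [sus_eq_sus_iff (by simpa [chord] using hs1) hs1]
    rcases hs1.lt_or_eq with h | h
    · rw [slope_chord h]; exact ⟨rfl, Or.inl rfl⟩
    · exact ⟨rfl, Or.inr h⟩
  rw [this]
  exact continuous_sus.comp ((continuous_jn.comp
    (f := fun q : (A × B) × J × J => (q.1.1, q.1.2, (q.2.1 : ℝ))) (by fun_prop)).prodMk
    (by fun_prop : Continuous fun q : (A × B) × J × J => (q.2.2 : ℝ)))

theorem isClosedMap_strip : IsClosedMap fun q : (A × B) × Dia => strip q.1 q.2 :=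
  continuous_strip.isClosedMap

theorem isQuotientMap_strip : IsQuotientMap fun q : (A × B) × Dia => strip q.1 q.2 :=
  isClosedMap_strip.isQuotientMap continuous_strip surjective_strip

theorem continuous_coord : Continuous (coord : TopSusp (TopJoin A B) → Dia) := by
  rw [isQuotientMap_strip.continuous_iff]
  have : (coord : TopSusp (TopJoin A B) → Dia) ∘ (fun q : (A × B) × Dia => strip q.1 q.2) =
    fun q => q.2 := by ext1 q; exact coord_strip _ _
  rw [this]; exact continuous_snd

end

/-! ### Two local invariants of points -/

section
variable {X X' : Type*} [TopologicalSpace X] [TopologicalSpace X']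

/-- The set `K` is weakly locally connected at `x`. -/
def ConnectedImKleinen (K : Set X) (x : X) : Prop :=
  ∀ V ∈ 𝓝 x, ∃ C ⊆ V, IsPreconnected C ∧ C ∈ 𝓝[K] x

theorem ConnectedImKleinen.image {K : Set X} {x : X} (h : ConnectedImKleinen K x) (f : X ≃ₜ X') :
    ConnectedImKleinen (f '' K) (f x) := by
  intro V hV
  obtain ⟨C, hCV, hC, hCx⟩ := h (f ⁻¹' V) (f.continuous.continuousAt hV)
  refine ⟨f '' C, image_subset_iff.2 hCV, hC.image _ f.continuous.continuousOn, ?_⟩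
  rw [← f.isEmbedding.map_nhdsWithin_eq]
  exact image_mem_map hCx

/-- The point `x` has a neighborhood such that the component of `x` in it is locally connected. -/
def HasLocConnectedLeaf (x : X) : Prop :=
  ∃ U ∈ 𝓝 x, ∀ y ∈ connectedComponentIn U x, ConnectedImKleinen (connectedComponentIn U x) y

theorem HasLocConnectedLeaf.map {x : X} (h : HasLocConnectedLeaf x) (f : X ≃ₜ X') :
    HasLocConnectedLeaf (f x) := by
  obtain ⟨U, hU, h⟩ := h
  refine ⟨f '' U, f.isOpenMap.image_mem_nhds hU, ?_⟩
  rw [← f.image_connectedComponentIn (mem_of_mem_nhds hU)]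
  rintro _ ⟨y, hy, rfl⟩
  exact (h y hy).image f

theorem hasLocConnectedLeaf_map_iff {x : X} (f : X ≃ₜ X') :
    HasLocConnectedLeaf (f x) ↔ HasLocConnectedLeaf x :=
  ⟨fun h => by simpa using h.map f.symm, fun h => h.map f⟩

/-- A connected neighbourhood inside `O` has a one-point image in `D`, although it contains `g c'`
for some `c' ≠ c` close to `c`. -/
theorem not_connectedImKleinen_of_projection {D : Type*} [TopologicalSpace D]
    [TotallyDisconnectedSpace D] {K : Set X} {g : D → X} {c : D} [(𝓝[≠] c).NeBot]
    (hg : ContinuousAt g c) (hK : ∀ c, g c ∈ K) {O : Set X} (hO : O ∈ 𝓝 (g c)) {pr : X → D}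
    (hpr : ContinuousOn pr O) (hprg : ∀ c, pr (g c) = c) : ¬ ConnectedImKleinen K (g c) := by
  intro h
  obtain ⟨C, hCO, hC, hCx⟩ := h O hO
  have hsub := (hC.image pr (hpr.mono hCO)).subsingleton
  have h1 : ∀ᶠ c' in 𝓝 c, g c' ∈ C :=
    (tendsto_nhdsWithin_iff.2 ⟨hg, Eventually.of_forall hK⟩).eventually hCx
  obtain ⟨c', hc', hne⟩ := ((h1.filter_mono nhdsWithin_le_nhds).and
    (self_mem_nhdsWithin : ∀ᶠ c' in 𝓝[≠] c, c' ∈ ({c}ᶜ : Set D))).exists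
  refine hne ?_
  rw [mem_singleton_iff, ← hprg c', ← hprg c]
  exact hsub ⟨_, hc', rfl⟩ ⟨_, h1.self_of_nhds, rfl⟩

end

namespace TopSusp

/-- The caps around a suspension point are unions of segments ending there, hence connected;
compactness of `Y` makes them arbitrarily small. -/
theorem connectedImKleinen_of_mem_points {Y : Type*} [TopologicalSpace Y] [CompactSpace Y]
    {x : TopSusp Y} (hx : x ∈ points Y) : ConnectedImKleinen univ x := by
  intro V hV
  rw [mem_points_iff] at hx
  obtain ⟨ε, hε⟩ : ∃ ε, ht x = ε := ⟨_, rfl⟩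
  rw [hε] at hx
  have hεε : ε * ε = 1 := by rw [← abs_mul_abs_self, hx, one_mul]
  have hsus : ∀ y, sus y ε = x := by
    intro y
    obtain ⟨y', h⟩ := exists_sus x
    rw [← h, hε, sus_eq_sus_iff hx.le hx.le]
    exact ⟨rfl, Or.inr hx⟩
  -- On the compact complement of `interior V` the maximum of `ε * ht` is below `1`, since the value
  -- `1` is taken only at `x`.
  obtain ⟨δ, hδ, hδV⟩ : ∃ δ < 1, ∀ x', δ < ε * ht x' → x' ∈ V := by
    have hcomp : IsCompact (interior V)ᶜ := isOpen_interior.isClosed_compl.isCompact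
    have hcont : Continuous fun x' : TopSusp Y => ε * ht x' := continuous_const.mul continuous_ht
    rcases ((interior V)ᶜ).eq_empty_or_nonempty with he | hne
    · refine ⟨0, one_pos, fun x' _ => interior_subset (s := V) ?_⟩
      rw [compl_empty_iff.1 he]; trivial
    · obtain ⟨m, hm, hmax⟩ := hcomp.exists_isMaxOn hne hcont.continuousOn
      have hle : ε * ht m ≤ 1 := by
        refine (le_abs_self _).trans ?_
        rw [abs_mul, hx, one_mul]; exact abs_ht_le m
      refine ⟨ε * ht m, lt_of_le_of_ne hle fun h => hm ?_, fun x' hx' => ?_⟩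
      · have : ht m = ε := by
          have := congrArg (fun u => ε * u) h
          simpa [← mul_assoc, hεε] using this
        obtain ⟨y, hy⟩ := exists_sus m
        rw [← hy, this, hsus y]
        exact mem_interior_iff_mem_nhds.2 hV
      · by_contra hc
        exact absurd (hmax (fun h => hc (interior_subset h))) (not_le.2 hx')
  refine ⟨{x' | δ < ε * ht x'}, hδV, ?_, ?_⟩
  · refine isPreconnected_of_forall x fun x' hx' => ?_
    obtain ⟨y, hy⟩ := exists_sus x'
    have hx1 := abs_ht_le x'
    refine ⟨sus y '' segment ℝ (ht x') ε, ?_, ⟨ε, right_mem_segment _ _ _, hsus y⟩,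
      ⟨ht x', left_mem_segment _ _ _, hy⟩, ?_⟩
    · rintro _ ⟨s, ⟨a, b, ha, hb, hab, rfl⟩, rfl⟩
      have hs : |a • ht x' + b • ε| ≤ 1 := by
        refine (abs_add_le _ _).trans ?_
        simp only [smul_eq_mul, abs_mul, abs_of_nonneg ha, abs_of_nonneg hb, hx]
        nlinarith
      rw [mem_ofPred_eq, ht_sus y hs, smul_eq_mul, smul_eq_mul]
      have : δ < ε * ht x' := hx'
      have e : ε * (a * ht x' + b * ε) = a * (ε * ht x') + b * (ε * ε) := by ring
      rw [e, hεε]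
      rcases ha.eq_or_lt with rfl | ha
      · simp at hab; subst hab; simpa using hδ
      · nlinarith
    · exact (convex_segment _ _).isPreconnected.image _
        (continuous_sus.comp (Continuous.prodMk_right y)).continuousOn
  · rw [nhdsWithin_univ]
    refine (isOpen_lt continuous_const (continuous_const.mul continuous_ht)).mem_nhds ?_
    show δ < ε * ht x
    rw [hε, hεε]; exact hδ

end TopSusp

/-! ### The invariants in the strips -/

section
open TopJoin TopSusp Dia
variable {A B : Type*}

/-- The coordinate in the first factor, away from the right side. -/
noncomputable def pr₁ (x : TopSusp (TopJoin A B)) : A := (exists_strip x).choose.1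
/-- The coordinate in the second factor, away from the left side. -/
noncomputable def pr₂ (x : TopSusp (TopJoin A B)) : B := (exists_strip x).choose.2

theorem pr₁_strip (p : A × B) {d : Dia} (h : ¬ IsRight d.1) : pr₁ (strip p d) = p.1 := by
  have := (exists_strip (strip p d)).choose_spec.choose_spec
  rw [eq_comm, strip_eq_strip_iff] at this
  exact (this.2.1.resolve_right h).symm

theorem pr₂_strip (p : A × B) {d : Dia} (h : ¬ IsLeft d.1) : pr₂ (strip p d) = p.2 := by
  have := (exists_strip (strip p d)).choose_spec.choose_spec
  rw [eq_comm, strip_eq_strip_iff] at this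
  exact (this.2.2.resolve_right h).symm

variable [TopologicalSpace A] [TopologicalSpace B]
variable [CompactSpace A] [T2Space A] [CompactSpace B] [T2Space B]

theorem continuousOn_pr₁ :
    ContinuousOn (pr₁ : TopSusp (TopJoin A B) → A) {x | ¬ IsRight (coord x).1} := by
  rw [continuousOn_iff_isClosed]
  intro K hK
  refine ⟨_, isClosedMap_strip _ (hK.preimage (continuous_fst.comp continuous_fst)), ?_⟩
  ext x
  obtain ⟨p, d, rfl⟩ := exists_strip x
  simp only [mem_inter_iff, mem_preimage, mem_ofPred_eq, coord_strip, mem_image, Prod.exists]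
  refine and_congr_left fun h => ?_
  rw [pr₁_strip _ h]
  constructor
  · exact fun hp => ⟨p.1, p.2, d, hp, rfl⟩
  · rintro ⟨a, b, d', ha, he⟩
    obtain ⟨rfl, h1, -⟩ := strip_eq_strip_iff.1 he
    rw [← h1.resolve_right h]; exact ha

theorem continuousOn_pr₂ :
    ContinuousOn (pr₂ : TopSusp (TopJoin A B) → B) {x | ¬ IsLeft (coord x).1} := by
  rw [continuousOn_iff_isClosed]
  intro K hK
  refine ⟨_, isClosedMap_strip _ (hK.preimage (continuous_snd.comp continuous_fst)), ?_⟩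
  ext x
  obtain ⟨p, d, rfl⟩ := exists_strip x
  simp only [mem_inter_iff, mem_preimage, mem_ofPred_eq, coord_strip, mem_image, Prod.exists]
  refine and_congr_left fun h => ?_
  rw [pr₂_strip _ h]
  constructor
  · exact fun hp => ⟨p.1, p.2, d, hp, rfl⟩
  · rintro ⟨a, b, d', ha, he⟩
    obtain ⟨rfl, -, h1⟩ := strip_eq_strip_iff.1 he
    rw [← h1.resolve_right h]; exact ha

theorem isOpen_not_isRight : IsOpen {x : TopSusp (TopJoin A B) | ¬ IsRight (coord x).1} :=
  (isClosed_isRight.preimage (continuous_subtype_val.comp continuous_coord)).isOpen_compl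

theorem isOpen_not_isLeft : IsOpen {x : TopSusp (TopJoin A B) | ¬ IsLeft (coord x).1} :=
  (isClosed_isLeft.preimage (continuous_subtype_val.comp continuous_coord)).isOpen_compl

theorem Dia.not_isLeft_and_isRight {d : ℝ × ℝ} (h : |d.2| < 1) : ¬ (IsLeft d ∧ IsRight d) := by
  rintro ⟨h1, h2⟩
  unfold IsLeft at h1; unfold IsRight at h2; linarith

theorem Dia.lt_one_iff {d : Dia} : |d.1.1| + |d.1.2| < 1 ↔ ¬ IsLeft d.1 ∧ ¬ IsRight d.1 := by
  have hd := d.abs_fst_le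
  have h2 := abs_le.1 hd
  constructor
  · intro h
    have h' := abs_lt.1 (show |d.1.1| < 1 - |d.1.2| by linarith)
    exact ⟨fun e => by unfold IsLeft at e; linarith, fun e => by unfold IsRight at e; linarith⟩
  · rintro ⟨h1, h3⟩
    have : |d.1.1| < 1 - |d.1.2| := abs_lt.2
      ⟨lt_of_le_of_ne h2.1 fun e => h1 e.symm, lt_of_le_of_ne h2.2 h3⟩
    linarith

variable [TotallyDisconnectedSpace A] [TotallyDisconnectedSpace B]

/-- On the union of the open diamonds, `pr₁` and `pr₂` are continuous with totally disconnected
values. So a component lies in a single diamond, and local connectedness of the plane suffices. -/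
theorem hasLocConnectedLeaf_strip {p : A × B} {d : Dia} (hd : |d.1.1| + |d.1.2| < 1) :
    HasLocConnectedLeaf (strip p d) := by
  set U : Set (TopSusp (TopJoin A B)) := {x | |(coord x).1.1| + |(coord x).1.2| < 1} with hU
  have hUo : IsOpen U := by
    have := continuous_subtype_val.comp (continuous_coord (A := A) (B := B))
    exact isOpen_lt (f := fun x => |(coord x).1.1| + |(coord x).1.2|) (by fun_prop) continuous_const
  have hdU : strip p d ∈ U := by simpa [hU, coord_strip] using hd
  refine ⟨U, hUo.mem_nhds hdU, ?_⟩
  set K := connectedComponentIn U (strip p d) with hK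
  have hKU : K ⊆ U := connectedComponentIn_subset _ _
  have hpK : strip p d ∈ K := mem_connectedComponentIn hdU
  have hKp : ∀ y ∈ K, strip p (coord y) = y := by
    intro y hy
    have hKc : IsPreconnected K := isPreconnected_connectedComponentIn
    have hlr : ∀ y ∈ K, ¬ IsLeft (coord y).1 ∧ ¬ IsRight (coord y).1 :=
      fun y hy => lt_one_iff.1 (hKU hy)
    have h1 := (hKc.image _ (continuousOn_pr₁.mono fun y hy => (hlr y hy).2)).subsingleton
      ⟨_, hpK, rfl⟩ ⟨_, hy, rfl⟩
    have h2 := (hKc.image _ (continuousOn_pr₂.mono fun y hy => (hlr y hy).1)).subsingleton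
      ⟨_, hpK, rfl⟩ ⟨_, hy, rfl⟩
    have hd' := lt_one_iff.1 hd
    have hy' := hlr y hy
    rw [pr₁_strip _ hd'.2] at h1
    rw [pr₂_strip _ hd'.1] at h2
    obtain ⟨p', d', rfl⟩ := exists_strip y
    rw [coord_strip] at hy' ⊢
    rw [pr₁_strip _ hy'.2] at h1
    rw [pr₂_strip _ hy'.1] at h2
    rw [show p = p' from Prod.ext h1 h2]
  intro y hy V hV
  have hc : Continuous fun z : ℝ × ℝ => strip p (clamp z) :=
    (continuous_strip (A := A) (B := B)).comp (continuous_const.prodMk continuous_clamp)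
  have hy0 : strip p (clamp (coord y).1) = y := by rw [clamp_self, hKp y hy]
  have hV' : (fun z : ℝ × ℝ => strip p (clamp z)) ⁻¹' V ∈ 𝓝 (coord y).1 :=
    hc.continuousAt (by rw [hy0]; exact hV)
  obtain ⟨ε, hε, hball⟩ := Metric.mem_nhds_iff.1 hV'
  -- The image of the ball may leave `U`. This is allowed: `ConnectedImKleinen` does not ask the
  -- connected set to lie in `K`.
  refine ⟨(fun z : ℝ × ℝ => strip p (clamp z)) '' (Metric.ball (coord y).1 ε), image_subset_iff.2 hball,
    (convex_ball _ _).isPreconnected.image _ hc.continuousOn, ?_⟩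
  have hnhd : (fun x => (coord x).1) ⁻¹' Metric.ball (coord y).1 ε ∈ 𝓝 y :=
    (continuous_subtype_val.comp continuous_coord).continuousAt (Metric.ball_mem_nhds _ hε)
  filter_upwards [nhdsWithin_le_nhds hnhd, self_mem_nhdsWithin] with z hz hzK
  exact ⟨_, hz, by simp only; rw [clamp_self, hKp z hzK]⟩

end

section
open TopJoin TopSusp Dia
variable {A B : Type*} [TopologicalSpace A] [TopologicalSpace B]
variable [CompactSpace A] [T2Space A] [CompactSpace B] [T2Space B]
variable [TotallyDisconnectedSpace A] [TotallyDisconnectedSpace B]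

/-- Off the suspension points at least one side is missed, so `pr₁` or `pr₂` is continuous nearby
and varies in a factor without isolated points. -/
theorem not_connectedImKleinen_strip [∀ a : A, (𝓝[≠] a).NeBot] [∀ b : B, (𝓝[≠] b).NeBot]
    {p : A × B} {d : Dia} (hd : |d.1.2| < 1) : ¬ ConnectedImKleinen univ (strip p d) := by
  by_cases hr : IsRight d.1
  · have hl : ¬ IsLeft d.1 := fun h => not_isLeft_and_isRight hd ⟨h, hr⟩
    refine not_connectedImKleinen_of_projection (g := fun b => strip (p.1, b) d) (c := p.2)
      (O := {x | ¬ IsLeft (coord x).1}) (pr := pr₂) ?_ (fun _ => mem_univ _)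
      (isOpen_not_isLeft.mem_nhds (by simpa [coord_strip] using hl)) continuousOn_pr₂
      fun b => pr₂_strip _ hl
    exact (continuous_strip.comp (f := fun b => ((p.1, b), d)) (by fun_prop)).continuousAt
  · refine not_connectedImKleinen_of_projection (g := fun a => strip (a, p.2) d) (c := p.1)
      (O := {x | ¬ IsRight (coord x).1}) (pr := pr₁) ?_ (fun _ => mem_univ _)
      (isOpen_not_isRight.mem_nhds (by simpa [coord_strip] using hr)) continuousOn_pr₁
      fun b => pr₁_strip _ hr
    exact (continuous_strip.comp (f := fun a => ((a, p.2), d)) (by fun_prop)).continuousAt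

theorem connectedImKleinen_univ_iff [∀ a : A, (𝓝[≠] a).NeBot] [∀ b : B, (𝓝[≠] b).NeBot]
    {x : TopSusp (TopJoin A B)} : ConnectedImKleinen univ x ↔ x ∈ points (TopJoin A B) := by
  refine ⟨fun h => ?_, connectedImKleinen_of_mem_points⟩
  obtain ⟨p, d, rfl⟩ := exists_strip x
  rw [mem_points_iff, ht_strip]
  exact (d.abs_snd_le.lt_or_eq).resolve_left fun hd => not_connectedImKleinen_strip hd h

-- The maps `g c` are the pages of a book through `e`. A component of a neighbourhood of `e`
-- contains nearby points of all pages, and at such a point inside an open diamond `pr` refutes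
-- local connectedness.
omit [TotallyDisconnectedSpace A] [TotallyDisconnectedSpace B] in
theorem not_hasLocConnectedLeaf_of_book {C : Type*} [TopologicalSpace C] [CompactSpace C]
    [TotallyDisconnectedSpace C] (c₀ : C) [(𝓝[≠] c₀).NeBot] {g : C → Dia → TopSusp (TopJoin A B)}
    (hg : Continuous fun q : C × Dia => g q.1 q.2) {e : TopSusp (TopJoin A B)} {d₀ : Dia}
    (hd₀ : ∀ c, g c d₀ = e) (hco : ∀ c d, coord (g c d) = d) {pr : TopSusp (TopJoin A B) → C}
    (hpr : ContinuousOn pr {x | |(coord x).1.1| + |(coord x).1.2| < 1})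
    (hprg : ∀ c (d : Dia), |d.1.1| + |d.1.2| < 1 → pr (g c d) = c) : ¬ HasLocConnectedLeaf e := by
  rintro ⟨U, hU, h⟩
  have ho : IsOpen {q : C × Dia | g q.1 q.2 ∈ interior U} := isOpen_interior.preimage hg
  -- Compactness of `C` gives one neighbourhood `v` of `d₀` that fits into `U` on all pages.
  obtain ⟨u, v, -, hv, hu, hdv, huv⟩ := generalized_tube_lemma (s := (univ : Set C)) isCompact_univ
    (t := {d₀}) isCompact_singleton ho (by
      rintro ⟨c, d⟩ ⟨-, hd⟩
      obtain rfl : d = d₀ := hd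
      show g c d ∈ interior U
      rw [hd₀ c]; exact mem_interior_iff_mem_nhds.2 hU)
  have hv' : clamp ⁻¹' v ∈ 𝓝 d₀.1 :=
    (hv.preimage continuous_clamp).mem_nhds (by
      show clamp d₀.1 ∈ v
      rw [clamp_self]; exact hdv rfl)
  obtain ⟨ε, hε, hball⟩ := Metric.mem_nhds_iff.1 hv'
  have hlim : Tendsto (fun t : ℝ => t • d₀.1) (𝓝[<] 1) (𝓝 d₀.1) := by
    have : Continuous fun t : ℝ => t • d₀.1 := by fun_prop
    simpa using (this.tendsto 1).mono_left (nhdsWithin_le_nhds (s := Iio 1))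
  obtain ⟨t, ht, ht1, ht0⟩ := ((hlim.eventually (Metric.ball_mem_nhds _ hε)).and
    ((eventually_mem_nhdsWithin (a := (1 : ℝ)) (s := Iio 1)).and
      ((lt_mem_nhds (zero_lt_one (α := ℝ))).filter_mono nhdsWithin_le_nhds))).exists
  have hN : |(t • d₀.1).1| + |(t • d₀.1).2| < 1 := by
    simp only [Prod.smul_fst, Prod.smul_snd, smul_eq_mul, abs_mul, ← mul_add]
    rw [abs_of_pos ht0]
    have : t < 1 := ht1
    nlinarith [d₀.2, abs_nonneg d₀.1.1, abs_nonneg d₀.1.2]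
  have hcl := clamp_val hN.le
  have heU : e ∈ U := mem_of_mem_nhds hU
  have hmem : ∀ c, g c (clamp (t • d₀.1)) ∈ connectedComponentIn U e := by
    intro c
    have hcont : Continuous fun z => g c (clamp z) :=
      hg.comp (continuous_const.prodMk continuous_clamp)
    refine ((convex_ball d₀.1 ε).isPreconnected.image _ hcont.continuousOn).subset_connectedComponentIn
      ⟨d₀.1, Metric.mem_ball_self hε, by simp only; rw [clamp_self, hd₀]⟩ ?_ ⟨_, ht, rfl⟩
    rintro _ ⟨z, hz, rfl⟩
    exact interior_subset (huv (mk_mem_prod (hu (mem_univ c)) (hball hz)))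
  have hsub := continuous_subtype_val.comp (continuous_coord (A := A) (B := B))
  have hUo : IsOpen {x : TopSusp (TopJoin A B) | |(coord x).1.1| + |(coord x).1.2| < 1} :=
    isOpen_lt (f := fun x => |(coord x).1.1| + |(coord x).1.2|) (by fun_prop) continuous_const
  refine not_connectedImKleinen_of_projection (g := fun c => g c (clamp (t • d₀.1))) (c := c₀)
    (hg.comp (f := fun c => (c, clamp (t • d₀.1))) (by fun_prop)).continuousAt
    hmem (hUo.mem_nhds ?_) hpr (fun c => hprg c _ (by rwa [hcl])) (h _ (hmem c₀))
  show |(coord (g c₀ _)).1.1| + |(coord (g c₀ _)).1.2| < 1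
  rw [hco, hcl]; exact hN

theorem hasLocConnectedLeaf_strip_iff [∀ a : A, (𝓝[≠] a).NeBot] [∀ b : B, (𝓝[≠] b).NeBot]
    {p : A × B} {d : Dia} : HasLocConnectedLeaf (strip p d) ↔ |d.1.1| + |d.1.2| < 1 := by
  refine ⟨fun h => ?_, hasLocConnectedLeaf_strip⟩
  by_contra hd
  rw [lt_one_iff, ← not_or, not_not] at hd
  rcases hd with hl | hr
  · refine not_hasLocConnectedLeaf_of_book p.2 (g := fun b d => strip (p.1, b) d) ?_ (d₀ := d) ?_
      (fun _ _ => coord_strip _ _) (continuousOn_pr₂.mono fun x hx => (lt_one_iff.1 hx).1)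
      (fun c d hd => pr₂_strip _ (lt_one_iff.1 hd).1) h
    · exact continuous_strip.comp (f := fun q : B × Dia => ((p.1, q.1), q.2)) (by fun_prop)
    · exact fun c => strip_eq_strip_iff.2 ⟨rfl, Or.inl rfl, Or.inr hl⟩
  · refine not_hasLocConnectedLeaf_of_book p.1 (g := fun a d => strip (a, p.2) d) ?_ (d₀ := d) ?_
      (fun _ _ => coord_strip _ _) (continuousOn_pr₁.mono fun x hx => (lt_one_iff.1 hx).2)
      (fun c d hd => pr₁_strip _ (lt_one_iff.1 hd).2) h
    · exact continuous_strip.comp (f := fun q : A × Dia => ((q.1, p.2), q.2)) (by fun_prop)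
    · exact fun c => strip_eq_strip_iff.2 ⟨rfl, Or.inr hr, Or.inl rfl⟩

end

/-! ### Sliding along the lines of a suspension -/

namespace TopSusp
variable {Y : Type*}

theorem one_add_mul_pos {a s : ℝ} (ha : |a| < 1) (hs : |s| ≤ 1) : 0 < 1 + a * s := by
  have : |a * s| < 1 := by
    rw [abs_mul]; nlinarith [abs_nonneg a, abs_nonneg s]
  linarith [(abs_lt.1 this).1]

/-- For `|a| < 1` this Möbius map is a bijection of `[-1, 1]` that fixes both ends and carries `-a`
to `0`; its inverse has parameter `-a`. Hence every interior level of a suspension can be slid to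
the base. -/
theorem abs_mobius_le {a s : ℝ} (ha : |a| < 1) (hs : |s| ≤ 1) : |(s + a) / (1 + a * s)| ≤ 1 := by
  have h := one_add_mul_pos ha hs
  rw [abs_lt] at ha
  rw [abs_le] at hs
  rw [abs_le, le_div_iff₀ h, div_le_iff₀ h]
  constructor <;> nlinarith

theorem mobius_of_abs_eq_one {a s : ℝ} (ha : |a| < 1) (hs : |s| = 1) :
    (s + a) / (1 + a * s) = s := by
  have h := one_add_mul_pos ha hs.le
  have h2 : s * s = 1 := by rw [← abs_mul_abs_self, hs, one_mul]
  rw [div_eq_iff h.ne']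
  linear_combination -a * h2

theorem mobius_mobius {a s : ℝ} (ha : |a| < 1) (hs : |s| ≤ 1) :
    ((s + a) / (1 + a * s) + -a) / (1 + -a * ((s + a) / (1 + a * s))) = s := by
  have h := one_add_mul_pos ha hs
  have h2 := one_add_mul_pos (a := -a) (by rwa [abs_neg]) (abs_mobius_le ha hs)
  rw [div_eq_iff h2.ne']
  have h3 := div_mul_cancel₀ (s + a) h.ne'
  linear_combination h3

/-- The translation of the suspension coordinate with parameter `a`. -/
noncomputable def shift (a : ℝ) (ha : |a| < 1) : TopSusp Y → TopSusp Y :=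
  Quot.lift (fun p => sus p.1 ((ht (TopJoin.mk p.1 p.2.1 p.2.2) + a) /
    (1 + a * ht (TopJoin.mk p.1 p.2.1 p.2.2)))) (by
    rintro _ _ (⟨y, b, c⟩ | ⟨y, y', b⟩)
    · simp only [ht_mk]; simp
    · have h : ht (TopJoin.mk y b 1) = ht (TopJoin.mk y' b 1) := by simp only [ht_mk]
      have h1 : |ht (TopJoin.mk y b 1)| = 1 := mem_points_iff.1 ⟨y, b, rfl⟩
      simp only [← h, mobius_of_abs_eq_one ha h1]
      exact (sus_eq_sus_iff h1.le h1.le).2 ⟨rfl, Or.inr h1⟩)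

theorem shift_sus {a : ℝ} (ha : |a| < 1) (y : Y) {s : ℝ} (hs : |s| ≤ 1) :
    shift a ha (sus y s) = sus y ((s + a) / (1 + a * s)) := by
  have key : ∀ b t, shift a ha (TopJoin.mk y b t) = sus y ((ht (TopJoin.mk y b t) + a) /
    (1 + a * ht (TopJoin.mk y b t))) := fun _ _ => rfl
  have h := ht_sus y hs
  unfold sus at h
  conv_lhs => unfold sus
  split_ifs at h ⊢ <;> rw [key, h]

theorem shift_neg_shift {a : ℝ} (ha : |a| < 1) (ha' : |-a| < 1) (x : TopSusp Y) :
    shift (-a) ha' (shift a ha x) = x := by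
  obtain ⟨y, h⟩ := exists_sus x
  have hx := abs_ht_le x
  rw [← h, shift_sus ha y hx, shift_sus ha' y (abs_mobius_le ha hx), mobius_mobius ha hx]

variable [TopologicalSpace Y]

theorem continuous_shift {a : ℝ} (ha : |a| < 1) : Continuous (shift a ha : TopSusp Y → _) := by
  refine TopJoin.continuous_iff.2 ?_
  have h : Continuous fun p : Y × Bool × I => ht (TopJoin.mk p.1 p.2.1 p.2.2) :=
    continuous_ht.comp TopJoin.continuous_mk
  refine continuous_sus.comp (f := fun p : Y × Bool × I => (p.1,
    (ht (TopJoin.mk p.1 p.2.1 p.2.2) + a) / (1 + a * ht (TopJoin.mk p.1 p.2.1 p.2.2)))) ?_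
  refine continuous_fst.prodMk (Continuous.div (by fun_prop) (by fun_prop) fun p => ?_)
  exact (one_add_mul_pos ha (abs_ht_le _)).ne'

/-- The translation of the suspension coordinate, as a homeomorphism. -/
noncomputable def shiftHomeo (a : ℝ) (ha : |a| < 1) : TopSusp Y ≃ₜ TopSusp Y where
  toFun := shift a ha
  invFun := shift (-a) (by rwa [abs_neg])
  left_inv := shift_neg_shift ha _
  right_inv x := by
    have := shift_neg_shift (a := -a) (by rwa [abs_neg]) (by rwa [neg_neg]) x
    simpa only [neg_neg] using this
  continuous_toFun := continuous_shift ha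
  continuous_invFun := continuous_shift _

end TopSusp

/-! ### Suspension structures and their suspension points -/

open TopJoin TopSusp Dia

/-- The lines of a suspension structure on a suspension, with the height normalized such that
the suspension point of height `1` is the same for both structures. -/
structure SuspensionLines {Y : Type*} [TopologicalSpace Y] (Z : Set (TopSusp Y)) where
  height : TopSusp Y → ℝ
  line : Z → ℝ → TopSusp Y
  continuous_height : Continuous height
  continuous_line : Continuous fun q : Z × ℝ => line q.1 q.2
  abs_height_le : ∀ x, |height x| ≤ 1
  height_line : ∀ z s, |s| ≤ 1 → height (line z s) = s
  line_zero : ∀ z, line z 0 = z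
  exists_line : ∀ x, ∃ z, line z (height x) = x
  height_eq_one_iff : ∀ x, height x = 1 ↔ ht x = 1
  height_eq_neg_one_iff : ∀ x, height x = -1 ↔ ht x = -1
  line_injective : ∀ z z' s, |s| < 1 → line z s = line z' s → z = z'
  mem_iff : ∀ x, x ∈ Z ↔ height x = 0
  exists_homeomorph : ∀ s, |s| < 1 → ∃ f : TopSusp Y ≃ₜ TopSusp Y, ∀ z, f (line z s) = z
  compactSpace : CompactSpace Z

theorem SuspensionStructure.mem_iff {X : Type*} [TopologicalSpace X] {Z : Set X}
    (S : SuspensionStructure Z) (x : X) : x ∈ Z ↔ ht (S.toHomeo.symm x) = 0 := by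
  constructor
  · intro hx
    have h := S.toHomeo.symm_apply_apply (TopJoin.mk ⟨x, hx⟩ true 0)
    rw [S.map_base] at h
    simp only at h
    rw [h, ht_mk]; simp
  · intro h
    obtain ⟨z, b, hz⟩ := mem_base_iff.2 h
    rw [← S.toHomeo.apply_symm_apply x, hz, S.map_base]
    exact z.2

theorem SuspensionStructure.compactSpace {X : Type*} [TopologicalSpace X] [CompactSpace X]
    {Z : Set X} (S : SuspensionStructure Z) : CompactSpace Z := by
  rw [← isCompact_iff_compactSpace]
  have : Z = (fun x => ht (S.toHomeo.symm x)) ⁻¹' {0} := by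
    ext x; exact S.mem_iff x
  rw [this]
  exact (isClosed_singleton.preimage (continuous_ht.comp S.toHomeo.symm.continuous)).isCompact

section
variable {A B : Type*} [TopologicalSpace A] [TopologicalSpace B]
variable [CompactSpace A] [T2Space A] [CompactSpace B] [T2Space B]
variable [TotallyDisconnectedSpace A] [TotallyDisconnectedSpace B]
variable [∀ a : A, (𝓝[≠] a).NeBot] [∀ b : B, (𝓝[≠] b).NeBot]

theorem image_points_eq (f : TopSusp (TopJoin A B) ≃ₜ TopSusp (TopJoin A B)) :
    f '' points (TopJoin A B) = points (TopJoin A B) := by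
  have key : ∀ (f : TopSusp (TopJoin A B) ≃ₜ TopSusp (TopJoin A B)) {x}, x ∈ points (TopJoin A B) →
      f x ∈ points (TopJoin A B) := by
    intro f x hx
    rw [← connectedImKleinen_univ_iff] at hx ⊢
    simpa using hx.image f
  refine Subset.antisymm (image_subset_iff.2 fun x hx => key f hx) fun x hx => ?_
  exact ⟨f.symm x, key f.symm hx, f.apply_symm_apply x⟩

/-- Since `Z` is compact, the suspension points of `Σ Z` have small connected neighbourhoods, and
this property is transported by the homeomorphism. -/
theorem SuspensionStructure.abs_ht_eq_one {Z : Set (TopSusp (TopJoin A B))}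
    (S : SuspensionStructure Z) {x : TopSusp Z} (hx : |ht x| = 1) : |ht (S.toHomeo x)| = 1 := by
  have := S.compactSpace
  have h := (connectedImKleinen_of_mem_points (mem_points_iff.2 hx)).image S.toHomeo
  rw [image_univ, S.toHomeo.surjective.range_eq, connectedImKleinen_univ_iff, mem_points_iff] at h
  exact h

theorem TopSusp.eq_of_ht_eq {Y : Type*} {x x' : TopSusp Y} (h : ht x = ht x') (h1 : |ht x| = 1) :
    x = x' := by
  obtain ⟨y, hy⟩ := exists_sus x
  obtain ⟨y', hy'⟩ := exists_sus x'
  rw [← hy, ← hy', sus_eq_sus_iff h1.le (h ▸ h1.le)]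
  exact ⟨h, Or.inr h1⟩

/-- The two suspension points have different images in `{n, p}`, so their labels are either kept or
exchanged; `ε` records which. -/
theorem SuspensionStructure.exists_sign {Z : Set (TopSusp (TopJoin A B))}
    (S : SuspensionStructure Z) : ∃ ε : ℝ, ε * ε = 1 ∧ ∀ x : TopSusp Z, ∀ u : ℝ, |u| = 1 →
      (ht x = u ↔ ht (S.toHomeo x) = ε * u) := by
  rcases isEmpty_or_nonempty (TopSusp Z) with he | ⟨⟨x₀⟩⟩
  · exact ⟨1, by norm_num, fun x => (he.false x).elim⟩
  obtain ⟨z, -⟩ := exists_sus x₀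
  have e1 : ht (sus z 1) = 1 := ht_sus z (by simp)
  have e2 : ht (sus z (-1)) = -1 := ht_sus z (by simp)
  have h1 := S.abs_ht_eq_one (x := sus z 1) (by rw [e1, abs_one])
  have h2 := S.abs_ht_eq_one (x := sus z (-1)) (by rw [e2]; simp)
  have hne : ht (S.toHomeo (sus z 1)) ≠ ht (S.toHomeo (sus z (-1))) := fun h => by
    have := S.toHomeo.injective (eq_of_ht_eq h h1)
    rw [this, e2] at e1
    norm_num at e1
  obtain ⟨ε, hε⟩ : ∃ ε, ht (S.toHomeo (sus z 1)) = ε := ⟨_, rfl⟩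
  rw [hε] at h1 hne
  have hεε : ε * ε = 1 := by rw [← abs_mul_abs_self, h1, one_mul]
  have h3 : ht (S.toHomeo (sus z (-1))) = -ε := by
    rcases eq_or_eq_neg_of_abs_eq h1 with rfl | rfl <;>
    rcases eq_or_eq_neg_of_abs_eq h2 with h | h <;> simp_all
  refine ⟨ε, hεε, fun x u hu => ?_⟩
  have key : ∀ v : ℝ, |v| = 1 → ht (S.toHomeo (sus z v)) = ε * v := by
    intro v hv
    rcases eq_or_eq_neg_of_abs_eq hv with rfl | rfl
    · simpa using hε
    · simpa using h3
  have hu' : ht (sus z u) = u := ht_sus z hu.le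
  constructor
  · intro h
    have : x = sus z u := eq_of_ht_eq (by rw [hu', h]) (by rw [h, hu])
    rw [this, key u hu]
  · intro h
    have : S.toHomeo x = S.toHomeo (sus z u) :=
      eq_of_ht_eq (by rw [key u hu, h]) (by rw [h, abs_mul, h1, hu, one_mul])
    rw [S.toHomeo.injective this, hu']

theorem SuspensionStructure.points_eq [Nonempty A] [Nonempty B] {Z : Set (TopSusp (TopJoin A B))}
    (S : SuspensionStructure Z) : S.points = TopSusp.points (TopJoin A B) := by
  obtain ⟨ε, hε, h⟩ := S.exists_sign
  ext x
  rw [mem_points_iff]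
  constructor
  · rintro ⟨y, hy, rfl⟩
    exact S.abs_ht_eq_one (mem_points_iff.1 hy)
  · intro hx
    refine ⟨S.toHomeo.symm x, ?_, S.toHomeo.apply_symm_apply x⟩
    have h1 : |ε| = 1 := by
      have := congrArg abs hε
      rw [abs_mul, abs_one] at this
      nlinarith [abs_nonneg ε]
    rw [mem_points_iff, (h _ (ε * ht x) (by rw [abs_mul, h1, hx, one_mul])).2, abs_mul, h1, hx,
      one_mul]
    rw [S.toHomeo.apply_symm_apply, ← mul_assoc, hε, one_mul]

theorem SuspensionStructure.nonempty_lines {Z : Set (TopSusp (TopJoin A B))}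
    (S : SuspensionStructure Z) : Nonempty (SuspensionLines Z) := by
  obtain ⟨ε, hε, h⟩ := S.exists_sign
  have h1 : |ε| = 1 := by
    have := congrArg abs hε
    rw [abs_mul, abs_one] at this
    nlinarith [abs_nonneg ε]
  have habs : ∀ {s : ℝ}, |ε * s| = |s| := fun {s} => by rw [abs_mul, h1, one_mul]
  have hcancel : ∀ s : ℝ, ε * (ε * s) = s := fun s => by rw [← mul_assoc, hε, one_mul]
  have hunit : ∀ x u, |u| = 1 → (ε * ht (S.toHomeo.symm x) = u ↔ ht x = u) := by
    intro x u hu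
    have := h (S.toHomeo.symm x) (ε * u) (by rw [habs, hu])
    rw [S.toHomeo.apply_symm_apply, hcancel] at this
    rw [← this]
    constructor
    · rintro rfl; rw [hcancel]
    · intro h; rw [h, hcancel]
  have hline : ∀ (z : Z), S.toHomeo (sus z 0) = z := by
    intro z
    rw [← S.map_base z true]
    congr 1
    unfold sus
    simp
  exact ⟨{
    height := fun x => ε * ht (S.toHomeo.symm x)
    line := fun z s => S.toHomeo (sus z (ε * s))
    continuous_height := continuous_const.mul (continuous_ht.comp S.toHomeo.symm.continuous)
    continuous_line := S.toHomeo.continuous.comp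
      (continuous_sus.comp (f := fun q : Z × ℝ => (q.1, ε * q.2)) (by fun_prop))
    abs_height_le := fun x => by rw [habs]; exact abs_ht_le _
    height_line := fun z s hs => by
      rw [S.toHomeo.symm_apply_apply, ht_sus z (by rw [habs]; exact hs), hcancel]
    line_zero := fun z => by rw [mul_zero, hline]
    exists_line := fun x => by
      obtain ⟨z, hz⟩ := exists_sus (S.toHomeo.symm x)
      exact ⟨z, by rw [hcancel, hz, S.toHomeo.apply_symm_apply]⟩
    height_eq_one_iff := fun x => hunit x 1 abs_one
    height_eq_neg_one_iff := fun x => hunit x (-1) (by simp)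
    line_injective := fun z z' s hs hzz => by
      have := S.toHomeo.injective hzz
      rw [sus_eq_sus_iff (by rw [habs]; exact hs.le) (by rw [habs]; exact hs.le), habs] at this
      exact this.2.resolve_right hs.ne
    mem_iff := fun x => by
      rw [S.mem_iff]
      constructor
      · intro h; rw [h, mul_zero]
      · intro h; rw [← hcancel (ht _), h, mul_zero]
    exists_homeomorph := fun s hs => by
      -- The translation with parameter `-(ε * s)` takes the level `ε * s` to the base.
      have hs' : |-(ε * s)| < 1 := by rw [abs_neg, habs]; exact hs
      refine ⟨(S.toHomeo.symm.trans (shiftHomeo _ hs')).trans S.toHomeo, fun z => ?_⟩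
      show S.toHomeo (shift _ hs' (S.toHomeo.symm (S.toHomeo (sus z (ε * s))))) = z
      rw [S.toHomeo.symm_apply_apply, shift_sus hs' z (by rw [habs]; exact hs.le), add_neg_cancel,
        zero_div, hline]
    compactSpace := S.compactSpace }⟩

end

/-! ### Crossing paths in the plane -/

theorem exists_int_abs_sub_le_of_cos_nonneg {φ : ℝ → ℝ} (hφ : ContinuousOn φ (Icc 0 1))
    (h : ∀ s ∈ Icc (0 : ℝ) 1, 0 ≤ Real.cos (φ s)) :
    ∃ k : ℤ, ∀ s ∈ Icc (0 : ℝ) 1, |φ s - k * (2 * Real.pi)| ≤ Real.pi / 2 := by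
  have hpi := Real.pi_pos
  have hcos : ∀ (k : ℤ) (s : ℝ), s ∈ Icc (0 : ℝ) 1 →
      ¬ (Real.pi / 2 < |φ s - k * (2 * Real.pi)| ∧
        |φ s - k * (2 * Real.pi)| < 3 * Real.pi / 2) := by
    rintro k s hs ⟨h1, h2⟩
    have := Real.cos_neg_of_pi_div_two_lt_of_lt h1 (by linarith)
    rw [Real.cos_abs, Real.cos_sub_int_mul_two_pi] at this
    linarith [h s hs]
  set k := round (φ 0 / (2 * Real.pi)) with hk
  refine ⟨k, fun s hs => ?_⟩
  have h0 : |φ 0 - k * (2 * Real.pi)| ≤ Real.pi / 2 := by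
    have h1 : |φ 0 - k * (2 * Real.pi)| ≤ Real.pi := by
      have := abs_sub_round (φ 0 / (2 * Real.pi))
      rw [← hk] at this
      have e : φ 0 - k * (2 * Real.pi) = (φ 0 / (2 * Real.pi) - k) * (2 * Real.pi) := by
        field_simp
      rw [e, abs_mul, abs_of_pos (by positivity : 0 < 2 * Real.pi)]
      nlinarith
    by_contra hc
    exact hcos k 0 (by simp) ⟨not_le.1 hc, by linarith⟩
  by_contra hc
  push Not at hc
  have hcont : ContinuousOn (fun u => |φ u - k * (2 * Real.pi)|) (Icc 0 s) :=
    (((hφ.mono (Icc_subset_Icc_right hs.2)).sub continuousOn_const).abs)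
  -- The cap at `π` keeps the intermediate value between `π / 2` and `3 * π / 2`, where the cosine
  -- is negative.
  have hm : min |φ s - k * (2 * Real.pi)| Real.pi ∈
      Icc |φ 0 - k * (2 * Real.pi)| |φ s - k * (2 * Real.pi)| :=
    ⟨le_min (by linarith) (by linarith), min_le_left _ _⟩
  obtain ⟨u, hu, hu'⟩ := intermediate_value_Icc hs.1 hcont hm
  refine hcos k u ⟨hu.1, hu.2.trans hs.2⟩ ?_
  simp only at hu'
  rw [hu']
  exact ⟨lt_min hc (by linarith), (min_le_right _ _).trans_lt (by linarith)⟩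

/-- In the plane, a path from left to right meets a path from bottom to top. -/
theorem exists_eq_of_crossing {f g : ℝ → ℝ × ℝ} (hf : Continuous f) (hg : Continuous g)
    (hf0 : ∀ t ∈ Icc (0 : ℝ) 1, (f 0).1 ≤ (g t).1) (hf1 : ∀ t ∈ Icc (0 : ℝ) 1, (g t).1 ≤ (f 1).1)
    (hg0 : ∀ s ∈ Icc (0 : ℝ) 1, (g 0).2 ≤ (f s).2) (hg1 : ∀ s ∈ Icc (0 : ℝ) 1, (f s).2 ≤ (g 1).2) :
    ∃ s t, f s = g t := by
  by_contra! hne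
  -- If the paths never meet, `f s - g t` has a continuous logarithm on the plane. Along the sides
  -- of the unit square it stays in the upper, right, lower and left half plane in turn, so its
  -- argument would lose a full turn on the way round.
  let F : C(ℝ × ℝ, {z : ℂ // z ≠ 0}) := ⟨fun p => ⟨⟨(f p.1).1 - (g p.2).1, (f p.1).2 - (g p.2).2⟩,
    fun h => hne p.1 p.2 (Prod.ext (sub_eq_zero.1 (congrArg Complex.re h))
      (sub_eq_zero.1 (congrArg Complex.im h)))⟩, by
    refine Continuous.subtype_mk ?_ _
    have : Continuous fun p : ℝ × ℝ => Complex.equivRealProdCLM.symm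
      ((f p.1).1 - (g p.2).1, (f p.1).2 - (g p.2).2) := by fun_prop
    exact this⟩
  obtain ⟨G, ⟨-, hG⟩, -⟩ := Complex.isCoveringMap_exp.existsUnique_continuousMap_lifts F (0, 0)
    (Complex.log (F (0, 0)).1) (Subtype.ext (Complex.exp_log (F (0, 0)).2))
  have hG' : ∀ s t, Complex.exp (G (s, t)) = (F (s, t)).1 := fun s t =>
    congrArg Subtype.val (congrFun hG (s, t))
  have hre : ∀ s t, Real.exp (G (s, t)).re * Real.cos (G (s, t)).im = (f s).1 - (g t).1 := by
    intro s t
    rw [← Complex.exp_re, hG']; rfl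
  have him : ∀ s t, Real.exp (G (s, t)).re * Real.sin (G (s, t)).im = (f s).2 - (g t).2 := by
    intro s t
    rw [← Complex.exp_im, hG']; rfl
  have hcont : Continuous fun p : ℝ × ℝ => (G p).im := Complex.continuous_im.comp G.continuous
  obtain ⟨k₀, h₀⟩ := exists_int_abs_sub_le_of_cos_nonneg
    (φ := fun s => (G (s, 0)).im - Real.pi / 2) (by fun_prop) (by
      intro s hs
      rw [Real.cos_sub_pi_div_two]
      have := him s 0
      have h2 := hg0 s hs
      exact (mul_nonneg_iff_of_pos_left (Real.exp_pos (G (s, 0)).re)).1 (by linarith))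
  obtain ⟨k₁, h₁⟩ := exists_int_abs_sub_le_of_cos_nonneg
    (φ := fun t => (G (1, t)).im) (by fun_prop) (by
      intro t ht
      have := hre 1 t
      have h2 := hf1 t ht
      exact (mul_nonneg_iff_of_pos_left (Real.exp_pos (G (1, t)).re)).1 (by linarith))
  obtain ⟨k₂, h₂⟩ := exists_int_abs_sub_le_of_cos_nonneg
    (φ := fun s => (G (s, 1)).im + Real.pi / 2) (by fun_prop) (by
      intro s hs
      rw [Real.cos_add_pi_div_two]
      have := him s 1
      have h2 := hg1 s hs
      exact (mul_nonneg_iff_of_pos_left (Real.exp_pos (G (s, 1)).re)).1 (by linarith))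
  obtain ⟨k₃, h₃⟩ := exists_int_abs_sub_le_of_cos_nonneg
    (φ := fun t => (G (0, t)).im + Real.pi) (by fun_prop) (by
      intro t ht
      rw [Real.cos_add_pi]
      have := hre 0 t
      have h2 := hf0 t ht
      exact (mul_nonneg_iff_of_pos_left (Real.exp_pos (G (0, t)).re)).1 (by linarith))
  have hpi := Real.pi_pos
  have i0 : (0 : ℝ) ∈ Icc (0 : ℝ) 1 := by simp
  have i1 : (1 : ℝ) ∈ Icc (0 : ℝ) 1 := by simp
  have a1 := abs_le.1 (h₀ 1 i1)
  have a2 := abs_le.1 (h₁ 0 i0)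
  have b1 := abs_le.1 (h₁ 1 i1)
  have b2 := abs_le.1 (h₂ 1 i1)
  have c1 := abs_le.1 (h₂ 0 i0)
  have c2 := abs_le.1 (h₃ 1 i1)
  have d1 := abs_le.1 (h₃ 0 i0)
  have d2 := abs_le.1 (h₀ 0 i0)
  have hint : ∀ m n : ℤ, (m - n : ℝ) * (2 * Real.pi) < 2 * Real.pi → m ≤ n := by
    intro m n h
    have h' : ((m - n : ℤ) : ℝ) < 1 := by
      push_cast
      by_contra hc
      nlinarith
    have : m - n < 1 := by exact_mod_cast h'
    omega
  -- Comparing arguments at three corners shows that the branch numbers do not increase, whereas the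
  -- corner `(0, 0)` requires `k₀ < k₃`.
  have e1 : k₁ ≤ k₀ := hint _ _ (by nlinarith)
  have e2 : k₂ ≤ k₁ := hint _ _ (by nlinarith)
  have e3 : k₃ ≤ k₂ := hint _ _ (by nlinarith)
  have e4 : (k₃ : ℝ) * (2 * Real.pi) ≤ k₀ * (2 * Real.pi) := by
    have : (k₃ : ℝ) ≤ k₀ := by exact_mod_cast e3.trans (e2.trans e1)
    nlinarith
  linarith

/-! ### The order of the lines in a diamond -/

/-- The diamond without its two suspension points. -/
abbrev Str : Type := {z : ℝ × ℝ // |z.1| + |z.2| ≤ 1 ∧ |z.2| < 1}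

namespace Str

theorem convex : Convex ℝ {z : ℝ × ℝ | |z.1| + |z.2| ≤ 1 ∧ |z.2| < 1} := by
  have h1 : ConvexOn ℝ univ fun d : ℝ × ℝ => |d.1| :=
    (convexOn_univ_norm (E := ℝ)).comp_linearMap (LinearMap.fst ℝ ℝ ℝ)
  have h2 : ConvexOn ℝ univ fun d : ℝ × ℝ => |d.2| :=
    (convexOn_univ_norm (E := ℝ)).comp_linearMap (LinearMap.snd ℝ ℝ ℝ)
  have := ((h1.add h2).convex_le 1).inter (h2.convex_lt 1)
  simpa [Set.inter_def] using this

theorem joinedIn_of_path {A : Set Str} {γ : ℝ → ℝ × ℝ} {u v : ℝ} (huv : u ≤ v)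
    (hγ : ContinuousOn γ (Icc u v))
    (h : ∀ t ∈ Icc u v, ∃ hT : |(γ t).1| + |(γ t).2| ≤ 1 ∧ |(γ t).2| < 1, (⟨γ t, hT⟩ : Str) ∈ A)
    {x y : Str} (hx : x.1 = γ u) (hy : y.1 = γ v) : JoinedIn A x y := by
  let g : Icc u v → Str := fun t => ⟨γ t, (h t t.2).choose⟩
  have hg : Continuous g := (continuousOn_iff_continuous_domRestrict.1 hγ).subtype_mk _
  have : PathConnectedSpace (Icc u v) :=
    isPathConnected_iff_pathConnectedSpace.1 ((convex_Icc u v).isPathConnected ⟨u, le_rfl, huv⟩)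
  have hr : range g ⊆ A := by
    rintro _ ⟨t, rfl⟩
    exact (h t t.2).choose_spec
  have hp : IsPathConnected (range g) := isPathConnected_range hg
  refine (hp.joinedIn x ⟨⟨u, le_rfl, huv⟩, Subtype.ext hx.symm⟩
    y ⟨⟨v, huv, le_rfl⟩, Subtype.ext hy.symm⟩).mono hr

theorem joinedIn_of_segment {A : Set Str} {x y : Str}
    (h : ∀ z : Str, z.1 ∈ segment ℝ x.1 y.1 → z ∈ A) : JoinedIn A x y := by
  refine joinedIn_of_path (γ := fun t => AffineMap.lineMap x.1 y.1 t) zero_le_one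
    (by fun_prop) (fun t ht => ?_) (by simp) (by simp)
  have hs : AffineMap.lineMap x.1 y.1 t ∈ segment ℝ x.1 y.1 := by
    rw [segment_eq_image_lineMap]; exact ⟨t, ht, rfl⟩
  exact ⟨convex.segment_subset x.2 y.2 hs, h ⟨_, _⟩ hs⟩

/-- The point of the horizontal diagonal with first coordinate `t`. -/
def diag (t : Icc (-1 : ℝ) 1) : Str := ⟨(t, 0), by simpa using abs_le.2 t.2⟩

theorem continuous_diag : Continuous diag := by
  unfold diag; fun_prop

/-- The left corner. -/
def leftPt : Str := ⟨(-1, 0), by simp⟩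
/-- The right corner. -/
def rightPt : Str := ⟨(1, 0), by simp⟩

theorem isLeft_leftPt : IsLeft leftPt.1 := by simp [IsLeft, leftPt]
theorem isRight_rightPt : IsRight rightPt.1 := by simp [IsRight, rightPt]

end Str

/-- A continuous family, parametrized by `P`, of partitions of the diamond without its suspension
points into lines that run from one suspension point to the other, two of the lines being the
sides. The map `r` is constant on lines and separates them; `l` parametrizes lines. -/
structure PlaneLines (P : Type*) [TopologicalSpace P] where
  r : P → Str → Dia
  l : P → Str → ℝ → Dia
  continuous_r : Continuous fun q : P × Str => r q.1 q.2
  continuous_l : ∀ c z, Continuous (l c z)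
  l_lt : ∀ c z s, |s| < 1 → |(l c z s).1.2| < 1
  l_one : ∀ c z, (l c z 1).1.2 = 1
  l_neg_one : ∀ c z, (l c z (-1)).1.2 = -1
  r_l : ∀ c z s (hs : |s| < 1), r c ⟨(l c z s).1, (l c z s).2, l_lt c z s hs⟩ = r c z
  exists_l : ∀ c z z', r c z = r c z' → ∃ s, |s| < 1 ∧ (l c z s).1 = z'.1
  left_iff : ∀ c z z', IsLeft z.1 → (IsLeft z'.1 ↔ r c z' = r c z)
  right_iff : ∀ c z z', IsRight z.1 → (IsRight z'.1 ↔ r c z' = r c z)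

namespace PlaneLines
open Str
variable {P : Type*} [TopologicalSpace P] (L : PlaneLines P)

/-- The complement of the line through `y`. -/
def off (c : P) (y : Str) : Set Str := {z | L.r c z ≠ L.r c y}

/-- In slope and height coordinates the path runs from left to right and the line through `y` from
bottom to top, so `exists_eq_of_crossing` makes them meet. -/
theorem not_joinedIn_off {c : P} {y a b : Str} (ha : IsLeft a.1) (hb : IsRight b.1) :
    ¬ JoinedIn (L.off c y) a b := by
  rintro ⟨γ, hγ⟩
  have hcont : Continuous fun t : ℝ => (γ.extend t).1 :=
    continuous_subtype_val.comp γ.continuous_extend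
  have hsl : ∀ {f : ℝ → ℝ × ℝ}, Continuous f → (∀ t, |(f t).2| < 1) →
      Continuous fun t => (slope (f t), (f t).2) := fun hf h =>
    (continuousOn_slope.comp_continuous hf h).prodMk (continuous_snd.comp hf)
  -- The path is compact and avoids the suspension points, so its heights stay in `[-m, m]`. A piece
  -- of the line that ends beyond both bounds suffices, and the slope is continuous along it.
  obtain ⟨m, hm1, hm⟩ : ∃ m < 1, ∀ t ∈ Icc (0 : ℝ) 1, |(γ.extend t).1.2| ≤ m := by
    obtain ⟨t, ht, hmax⟩ := isCompact_Icc.exists_isMaxOn (nonempty_Icc.2 (zero_le_one (α := ℝ)))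
      (f := fun t => |(γ.extend t).1.2|) (by fun_prop)
    exact ⟨_, (γ.extend t).2.2, fun u hu => hmax hu⟩
  have hl2 : Continuous fun s => (L.l c y s).1.2 :=
    continuous_snd.comp (continuous_subtype_val.comp (L.continuous_l c y))
  obtain ⟨s₁, h1, h1', h1''⟩ : ∃ s₁ : ℝ, m < (L.l c y s₁).1.2 ∧ s₁ < 1 ∧ 0 < s₁ := by
    have e := (hl2.tendsto 1).eventually (lt_mem_nhds (by rw [L.l_one]; exact hm1))
    exact ((e.filter_mono nhdsWithin_le_nhds).and
      ((eventually_mem_nhdsWithin (a := (1 : ℝ)) (s := Iio 1)).and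
      ((lt_mem_nhds (zero_lt_one (α := ℝ))).filter_mono nhdsWithin_le_nhds))).exists
  obtain ⟨s₀, h0, h0', h0''⟩ : ∃ s₀ : ℝ, (L.l c y s₀).1.2 < -m ∧ -1 < s₀ ∧ s₀ < 0 := by
    have hlt : (L.l c y (-1)).1.2 < -m := by rw [L.l_neg_one]; linarith
    have e := (hl2.tendsto (-1)).eventually (gt_mem_nhds hlt)
    exact ((e.filter_mono nhdsWithin_le_nhds).and
      ((eventually_mem_nhdsWithin (a := (-1 : ℝ)) (s := Ioi (-1))).and
      ((gt_mem_nhds (neg_one_lt_zero (R := ℝ))).filter_mono nhdsWithin_le_nhds))).exists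
  let ρ : ℝ → ℝ := fun t => s₀ + (s₁ - s₀) * max 0 (min 1 t)
  have hρ : Continuous ρ := by fun_prop
  have hρ1 : ∀ t, |ρ t| < 1 := by
    intro t
    have i0 : 0 ≤ max 0 (min 1 t) := le_max_left _ _
    have i1 : max 0 (min 1 t) ≤ 1 := max_le zero_le_one (min_le_left _ _)
    have hpos : 0 < s₁ - s₀ := by linarith
    rw [abs_lt]
    constructor <;> simp only [ρ] <;> nlinarith
  have habs : ∀ z : Str, |slope z.1| ≤ 1 := fun z => abs_slope_le ⟨z.1, z.2.1⟩
  have hγ0 : slope (γ.extend 0).1 = -1 := by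
    rw [γ.extend_zero]; exact (isLeft_iff a.2.2).1 ha
  have hγ1 : slope (γ.extend 1).1 = 1 := by
    rw [γ.extend_one]; exact (isRight_iff b.2.2).1 hb
  obtain ⟨t, u, he⟩ := exists_eq_of_crossing
    (f := fun t => (slope (γ.extend t).1, (γ.extend t).1.2))
    (g := fun t => (slope (L.l c y (ρ t)).1, (L.l c y (ρ t)).1.2))
    (hsl hcont fun t => (γ.extend t).2.2)
    (hsl (continuous_subtype_val.comp ((L.continuous_l c y).comp hρ)) fun t => L.l_lt _ _ _ (hρ1 t))
    (fun t _ => by simp only [hγ0]; exact (abs_le.1 (abs_slope_le _)).1)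
    (fun t _ => by simp only [hγ1]; exact (abs_le.1 (abs_slope_le _)).2)
    (fun t ht => by
      have := (abs_le.1 (hm t ht)).1
      simp only [ρ]; simp; linarith)
    (fun t ht => by
      have := (abs_le.1 (hm t ht)).2
      simp only [ρ]; simp; linarith)
  have he' : (γ.extend t).1 = (L.l c y (ρ u)).1 := by
    have e1 := chord_slope ⟨(γ.extend t).1, (γ.extend t).2.1⟩
    have e2 := chord_slope (L.l c y (ρ u))
    simp only [Prod.mk.injEq] at he
    rw [← e1, ← e2]
    simp only [he.1, he.2]
  have hmem : γ.extend t ∈ L.off c y := hγ (projIcc 0 1 zero_le_one t)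
  refine hmem ?_
  rw [← L.r_l c y (ρ u) (hρ1 u)]
  congr 1
  exact Subtype.ext he'

theorem joinedIn_off_of_eq {c : P} {x x' y : Str} (h : L.r c x = L.r c x')
    (hy : L.r c x ≠ L.r c y) : JoinedIn (L.off c y) x x' := by
  have key : ∀ {x' : Str}, L.r c x = L.r c x' → ∃ s, |s| < 1 ∧ (L.l c x s).1 = x'.1 :=
    fun h => L.exists_l c x _ h
  have main : ∀ {u v : ℝ} {x₁ x₂ : Str}, u ≤ v → |u| < 1 → |v| < 1 → (L.l c x u).1 = x₁.1 →
      (L.l c x v).1 = x₂.1 → JoinedIn (L.off c y) x₁ x₂ := by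
    intro u v x₁ x₂ huv hu hv h1 h2
    refine joinedIn_of_path (γ := fun s => (L.l c x s).1) huv
      (continuous_subtype_val.comp (L.continuous_l c x)).continuousOn (fun t ht => ?_) h1.symm h2.symm
    have ht1 : |t| < 1 := by
      rw [abs_lt] at *
      exact ⟨hu.1.trans_le ht.1, ht.2.trans_lt hv.2⟩
    refine ⟨⟨(L.l c x t).2, L.l_lt c x t ht1⟩, ?_⟩
    show L.r c _ ≠ _
    rw [L.r_l c x t ht1]; exact hy
  obtain ⟨u, hu, hu'⟩ := key rfl
  obtain ⟨v, hv, hv'⟩ := key h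
  rcases le_total u v with huv | huv
  · exact main huv hu hv hu' hv'
  · exact (main huv hv hu hv' hu').symm

/-- The line through `x` lies to the left of the line through `y`. -/
def Lt (c : P) (x y : Str) : Prop := ∃ a : Str, IsLeft a.1 ∧ JoinedIn (L.off c y) a x

variable {L}

theorem Lt.ne {c : P} {x y : Str} (h : L.Lt c x y) : L.r c x ≠ L.r c y := by
  obtain ⟨a, -, h⟩ := h
  exact h.target_mem

theorem Lt.congr_left {c : P} {x x' y : Str} (h : L.Lt c x y) (hx : L.r c x = L.r c x') :
    L.Lt c x' y := by
  obtain ⟨a, ha, hj⟩ := id h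
  exact ⟨a, ha, hj.trans (L.joinedIn_off_of_eq hx h.ne)⟩

theorem Lt.congr_right {c : P} {x y y' : Str} (h : L.Lt c x y) (hy : L.r c y = L.r c y') :
    L.Lt c x y' := by
  obtain ⟨a, ha, hj⟩ := h
  exact ⟨a, ha, by unfold off at *; rwa [← hy]⟩

theorem isClosed_line (c : P) (x : Str) : IsClosed {z | L.r c z = L.r c x} :=
  isClosed_eq (L.continuous_r.comp (Continuous.prodMk_right c)) continuous_const

/-- On the segment from the left corner to `x`, the first of the two lines to be met lies to the
left of the other, which the initial piece avoids. -/
theorem lt_or_lt {c : P} {x y : Str} (h : L.r c x ≠ L.r c y) : L.Lt c x y ∨ L.Lt c y x := by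
  let γ : Icc (0 : ℝ) 1 → Str := fun t => ⟨AffineMap.lineMap leftPt.1 x.1 (t : ℝ),
    Str.convex.segment_subset leftPt.2 x.2 (by
      rw [segment_eq_image_lineMap]; exact ⟨t, t.2, rfl⟩)⟩
  have hγ : Continuous γ := Continuous.subtype_mk (by fun_prop) _
  have h1 : γ ⟨1, by simp⟩ = x := Subtype.ext (by simp [γ])
  have hK : IsCompact {t | L.r c (γ t) = L.r c x ∨ L.r c (γ t) = L.r c y} :=
    (((isClosed_line c x).preimage hγ).union ((isClosed_line c y).preimage hγ)).isCompact
  obtain ⟨t, ht, hmin⟩ := hK.exists_isLeast ⟨⟨1, by simp⟩, Or.inl (by rw [h1])⟩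
  have key : ∀ w, (L.r c (γ t) ≠ L.r c w) → (L.r c w = L.r c x ∨ L.r c w = L.r c y) →
      JoinedIn (L.off c w) leftPt (γ t) := by
    intro w hw hwxy
    refine joinedIn_of_path (γ := fun t => AffineMap.lineMap leftPt.1 x.1 t) t.2.1
      (by fun_prop) (fun u hu => ?_) (by simp) rfl
    have hu1 : u ∈ Icc (0 : ℝ) 1 := ⟨hu.1, hu.2.trans t.2.2⟩
    refine ⟨(γ ⟨u, hu1⟩).2, fun he => ?_⟩
    have hle : t ≤ ⟨u, hu1⟩ := hmin (by
      rcases hwxy with e | e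
      · exact Or.inl (Eq.trans he e)
      · exact Or.inr (Eq.trans he e))
    have : t = ⟨u, hu1⟩ := le_antisymm hle hu.2
    exact hw (by rw [this]; exact he)
  rcases ht with ht | ht
  · left
    refine Lt.congr_left ⟨leftPt, isLeft_leftPt, key y (by rwa [ht]) (Or.inr rfl)⟩ ht
  · right
    refine Lt.congr_left ⟨leftPt, isLeft_leftPt, key x (by rw [ht]; exact h.symm) (Or.inl rfl)⟩ ht

theorem joinedIn_diag {c : P} {y : Str} {u : Icc (-1 : ℝ) 1}
    (h : ∀ t, u ≤ t → L.r c (diag t) ≠ L.r c y) : JoinedIn (L.off c y) (diag u) rightPt := by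
  refine joinedIn_of_path (γ := fun t => (t, 0)) u.2.2 (by fun_prop) (fun t ht => ?_) rfl rfl
  have ht1 : t ∈ Icc (-1 : ℝ) 1 := ⟨u.2.1.trans ht.1, ht.2⟩
  exact ⟨(diag ⟨t, ht1⟩).2, h ⟨t, ht1⟩ ht.1⟩

/-- Otherwise the horizontal diagonal would join the two sides off the line. The diagonal thus
serves as a compact transversal for all lines. -/
theorem exists_diag (c : P) (x : Str) : ∃ t, L.r c (diag t) = L.r c x := by
  by_contra! h
  exact L.not_joinedIn_off (a := diag ⟨-1, by simp⟩) isLeft_leftPt isRight_rightPt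
    (joinedIn_diag (u := ⟨-1, by simp⟩) fun t _ => h t)

/-- Take the last point of the diagonal on either line. If its line is to the left of the other one,
a path from the left side to it, continued along the diagonal, avoids that other line, against
`not_joinedIn_off`. -/
theorem Lt.asymm {c : P} {x y : Str} (h : L.Lt c x y) (h' : L.Lt c y x) : False := by
  have hK : IsCompact {t | L.r c (diag t) = L.r c x ∨ L.r c (diag t) = L.r c y} :=
    (((isClosed_line c x).preimage continuous_diag).union
      ((isClosed_line c y).preimage continuous_diag)).isCompact
  obtain ⟨t₀, ht₀⟩ := exists_diag (L := L) c x
  obtain ⟨t, ht, hmax⟩ := hK.exists_isGreatest ⟨t₀, Or.inl ht₀⟩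
  have key : ∀ {v w : Str}, L.Lt c v w → L.r c (diag t) = L.r c v →
      (L.r c w = L.r c x ∨ L.r c w = L.r c y) → False := by
    rintro v w hvw htv hw
    obtain ⟨a, ha, hj⟩ := hvw.congr_left htv.symm
    refine L.not_joinedIn_off ha isRight_rightPt (hj.trans (joinedIn_diag fun u hu he => ?_))
    have : u ≤ t := hmax (by
      rcases hw with e | e
      · exact Or.inl (he.trans e)
      · exact Or.inr (he.trans e))
    obtain rfl := le_antisymm hu this
    exact hvw.ne (htv.symm.trans he)
  rcases ht with ht | ht
  · exact key h ht (Or.inr rfl)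
  · exact key h' ht (Or.inl rfl)

/-- The path to `v` that avoids the line of `w` also avoids that of `x`; otherwise it would put `x`
to the left of `w`. -/
theorem Lt.trans {c : P} {v w x : Str} (h : L.Lt c v w) (h' : L.Lt c w x) : L.Lt c v x := by
  obtain ⟨a, ha, γ, hγ⟩ := h
  refine ⟨a, ha, γ, fun t he => ?_⟩
  have : PathConnectedSpace I := isPathConnected_iff_pathConnectedSpace.1
    ((convex_Icc (0 : ℝ) 1).isPathConnected (nonempty_Icc.2 zero_le_one))
  have hj : JoinedIn (L.off c w) a (γ t) :=
    ((isPathConnected_range γ.continuous).joinedIn a ⟨0, γ.source⟩ _ ⟨t, rfl⟩).mono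
      (range_subset_iff.2 hγ)
  exact h'.asymm (Lt.congr_left ⟨a, ha, hj⟩ he)

/-- The witnessing path is compact, so it avoids all nearby lines for nearby parameters; a short
segment at its end reaches the nearby points. -/
theorem eventually_lt {c : P} {x y : Str} (h : L.Lt c x y) :
    ∀ᶠ q : P × Str × Str in 𝓝 (c, x, y), L.Lt q.1 q.2.1 q.2.2 := by
  obtain ⟨a, ha, γ, hγ⟩ := h
  have ho : IsOpen {q : (P × Str) × Str | L.r q.1.1 q.2 ≠ L.r q.1.1 q.1.2} :=
    isOpen_ne_fun
      (L.continuous_r.comp (f := fun q : (P × Str) × Str => (q.1.1, q.2)) (by fun_prop))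
      (L.continuous_r.comp (f := fun q : (P × Str) × Str => (q.1.1, q.1.2)) (by fun_prop))
  obtain ⟨u, v, hu, hv, hcu, hγv, huv⟩ := generalized_tube_lemma (s := {(c, y)})
    isCompact_singleton (t := range γ) (isCompact_range γ.continuous) ho (by
      rintro ⟨q, z⟩ ⟨rfl, t, rfl⟩
      exact hγ t)
  obtain ⟨w, hw, hwv⟩ := isOpen_induced_iff.1 hv
  have hxw : x.1 ∈ w := by
    have : x ∈ v := hγv ⟨1, γ.target⟩
    rw [← hwv] at this; exact this
  obtain ⟨ε, hε, hball⟩ := Metric.mem_nhds_iff.1 (hw.mem_nhds hxw)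
  have e1 : ∀ᶠ q : P × Str × Str in 𝓝 (c, x, y), (q.1, q.2.2) ∈ u :=
    (Continuous.tendsto (f := fun q : P × Str × Str => (q.1, q.2.2)) (by fun_prop)
      (c, x, y)).eventually (hu.mem_nhds (hcu rfl))
  have e2 : ∀ᶠ q : P × Str × Str in 𝓝 (c, x, y), q.2.1.1 ∈ Metric.ball x.1 ε :=
    (Continuous.tendsto (f := fun q : P × Str × Str => q.2.1.1) (by fun_prop)
      (c, x, y)).eventually (Metric.ball_mem_nhds _ hε)
  filter_upwards [e1, e2] with q hq1 hq2
  have hoff : v ⊆ L.off q.1 q.2.2 := fun z hz => huv (mk_mem_prod hq1 hz)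
  refine ⟨a, ha, JoinedIn.trans ⟨γ, fun t => hoff (hγv ⟨t, rfl⟩)⟩ (joinedIn_of_segment ?_)⟩
  intro z hz
  refine hoff ?_
  rw [← hwv]
  exact hball ((convex_ball _ _).segment_subset (Metric.mem_ball_self hε) hq2 hz)

end PlaneLines

/-! ### A continuous transverse coordinate -/

namespace PlaneLines
open Str
variable {P : Type*} [TopologicalSpace P] (L : PlaneLines P)

open Classical in
/-- The distance of the representatives of two lines if the second one, the line through `v`, lies
to the right of the line through `x`, and `0` otherwise. -/
noncomputable def excess (q : P × Str × Str) : ℝ :=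
  if L.Lt q.1 q.2.2 q.2.1 then dist (L.r q.1 q.2.1) (L.r q.1 q.2.2) else 0

theorem excess_nonneg (q : P × Str × Str) : 0 ≤ L.excess q := by
  unfold excess; split_ifs <;> simp [dist_nonneg]

theorem excess_le (q : P × Str × Str) :
    L.excess q ≤ dist (L.r q.1 q.2.1) (L.r q.1 q.2.2) := by
  unfold excess; split_ifs <;> simp [dist_nonneg]

/-- For distinct lines the order is locally constant; where they coincide, the distance tends to `0`
and both cases agree. -/
theorem continuous_excess : Continuous L.excess := by
  have hd : Continuous fun q : P × Str × Str => dist (L.r q.1 q.2.1) (L.r q.1 q.2.2) :=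
    (L.continuous_r.comp (f := fun q : P × Str × Str => (q.1, q.2.1)) (by fun_prop)).dist
      (L.continuous_r.comp (f := fun q : P × Str × Str => (q.1, q.2.2)) (by fun_prop))
  rw [continuous_iff_continuousAt]
  rintro ⟨c, v, x⟩
  by_cases h : L.r c v = L.r c x
  · have h0 : L.excess (c, v, x) = 0 := le_antisymm
      ((L.excess_le _).trans_eq (by simp [h])) (L.excess_nonneg _)
    rw [ContinuousAt, h0]
    refine squeeze_zero L.excess_nonneg L.excess_le ?_
    simpa [h] using hd.tendsto (c, v, x)
  · rcases lt_or_lt h with h | h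
    · have e : L.excess =ᶠ[𝓝 (c, v, x)] fun _ => 0 := by
        filter_upwards [eventually_lt h] with q hq
        exact if_neg fun hq' => hq.asymm hq'
      exact continuousAt_const.congr e.symm
    · have e : L.excess =ᶠ[𝓝 (c, v, x)] fun q => dist (L.r q.1 q.2.1) (L.r q.1 q.2.2) := by
        have ht : Tendsto (fun q : P × Str × Str => (q.1, q.2.2, q.2.1)) (𝓝 (c, v, x))
            (𝓝 (c, x, v)) := Continuous.tendsto (by fun_prop) (c, v, x)
        filter_upwards [ht.eventually (eventually_lt h)] with q hq
        exact if_pos hq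
      exact hd.continuousAt.congr e.symm

/-- The distance of `y` to the part of the transversal that is not to the right of the line
through `x`. -/
noncomputable def gap (q : Dia × P × Str) : ℝ :=
  sInf ((fun t => dist q.1 (L.r q.2.1 (diag t)) + L.excess (q.2.1, diag t, q.2.2)) '' univ)

theorem continuous_gap_aux : Continuous fun p : (Dia × P × Str) × Icc (-1 : ℝ) 1 =>
    dist p.1.1 (L.r p.1.2.1 (diag p.2)) + L.excess (p.1.2.1, diag p.2, p.1.2.2) := by
  have h1 := continuous_diag
  exact (Continuous.dist (by fun_prop) (L.continuous_r.comp
      (f := fun p : (Dia × P × Str) × Icc (-1 : ℝ) 1 => (p.1.2.1, diag p.2)) (by fun_prop))).add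
    (L.continuous_excess.comp
      (f := fun p : (Dia × P × Str) × Icc (-1 : ℝ) 1 => (p.1.2.1, diag p.2, p.1.2.2)) (by fun_prop))

/-- With the penalty `excess` in place of a constraint, the infimum runs over a fixed compact
interval, whence joint continuity. -/
theorem continuous_gap : Continuous L.gap :=
  isCompact_univ.continuous_sInf (f := fun (q : Dia × P × Str) (t : Icc (-1 : ℝ) 1) =>
    dist q.1 (L.r q.2.1 (diag t)) + L.excess (q.2.1, diag t, q.2.2)) L.continuous_gap_aux

theorem gap_le (q : Dia × P × Str) (t : Icc (-1 : ℝ) 1) :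
    L.gap q ≤ dist q.1 (L.r q.2.1 (diag t)) + L.excess (q.2.1, diag t, q.2.2) :=
  csInf_le ⟨0, by rintro _ ⟨t, -, rfl⟩; exact add_nonneg dist_nonneg (L.excess_nonneg _)⟩
    ⟨t, mem_univ _, rfl⟩

theorem exists_gap_eq (q : Dia × P × Str) : ∃ t,
    L.gap q = dist q.1 (L.r q.2.1 (diag t)) + L.excess (q.2.1, diag t, q.2.2) := by
  have hc : Continuous fun t : Icc (-1 : ℝ) 1 =>
      dist q.1 (L.r q.2.1 (diag t)) + L.excess (q.2.1, diag t, q.2.2) :=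
    L.continuous_gap_aux.comp (Continuous.prodMk_right q)
  have hne : (univ : Set (Icc (-1 : ℝ) 1)).Nonempty := ⟨⟨1, by simp⟩, trivial⟩
  obtain ⟨t, -, h⟩ := isCompact_univ.exists_sInf_image_eq hne hc.continuousOn
  exact ⟨t, h⟩

theorem gap_nonneg (q : Dia × P × Str) : 0 ≤ L.gap q := by
  obtain ⟨t, h⟩ := L.exists_gap_eq q
  rw [h]; exact add_nonneg dist_nonneg (L.excess_nonneg _)

theorem dist_le_two (d d' : Dia) : dist d d' ≤ 2 := by
  have h1 := abs_le.1 (show |d.1.1| ≤ 1 by linarith [d.2, abs_nonneg d.1.2])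
  have h2 := abs_le.1 d.abs_snd_le
  have h3 := abs_le.1 (show |d'.1.1| ≤ 1 by linarith [d'.2, abs_nonneg d'.1.2])
  have h4 := abs_le.1 d'.abs_snd_le
  rw [Subtype.dist_eq, Prod.dist_eq, Real.dist_eq, Real.dist_eq]
  refine max_le ?_ ?_ <;> rw [abs_le] <;> constructor <;> linarith

theorem gap_le_four (q : Dia × P × Str) : L.gap q ≤ 4 := by
  refine (L.gap_le q ⟨0, by simp⟩).trans ?_
  have h1 := dist_le_two q.1 (L.r q.2.1 (diag ⟨0, by simp⟩))
  have h2 := (L.excess_le (q.2.1, diag ⟨0, by simp⟩, q.2.2)).trans (dist_le_two _ _)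
  linarith

theorem gap_congr (y : Dia) {c : P} {x x' : Str} (h : L.r c x = L.r c x') :
    L.gap (y, c, x) = L.gap (y, c, x') := by
  have : ∀ v, L.excess (c, v, x) = L.excess (c, v, x') := by
    intro v
    have e : L.Lt c x v ↔ L.Lt c x' v := ⟨fun h' => h'.congr_left h, fun h' => h'.congr_left h.symm⟩
    by_cases hv : L.Lt c x v
    · simp only [excess, if_pos hv, if_pos (e.1 hv), h]
    · simp only [excess, if_neg hv, if_neg fun h' => hv (e.2 h')]
  simp only [gap, this]

theorem excess_self (c : P) {v x : Str} (h : L.r c v = L.r c x) : L.excess (c, v, x) = 0 :=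
  le_antisymm ((L.excess_le _).trans_eq (by simp [h])) (L.excess_nonneg _)

/-- Take the optimal `t` for `x`. If it is to the right of `x'`, moving it to the line of `x` costs
no more, as the penalty at `t` was the distance to that line. Otherwise its penalty for `x'`
vanishes. -/
theorem gap_anti (y : Dia) {c : P} {x x' : Str} (h : L.Lt c x x') :
    L.gap (y, c, x') ≤ L.gap (y, c, x) := by
  obtain ⟨t, ht⟩ := L.exists_gap_eq (y, c, x)
  rw [ht]
  by_cases hv : L.Lt c x' (diag t)
  · obtain ⟨u, hu⟩ := exists_diag (L := L) c x
    refine (L.gap_le _ u).trans ?_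
    have e1 : L.excess (c, diag u, x') = 0 := if_neg fun h' => (h'.congr_right hu).asymm h
    have e2 : L.excess (c, diag t, x) = dist (L.r c (diag t)) (L.r c x) := if_pos (h.trans hv)
    simp only [e1, e2, hu, add_zero]
    exact dist_triangle _ _ _
  · refine (L.gap_le _ t).trans ?_
    have e1 : L.excess (c, diag t, x') = 0 := if_neg hv
    simp only [e1, add_zero]
    linarith [L.excess_nonneg (c, diag t, x)]

theorem gap_self (c : P) (x : Str) : L.gap (L.r c x, c, x) = 0 := by
  obtain ⟨u, hu⟩ := exists_diag (L := L) c x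
  refine le_antisymm ((L.gap_le _ u).trans_eq ?_) (L.gap_nonneg _)
  simp only [hu, dist_self, L.excess_self c hu, add_zero]

theorem gap_pos {c : P} {x x' : Str} (h : L.Lt c x x') : 0 < L.gap (L.r c x', c, x) := by
  refine lt_of_le_of_ne (L.gap_nonneg _) fun h0 => ?_
  obtain ⟨t, ht⟩ := L.exists_gap_eq (L.r c x', c, x)
  rw [← h0] at ht
  have h1 := L.excess_nonneg (c, diag t, x)
  have h2 : dist (L.r c x') (L.r c (diag t)) = 0 :=
    le_antisymm (by simp only at ht; linarith) dist_nonneg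
  have h3 : L.excess (c, diag t, x) = 0 := by simp only [h2] at ht; linarith
  have e2 : L.excess (c, diag t, x) = dist (L.r c (diag t)) (L.r c x) :=
    if_pos (h.congr_right (dist_eq_zero.1 h2))
  rw [e2, dist_eq_zero, ← dist_eq_zero.1 h2] at h3
  exact h.ne h3.symm

instance : Nonempty Dia := ⟨⟨(0, 0), by simp⟩⟩

/-- A continuous function that distinguishes the lines and decreases from left to right. -/
noncomputable def rank (q : P × Str) : ℝ :=
  ∑' i : ℕ, (1 / 2 : ℝ) ^ i * L.gap (TopologicalSpace.denseSeq Dia i, q)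

theorem summable_bound : Summable fun i : ℕ => (1 / 2 : ℝ) ^ i * 4 :=
  summable_geometric_two.mul_right 4

theorem norm_term_le (i : ℕ) (q : P × Str) :
    ‖(1 / 2 : ℝ) ^ i * L.gap (TopologicalSpace.denseSeq Dia i, q)‖ ≤ (1 / 2 : ℝ) ^ i * 4 := by
  rw [Real.norm_eq_abs, abs_mul, abs_of_nonneg (by positivity : (0 : ℝ) ≤ (1 / 2) ^ i),
    abs_of_nonneg (L.gap_nonneg _)]
  exact mul_le_mul_of_nonneg_left (L.gap_le_four _) (by positivity)

theorem continuous_rank : Continuous L.rank :=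
  continuous_tsum (fun _ => continuous_const.mul
    (L.continuous_gap.comp (Continuous.prodMk_right _))) summable_bound fun i q => L.norm_term_le i q

theorem rank_congr {c : P} {x x' : Str} (h : L.r c x = L.r c x') :
    L.rank (c, x) = L.rank (c, x') := by
  simp only [rank, L.gap_congr _ h]

/-- At `y = L.r c x'` the gap vanishes for `x'` but not for `x`. The strict inequality persists on
an open set, which meets the dense sequence. -/
theorem rank_lt {c : P} {x x' : Str} (h : L.Lt c x x') : L.rank (c, x') < L.rank (c, x) := by
  have ho : IsOpen {y : Dia | L.gap (y, c, x') < L.gap (y, c, x)} :=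
    isOpen_lt (L.continuous_gap.comp (Continuous.prodMk_left _))
      (L.continuous_gap.comp (Continuous.prodMk_left _))
  have hmem : L.gap (L.r c x', c, x') < L.gap (L.r c x', c, x) := by
    rw [L.gap_self]; exact L.gap_pos h
  obtain ⟨i, hi⟩ := (TopologicalSpace.denseRange_denseSeq Dia).exists_mem_open ho ⟨_, hmem⟩
  have hs : ∀ x, Summable fun i : ℕ =>
      (1 / 2 : ℝ) ^ i * L.gap (TopologicalSpace.denseSeq Dia i, (c, x)) :=
    fun x => summable_bound.of_norm_bounded fun i => L.norm_term_le i (c, x)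
  refine Summable.tsum_lt_tsum (i := i) (fun j => ?_) ?_ (hs x') (hs x)
  · exact mul_le_mul_of_nonneg_left (L.gap_anti _ h) (by positivity)
  · exact mul_lt_mul_of_pos_left hi (by positivity)

theorem rank_le_left (c : P) (x : Str) : L.rank (c, x) ≤ L.rank (c, leftPt) := by
  by_cases h : L.r c leftPt = L.r c x
  · exact (L.rank_congr h).ge
  · rcases lt_or_lt h with h | ⟨a, ha, hj⟩
    · exact (L.rank_lt h).le
    · exact (hj.source_mem (((L.left_iff c leftPt a isLeft_leftPt).1 ha))).elim

theorem right_le_rank (c : P) (x : Str) : L.rank (c, rightPt) ≤ L.rank (c, x) := by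
  by_cases h : L.r c x = L.r c rightPt
  · exact (L.rank_congr h).ge
  · rcases lt_or_lt h with h | ⟨a, ha, hj⟩
    · exact (L.rank_lt h).le
    · exact (L.not_joinedIn_off ha isRight_rightPt hj).elim

theorem right_lt_left (c : P) : L.rank (c, rightPt) < L.rank (c, leftPt) := by
  refine L.rank_lt ((lt_or_lt fun h => ?_).resolve_right fun h => ?_)
  · refine not_isLeft_and_isRight rightPt.2.2 ⟨?_, isRight_rightPt⟩
    exact (L.left_iff c leftPt rightPt isLeft_leftPt).2 h.symm
  · obtain ⟨a, ha, hj⟩ := h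
    exact L.not_joinedIn_off ha isRight_rightPt hj

theorem exists_transverse_coordinate : ∃ U : P × Str → ℝ, Continuous U ∧ (∀ q, |U q| ≤ 1) ∧
    (∀ c x x', U (c, x) = U (c, x') ↔ L.r c x = L.r c x') ∧
    (∀ c, U (c, leftPt) = -1) ∧ (∀ c, U (c, rightPt) = 1) := by
  have hc : ∀ x : Str, Continuous fun q : P × Str => L.rank (q.1, x) := fun x =>
    L.continuous_rank.comp (f := fun q : P × Str => (q.1, x)) (by fun_prop)
  have hpos : ∀ c, 0 < L.rank (c, leftPt) - L.rank (c, rightPt) := fun c =>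
    sub_pos.2 (L.right_lt_left c)
  refine ⟨fun q => 1 - 2 * ((L.rank q - L.rank (q.1, rightPt)) /
    (L.rank (q.1, leftPt) - L.rank (q.1, rightPt))), ?_, ?_, ?_, ?_, ?_⟩
  · refine continuous_const.sub (continuous_const.mul ?_)
    exact (L.continuous_rank.sub (hc _)).div ((hc _).sub (hc _)) fun q => (hpos q.1).ne'
  · rintro ⟨c, x⟩
    have h0 : 0 ≤ (L.rank (c, x) - L.rank (c, rightPt)) /
        (L.rank (c, leftPt) - L.rank (c, rightPt)) :=
      div_nonneg (sub_nonneg.2 (L.right_le_rank c x)) (hpos c).le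
    have h1 : (L.rank (c, x) - L.rank (c, rightPt)) /
        (L.rank (c, leftPt) - L.rank (c, rightPt)) ≤ 1 := by
      rw [div_le_one (hpos c)]; linarith [L.rank_le_left c x]
    rw [abs_le]; constructor <;> linarith
  · intro c x x'
    constructor
    · intro h
      have h' : L.rank (c, x) = L.rank (c, x') := by
        have := (div_left_inj' (hpos c).ne').1 (by linarith :
          (L.rank (c, x) - L.rank (c, rightPt)) / (L.rank (c, leftPt) - L.rank (c, rightPt)) =
          (L.rank (c, x') - L.rank (c, rightPt)) / (L.rank (c, leftPt) - L.rank (c, rightPt)))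
        linarith
      by_contra hne
      rcases lt_or_lt hne with h | h
      · exact (L.rank_lt h).ne' h'
      · exact (L.rank_lt h).ne h'
    · intro h
      simp only [L.rank_congr h]
  · intro c
    simp only
    rw [div_self (hpos c).ne']; norm_num
  · intro c
    simp

end PlaneLines

/-! ### The lines of a suspension structure inside the strips -/

namespace SuspensionLines
section
variable {Y : Type*} [TopologicalSpace Y] {Z : Set (TopSusp Y)} (L : SuspensionLines Z)

theorem height_lt_iff (x : TopSusp Y) : |L.height x| < 1 ↔ |ht x| < 1 := by
  have e : |L.height x| = 1 ↔ |ht x| = 1 := by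
    rw [abs_eq zero_le_one, abs_eq zero_le_one, L.height_eq_one_iff, L.height_eq_neg_one_iff]
  rw [lt_iff_le_and_ne, lt_iff_le_and_ne, Ne, Ne, e]
  exact and_congr_left' ⟨fun _ => abs_ht_le x, fun _ => L.abs_height_le x⟩

/-- The point of `Z` on the line through `x`. -/
noncomputable def foot (x : TopSusp Y) : Z := (L.exists_line x).choose

theorem line_foot (x : TopSusp Y) : L.line (L.foot x) (L.height x) = x :=
  (L.exists_line x).choose_spec

theorem ht_line_lt (z : Z) {s : ℝ} (hs : |s| < 1) : |ht (L.line z s)| < 1 := by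
  rw [← L.height_lt_iff, L.height_line z s hs.le]; exact hs

theorem foot_line (z : Z) {s : ℝ} (hs : |s| < 1) : L.foot (L.line z s) = z := by
  have h := L.line_foot (L.line z s)
  rw [L.height_line z s hs.le] at h
  exact L.line_injective _ _ s hs h

theorem ht_line_one (z : Z) : ht (L.line z 1) = 1 :=
  (L.height_eq_one_iff _).1 (L.height_line z 1 (by simp))

theorem ht_line_neg_one (z : Z) : ht (L.line z (-1)) = -1 :=
  (L.height_eq_neg_one_iff _).1 (L.height_line z (-1) (by simp))

theorem continuous_line_right (z : Z) : Continuous (L.line z) :=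
  L.continuous_line.comp (Continuous.prodMk_right z)

theorem eq_of_foot_eq {x y : TopSusp Y} (h : L.foot x = L.foot y) (h' : L.height x = L.height y) :
    x = y := by
  rw [← L.line_foot x, ← L.line_foot y, h, h']

theorem continuousOn_foot [T2Space (TopSusp Y)] : ContinuousOn L.foot {x | |ht x| < 1} := by
  have := L.compactSpace
  rw [continuousOn_iff_isClosed]
  intro K hK
  refine ⟨(fun q : Z × ℝ => L.line q.1 q.2) '' (K ×ˢ Icc (-1) 1),
    ((hK.isCompact.prod isCompact_Icc).image L.continuous_line).isClosed, ?_⟩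
  ext x
  refine and_congr_left fun hx => ?_
  have hx' : |L.height x| < 1 := (L.height_lt_iff x).2 hx
  constructor
  · exact fun h => ⟨(L.foot x, L.height x), ⟨h, abs_le.1 hx'.le⟩, L.line_foot x⟩
  · rintro ⟨⟨z, s⟩, ⟨hz, hs⟩, rfl⟩
    rw [L.height_line z s (abs_le.2 hs)] at hx'
    show L.foot (L.line z s) ∈ K
    rw [L.foot_line z hx']; exact hz

theorem hasLocConnectedLeaf_line (z : Z) {s : ℝ} (hs : |s| < 1) :
    HasLocConnectedLeaf (L.line z s) ↔ HasLocConnectedLeaf (z : TopSusp Y) := by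
  obtain ⟨f, hf⟩ := L.exists_homeomorph s hs
  rw [← hasLocConnectedLeaf_map_iff f, hf]

theorem hasLocConnectedLeaf_line_foot {x : TopSusp Y} (hx : |ht x| < 1) {s : ℝ} (hs : |s| < 1) :
    HasLocConnectedLeaf (L.line (L.foot x) s) ↔ HasLocConnectedLeaf x := by
  rw [L.hasLocConnectedLeaf_line _ hs,
    ← L.hasLocConnectedLeaf_line _ ((L.height_lt_iff x).2 hx), L.line_foot]

theorem isPreconnected_line (z : Z) : IsPreconnected (L.line z '' Ioo (-1) 1) :=
  (convex_Ioo _ _).isPreconnected.image _ (L.continuous_line_right z).continuousOn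

theorem mem_line_foot {x : TopSusp Y} (hx : |ht x| < 1) :
    x ∈ L.line (L.foot x) '' Ioo (-1) 1 :=
  ⟨L.height x, abs_lt.1 ((L.height_lt_iff x).2 hx), L.line_foot x⟩

end

section
variable {A B : Type*} [TopologicalSpace A] [TopologicalSpace B]
variable [CompactSpace A] [T2Space A] [CompactSpace B] [T2Space B]
variable [TotallyDisconnectedSpace A] [TotallyDisconnectedSpace B]
variable [∀ a : A, (𝓝[≠] a).NeBot] [∀ b : B, (𝓝[≠] b).NeBot]
variable {Z : Set (TopSusp (TopJoin A B))} (L : SuspensionLines Z)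

theorem abs_slope_eq_one_iff {x : TopSusp (TopJoin A B)} (hx : |ht x| < 1) :
    |slope (coord x).1| = 1 ↔ ¬ HasLocConnectedLeaf x := by
  obtain ⟨p, d, rfl⟩ := exists_strip x
  rw [ht_strip] at hx
  rw [hasLocConnectedLeaf_strip_iff, coord_strip, lt_one_iff, isLeft_iff hx, isRight_iff hx,
    abs_eq zero_le_one]
  tauto

/-- By the invariant, a line through a point of a side stays where the slope is `1` or `-1`; being
connected, it cannot change the sign. -/
theorem slope_line_eq {p : A × B} {d : Dia} (hd : |d.1.2| < 1) (hN : ¬ (|d.1.1| + |d.1.2| < 1))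
    {s : ℝ} (hs : |s| < 1) : slope (coord (L.line (L.foot (strip p d)) s)).1 = slope d.1 := by
  set z := L.foot (strip p d) with hz
  have hx : |ht (strip p d)| < 1 := by rwa [ht_strip]
  have hleaf := fun s hs => L.hasLocConnectedLeaf_line_foot hx (s := s) hs
  have hcont : ContinuousOn (fun x : TopSusp (TopJoin A B) => slope (coord x).1)
      (L.line z '' Ioo (-1) 1) := by
    refine continuousOn_slope.comp
      (continuous_subtype_val.comp continuous_coord).continuousOn ?_
    rintro _ ⟨s, hs, rfl⟩
    show |(coord _).1.2| < 1
    rw [coord_snd]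
    exact L.ht_line_lt z (abs_lt.2 hs)
  have hpre := (L.isPreconnected_line z).image _ hcont
  have habs : ∀ v ∈ (fun x : TopSusp (TopJoin A B) => slope (coord x).1) ''
      (L.line z '' Ioo (-1) 1), |v| = 1 := by
    rintro _ ⟨_, ⟨s, hs, rfl⟩, rfl⟩
    rw [abs_slope_eq_one_iff (L.ht_line_lt z (abs_lt.2 hs)), hleaf s (abs_lt.2 hs),
      hasLocConnectedLeaf_strip_iff]
    exact hN
  have h1 : slope (coord (L.line z s)).1 ∈ (fun x : TopSusp (TopJoin A B) => slope (coord x).1) ''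
      (L.line z '' Ioo (-1) 1) := ⟨_, ⟨s, abs_lt.1 hs, rfl⟩, rfl⟩
  have h2 : slope d.1 ∈ (fun x : TopSusp (TopJoin A B) => slope (coord x).1) ''
      (L.line z '' Ioo (-1) 1) := ⟨_, L.mem_line_foot hx, by simp only [coord_strip]⟩
  have key : ∀ {u v : ℝ}, u ∈ (fun x : TopSusp (TopJoin A B) => slope (coord x).1) ''
      (L.line z '' Ioo (-1) 1) → v ∈ (fun x : TopSusp (TopJoin A B) => slope (coord x).1) ''
      (L.line z '' Ioo (-1) 1) → u = -1 → v = 1 → False := by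
    rintro u v hu hv rfl rfl
    have := habs 0 (hpre.Icc_subset hu hv (by simp))
    simp at this
  rcases (abs_eq zero_le_one).1 (habs _ h1) with e1 | e1 <;>
    rcases (abs_eq zero_le_one).1 (habs _ h2) with e2 | e2
  · rw [e1, e2]
  · exact (key h2 h1 e2 e1).elim
  · exact (key h1 h2 e1 e2).elim
  · rw [e1, e2]

omit [TotallyDisconnectedSpace B] [∀ a : A, (𝓝[≠] a).NeBot] [∀ b : B, (𝓝[≠] b).NeBot] in
theorem pr₁_line {p : A × B} {d : Dia} (hd : |d.1.2| < 1) (hr : ¬ IsRight d.1)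
    (h : ∀ s, |s| < 1 → ¬ IsRight (coord (L.line (L.foot (strip p d)) s)).1) {s : ℝ}
    (hs : |s| < 1) : pr₁ (L.line (L.foot (strip p d)) s) = p.1 := by
  have hx : |ht (strip p d)| < 1 := by rwa [ht_strip]
  have hc : ContinuousOn pr₁ (L.line (L.foot (strip p d)) '' Ioo (-1) 1) :=
    continuousOn_pr₁.mono (by rintro _ ⟨s, hs, rfl⟩; exact h s (abs_lt.2 hs))
  rw [← pr₁_strip p hr]
  exact ((L.isPreconnected_line _).image _ hc).subsingleton ⟨_, ⟨s, abs_lt.1 hs, rfl⟩, rfl⟩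
    ⟨_, L.mem_line_foot hx, rfl⟩

omit [TotallyDisconnectedSpace A] [∀ a : A, (𝓝[≠] a).NeBot] [∀ b : B, (𝓝[≠] b).NeBot] in
theorem pr₂_line {p : A × B} {d : Dia} (hd : |d.1.2| < 1) (hl : ¬ IsLeft d.1)
    (h : ∀ s, |s| < 1 → ¬ IsLeft (coord (L.line (L.foot (strip p d)) s)).1) {s : ℝ}
    (hs : |s| < 1) : pr₂ (L.line (L.foot (strip p d)) s) = p.2 := by
  have hx : |ht (strip p d)| < 1 := by rwa [ht_strip]
  have hc : ContinuousOn pr₂ (L.line (L.foot (strip p d)) '' Ioo (-1) 1) :=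
    continuousOn_pr₂.mono (by rintro _ ⟨s, hs, rfl⟩; exact h s (abs_lt.2 hs))
  rw [← pr₂_strip p hl]
  exact ((L.isPreconnected_line _).image _ hc).subsingleton ⟨_, ⟨s, abs_lt.1 hs, rfl⟩, rfl⟩
    ⟨_, L.mem_line_foot hx, rfl⟩

omit [TopologicalSpace A] [TopologicalSpace B] [CompactSpace A] [T2Space A] [CompactSpace B]
  [T2Space B] [TotallyDisconnectedSpace A] [TotallyDisconnectedSpace B]
  [∀ a : A, (𝓝[≠] a).NeBot] [∀ b : B, (𝓝[≠] b).NeBot] in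
theorem _root_.strip_coord_eq {p : A × B} {x : TopSusp (TopJoin A B)}
    (h1 : IsRight (coord x).1 ∨ pr₁ x = p.1) (h2 : IsLeft (coord x).1 ∨ pr₂ x = p.2) :
    strip p (coord x) = x := by
  obtain ⟨p', d', rfl⟩ := exists_strip x
  rw [coord_strip] at *
  refine strip_eq_strip_iff.2 ⟨rfl, ?_, ?_⟩
  · by_cases hr : IsRight d'.1
    · exact Or.inr hr
    · rw [pr₁_strip _ hr] at h1
      exact Or.inl (h1.resolve_left hr).symm
  · by_cases hr : IsLeft d'.1
    · exact Or.inr hr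
    · rw [pr₂_strip _ hr] at h2
      exact Or.inl (h2.resolve_left hr).symm

/-- Lines do not leave their strip. -/
theorem strip_coord_line (p : A × B) {d : Dia} (hd : |d.1.2| < 1) {s : ℝ} (hs : |s| < 1) :
    strip p (coord (L.line (L.foot (strip p d)) s)) = L.line (L.foot (strip p d)) s := by
  have hx : |ht (strip p d)| < 1 := by rwa [ht_strip]
  have hht : ∀ s, |s| < 1 → |(coord (L.line (L.foot (strip p d)) s)).1.2| < 1 := fun s hs => by
    rw [coord_snd]; exact L.ht_line_lt _ hs
  by_cases hN : |d.1.1| + |d.1.2| < 1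
  · have hlr : ∀ s, |s| < 1 → ¬ IsLeft (coord (L.line (L.foot (strip p d)) s)).1 ∧
        ¬ IsRight (coord (L.line (L.foot (strip p d)) s)).1 := by
      intro s hs
      have h := (L.hasLocConnectedLeaf_line_foot hx hs).2 (hasLocConnectedLeaf_strip hN)
      have h2 := mt (abs_slope_eq_one_iff (L.ht_line_lt _ hs)).1 (not_not.2 h)
      rw [isLeft_iff (hht s hs), isRight_iff (hht s hs)]
      exact ⟨fun e => h2 (by rw [e]; simp), fun e => h2 (by rw [e]; simp)⟩
    have hd' := lt_one_iff.1 hN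
    exact strip_coord_eq (Or.inr (L.pr₁_line hd hd'.2 (fun s hs => (hlr s hs).2) hs))
      (Or.inr (L.pr₂_line hd hd'.1 (fun s hs => (hlr s hs).1) hs))
  · have hslope := fun s (hs : |s| < 1) => L.slope_line_eq (p := p) hd hN hs
    by_cases hl : IsLeft d.1
    · have hl' : ∀ s, |s| < 1 → IsLeft (coord (L.line (L.foot (strip p d)) s)).1 := fun s hs => by
        rw [isLeft_iff (hht s hs), hslope s hs, ← isLeft_iff hd]; exact hl
      refine strip_coord_eq (Or.inr (L.pr₁_line hd ?_ (fun s hs => ?_) hs)) (Or.inl (hl' s hs))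
      · exact fun hr => not_isLeft_and_isRight hd ⟨hl, hr⟩
      · exact fun hr => not_isLeft_and_isRight (hht s hs) ⟨hl' s hs, hr⟩
    · have hr : IsRight d.1 := by
        by_contra hr; exact hN (lt_one_iff.2 ⟨hl, hr⟩)
      have hr' : ∀ s, |s| < 1 → IsRight (coord (L.line (L.foot (strip p d)) s)).1 := fun s hs => by
        rw [isRight_iff (hht s hs), hslope s hs, ← isRight_iff hd]; exact hr
      refine strip_coord_eq (Or.inl (hr' s hs)) (Or.inr (L.pr₂_line hd hl (fun s hs => ?_) hs))
      exact fun hl => not_isLeft_and_isRight (hht s hs) ⟨hl, hr' s hs⟩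

theorem strip_coord_foot (p : A × B) {d : Dia} (hd : |d.1.2| < 1) :
    strip p (coord (L.foot (strip p d) : TopSusp (TopJoin A B))) = L.foot (strip p d) := by
  have := L.strip_coord_line p hd (s := 0) (by simp)
  rwa [L.line_zero] at this

/-- The sides are lines themselves: a line on a side runs through all heights and so exhausts it. -/
theorem side_iff (p : A × B) {d d' : Dia} (hd : |d.1.2| < 1) (hd' : |d'.1.2| < 1)
    (hN : ¬ (|d.1.1| + |d.1.2| < 1)) :
    slope d'.1 = slope d.1 ↔ L.foot (strip p d') = L.foot (strip p d) := by
  have hslope := fun s (hs : |s| < 1) => L.slope_line_eq (p := p) hd hN hs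
  constructor
  · intro h
    set z := L.foot (strip p d) with hz
    have hc : Continuous fun s => ht (L.line z s) := continuous_ht.comp (L.continuous_line_right z)
    have hmem : d'.1.2 ∈ Icc (ht (L.line z (-1))) (ht (L.line z 1)) := by
      rw [L.ht_line_one, L.ht_line_neg_one]; exact abs_le.1 hd'.le
    obtain ⟨s, hs, hs'⟩ := intermediate_value_Icc (by norm_num : (-1 : ℝ) ≤ 1) hc.continuousOn hmem
    simp only at hs'
    have hs1 : |s| < 1 := by
      rw [← L.height_line z s (abs_le.2 hs), L.height_lt_iff, hs']; exact hd'
    have e : coord (L.line z s) = d' := by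
      rw [← Subtype.coe_inj, ← chord_slope d', ← chord_slope (coord _), coord_snd, hs', hslope s hs1,
        h]
    have := L.strip_coord_line p hd hs1
    rw [e] at this
    rw [this, L.foot_line _ hs1]
  · intro h
    have h1 := hslope _ ((L.height_lt_iff (strip p d')).2 (by rwa [ht_strip]))
    rw [← h, L.line_foot, coord_strip] at h1
    exact h1

/-- The lines of a suspension structure, as seen in the strips. -/
noncomputable def planeLines : PlaneLines (A × B) where
  r p z := coord (L.foot (strip p ⟨z.1, z.2.1⟩) : TopSusp (TopJoin A B))
  l p z s := coord (L.line (L.foot (strip p ⟨z.1, z.2.1⟩)) s)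
  continuous_r := by
    refine continuous_coord.comp (continuous_subtype_val.comp ?_)
    refine L.continuousOn_foot.comp_continuous (f := fun q : (A × B) × Str =>
      strip q.1 ⟨q.2.1, q.2.2.1⟩) ?_ fun q => ?_
    · exact continuous_strip.comp (f := fun q : (A × B) × Str =>
        (q.1, (⟨q.2.1, q.2.2.1⟩ : Dia))) (by fun_prop)
    · show |ht _| < 1
      rw [ht_strip]; exact q.2.2.2
  continuous_l p z := continuous_coord.comp (L.continuous_line_right _)
  l_lt p z s hs := by rw [coord_snd]; exact L.ht_line_lt _ hs
  l_one p z := by rw [coord_snd, L.ht_line_one]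
  l_neg_one p z := by rw [coord_snd, L.ht_line_neg_one]
  r_l p z s hs := by
    simp only
    rw [Subtype.coe_eta, L.strip_coord_line p (d := ⟨z.1, z.2.1⟩) z.2.2 hs, L.foot_line _ hs]
  exists_l p z z' h := by
    have h' := congrArg (strip p) h
    rw [L.strip_coord_foot p (d := ⟨z.1, z.2.1⟩) z.2.2,
      L.strip_coord_foot p (d := ⟨z'.1, z'.2.1⟩) z'.2.2, Subtype.coe_inj] at h'
    refine ⟨L.height (strip p ⟨z'.1, z'.2.1⟩), ?_, ?_⟩
    · rw [L.height_lt_iff, ht_strip]; exact z'.2.2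
    · rw [h', L.line_foot, coord_strip]
  left_iff p z z' hz := by
    have hN : ¬ (|z.1.1| + |z.1.2| < 1) := fun h =>
      (lt_one_iff (d := ⟨z.1, z.2.1⟩).1 h).1 hz
    have h := L.side_iff p (d := ⟨z.1, z.2.1⟩) (d' := ⟨z'.1, z'.2.1⟩) z.2.2 z'.2.2 hN
    rw [(isLeft_iff z.2.2).1 hz, ← isLeft_iff z'.2.2] at h
    rw [h]
    refine ⟨fun e => by rw [e], fun e => ?_⟩
    have h' := congrArg (strip p) e
    rwa [L.strip_coord_foot p (d := ⟨z.1, z.2.1⟩) z.2.2,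
      L.strip_coord_foot p (d := ⟨z'.1, z'.2.1⟩) z'.2.2, Subtype.coe_inj] at h'
  right_iff p z z' hz := by
    have hN : ¬ (|z.1.1| + |z.1.2| < 1) := fun h =>
      (lt_one_iff (d := ⟨z.1, z.2.1⟩).1 h).2 hz
    have h := L.side_iff p (d := ⟨z.1, z.2.1⟩) (d' := ⟨z'.1, z'.2.1⟩) z.2.2 z'.2.2 hN
    rw [(isRight_iff z.2.2).1 hz, ← isRight_iff z'.2.2] at h
    rw [h]
    refine ⟨fun e => by rw [e], fun e => ?_⟩
    have h' := congrArg (strip p) e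
    rwa [L.strip_coord_foot p (d := ⟨z.1, z.2.1⟩) z.2.2,
      L.strip_coord_foot p (d := ⟨z'.1, z'.2.1⟩) z'.2.2, Subtype.coe_inj] at h'

end
end SuspensionLines

/-! ### Maps of the strips that respect the gluing -/

/-- A family of bijections of the diamond that respects the gluing of the strips to the suspension
of the join. -/
structure StripCompatible {A B : Type*} (g : A × B → Dia → Dia) : Prop where
  bijective : ∀ p, Function.Bijective (g p)
  left_iff : ∀ p d, IsLeft (g p d).1 ↔ IsLeft d.1
  right_iff : ∀ p d, IsRight (g p d).1 ↔ IsRight d.1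
  eq_of_left : ∀ p p' : A × B, p.1 = p'.1 → ∀ d : Dia, IsLeft d.1 → g p d = g p' d
  eq_of_right : ∀ p p' : A × B, p.2 = p'.2 → ∀ d : Dia, IsRight d.1 → g p d = g p' d

namespace StripCompatible
variable {A B : Type*} {f g : A × B → Dia → Dia}

theorem comp (hf : StripCompatible f) (hg : StripCompatible g) :
    StripCompatible fun p d => f p (g p d) where
  bijective p := (hf.bijective p).comp (hg.bijective p)
  left_iff p d := (hf.left_iff _ _).trans (hg.left_iff _ _)
  right_iff p d := (hf.right_iff _ _).trans (hg.right_iff _ _)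
  eq_of_left p p' h d hd := by
    rw [← hg.eq_of_left p p' h d hd, hf.eq_of_left p p' h _ ((hg.left_iff _ _).2 hd)]
  eq_of_right p p' h d hd := by
    rw [← hg.eq_of_right p p' h d hd, hf.eq_of_right p p' h _ ((hg.right_iff _ _).2 hd)]

theorem of_fixes_sides (hb : ∀ p, Function.Bijective (g p))
    (hl : ∀ p d, IsLeft d.1 → g p d = d) (hr : ∀ p d, IsRight d.1 → g p d = d) :
    StripCompatible g where
  bijective := hb
  left_iff p d := by
    constructor
    · intro h
      have := (hb p).1 (hl p _ h)
      rwa [this] at h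
    · intro h; rwa [hl p d h]
  right_iff p d := by
    constructor
    · intro h
      have := (hb p).1 (hr p _ h)
      rwa [this] at h
    · intro h; rwa [hr p d h]
  eq_of_left p p' _ d hd := by rw [hl p d hd, hl p' d hd]
  eq_of_right p p' _ d hd := by rw [hr p d hd, hr p' d hd]

theorem eq_of_strip_eq (hg : StripCompatible g) {p p' : A × B} {d : Dia}
    (h : strip p d = strip p' d) : g p d = g p' d := by
  obtain ⟨-, h1, h2⟩ := strip_eq_strip_iff.1 h
  have e1 : g p d = g (p.1, p'.2) d := by
    rcases h2 with h2 | h2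
    · rw [show p = (p.1, p'.2) from Prod.ext rfl h2]
    · exact hg.eq_of_left p (p.1, p'.2) rfl d h2
  have e2 : g (p.1, p'.2) d = g p' d := by
    rcases h1 with h1 | h1
    · rw [show (p.1, p'.2) = p' from Prod.ext h1 rfl]
    · exact hg.eq_of_right (p.1, p'.2) p' rfl d h1
  exact e1.trans e2

theorem strip_eq_iff (hg : StripCompatible g) {p p' : A × B} {d d' : Dia} :
    strip p (g p d) = strip p' (g p' d') ↔ strip p d = strip p' d' := by
  constructor
  · intro h
    obtain ⟨h0, h1, h2⟩ := strip_eq_strip_iff.1 h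
    rw [hg.right_iff] at h1
    rw [hg.left_iff] at h2
    have h3 : strip p d = strip p' d := strip_eq_strip_iff.2 ⟨rfl, h1, h2⟩
    rw [hg.eq_of_strip_eq h3] at h0
    rw [h3, (hg.bijective p').1 h0]
  · intro h
    obtain ⟨rfl, h1, h2⟩ := strip_eq_strip_iff.1 h
    rw [← hg.eq_of_strip_eq h]
    exact strip_eq_strip_iff.2 ⟨rfl, by rwa [hg.right_iff], by rwa [hg.left_iff]⟩

end StripCompatible

/-- By compactness the product with `I` of the strips is still mapped by a quotient map, so the
family descends; each stage is a continuous bijection of a compact Hausdorff space. -/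
theorem exists_isotopy_of_stripCompatible {A B : Type*} [TopologicalSpace A] [TopologicalSpace B]
    [CompactSpace A] [T2Space A] [CompactSpace B] [T2Space B] {f : I → A × B → Dia → Dia}
    (hf : Continuous fun q : I × (A × B) × Dia => f q.1 q.2.1 q.2.2)
    (hc : ∀ t, StripCompatible (f t)) :
    ∃ F : I → (TopSusp (TopJoin A B) ≃ₜ TopSusp (TopJoin A B)),
      Continuous (fun q : I × TopSusp (TopJoin A B) => F q.1 q.2) ∧
      ∀ t p d, F t (strip p d) = strip p (f t p d) := by
  choose P D hPD using exists_strip (A := A) (B := B)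
  let Φ : I → TopSusp (TopJoin A B) → TopSusp (TopJoin A B) := fun t x => strip (P x) (f t (P x) (D x))
  have hΦ : ∀ t p d, Φ t (strip p d) = strip p (f t p d) := fun t p d =>
    (hc t).strip_eq_iff.2 (hPD _)
  have hcont : Continuous fun q : I × TopSusp (TopJoin A B) => Φ q.1 q.2 := by
    let κ : I × (A × B) × Dia → I × TopSusp (TopJoin A B) := fun q => (q.1, strip q.2.1 q.2.2)
    have hκ : Continuous κ := continuous_fst.prodMk (continuous_strip.comp continuous_snd)
    have hs : Function.Surjective κ := by
      rintro ⟨t, x⟩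
      exact ⟨(t, P x, D x), Prod.ext rfl (hPD x)⟩
    rw [(hκ.isClosedMap.isQuotientMap hκ hs).continuous_iff]
    have : (fun q : I × TopSusp (TopJoin A B) => Φ q.1 q.2) ∘ κ =
        fun q => strip q.2.1 (f q.1 q.2.1 q.2.2) := by
      ext1 q; exact hΦ _ _ _
    rw [this]
    exact continuous_strip.comp ((continuous_fst.comp continuous_snd).prodMk hf)
  have hbij : ∀ t, Function.Bijective (Φ t) := by
    refine fun t => ⟨fun x y h => ?_, fun x => ?_⟩
    · rw [← hPD x, ← hPD y]
      exact (hc t).strip_eq_iff.1 h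
    · obtain ⟨d, hd⟩ := ((hc t).bijective (P x)).2 (D x)
      exact ⟨strip (P x) d, by rw [hΦ, hd, hPD]⟩
  refine ⟨fun t => Continuous.homeoOfEquivCompactToT2 (f := Equiv.ofBijective (Φ t) (hbij t))
    (hcont.comp (Continuous.prodMk_right t)), hcont, hΦ⟩

/-! ### The Alexander trick on the diamond -/

namespace Dia

/-- The sum norm on the plane. -/
def norm₁ (d : ℝ × ℝ) : ℝ := |d.1| + |d.2|

theorem norm₁_nonneg (d : ℝ × ℝ) : 0 ≤ norm₁ d := by unfold norm₁; positivity

theorem norm₁_smul {m : ℝ} (hm : 0 ≤ m) (d : ℝ × ℝ) : norm₁ (m • d) = m * norm₁ d := by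
  simp [norm₁, abs_mul, abs_of_nonneg hm, mul_add]

theorem continuous_norm₁ : Continuous norm₁ := by unfold norm₁; fun_prop

theorem eq_zero_of_norm₁ {d : ℝ × ℝ} (h : norm₁ d = 0) : d = 0 := by
  unfold norm₁ at h
  have h1 := abs_nonneg d.1
  have h2 := abs_nonneg d.2
  exact Prod.ext (abs_eq_zero.1 (by linarith)) (abs_eq_zero.1 (by linarith))

/-- The Alexander isotopy of a self-map of the diamond that fixes the boundary. -/
noncomputable def alexander (g : Dia → Dia) (t : ℝ) (d : Dia) : Dia :=
  clamp (max (norm₁ d.1) t • (g (clamp ((max (norm₁ d.1) t)⁻¹ • d.1))).1)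

theorem norm₁_inv_smul_le {d : ℝ × ℝ} {t : ℝ} : norm₁ ((max (norm₁ d) t)⁻¹ • d) ≤ 1 := by
  have h0 : 0 ≤ max (norm₁ d) t := (norm₁_nonneg d).trans (le_max_left _ _)
  rw [norm₁_smul (inv_nonneg.2 h0)]
  exact inv_mul_le_one_of_le₀ (le_max_left _ _) h0

theorem norm₁_smul_coe_le {d e : Dia} {t : ℝ} (ht : t ≤ 1) :
    norm₁ (max (norm₁ d.1) t • e.1) ≤ 1 := by
  have h0 : 0 ≤ max (norm₁ d.1) t := (norm₁_nonneg _).trans (le_max_left _ _)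
  rw [norm₁_smul h0]
  exact mul_le_one₀ (max_le d.2 ht) (norm₁_nonneg _) e.2

theorem alexander_val {g : Dia → Dia} {t : ℝ} (ht : t ≤ 1) (d : Dia) : (alexander g t d).1 =
    max (norm₁ d.1) t • (g (clamp ((max (norm₁ d.1) t)⁻¹ • d.1))).1 :=
  clamp_val (norm₁_smul_coe_le ht)

/-- From radius `t` on, `g` is evaluated only on the boundary, which it fixes; at the centre the
scaling factor is zero. -/
theorem alexander_of_le {g : Dia → Dia} (hg : ∀ d : Dia, norm₁ d.1 = 1 → g d = d) {t : ℝ}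
    (ht1 : t ≤ 1) {d : Dia} (h : t ≤ norm₁ d.1) : alexander g t d = d := by
  refine Subtype.ext ?_
  rw [alexander_val ht1, max_eq_left h]
  rcases (norm₁_nonneg d.1).eq_or_lt with h0 | h0
  · rw [← h0, eq_zero_of_norm₁ h0.symm, zero_smul]
  · have h1 : norm₁ ((norm₁ d.1)⁻¹ • d.1) = 1 := by
      rw [norm₁_smul (inv_nonneg.2 h0.le), inv_mul_cancel₀ h0.ne']
    have h2 := clamp_val (d := (norm₁ d.1)⁻¹ • d.1) h1.le
    rw [hg _ (by rw [h2, h1]), h2, smul_inv_smul₀ h0.ne']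

theorem alexander_alexander {g g' : Dia → Dia} (hg : ∀ d : Dia, norm₁ d.1 = 1 → g d = d)
    (hg' : ∀ d : Dia, norm₁ d.1 = 1 → g' d = d) (hgg : ∀ d, g' (g d) = d) {t : ℝ}
    (ht1 : t ≤ 1) (d : Dia) : alexander g' t (alexander g t d) = d := by
  rcases le_total t (norm₁ d.1) with h | h
  · rw [alexander_of_le hg ht1 h, alexander_of_le hg' ht1 h]
  · rcases h.eq_or_lt with h | h
    · rw [alexander_of_le hg ht1 h.ge, alexander_of_le hg' ht1 h.ge]
    have h0 : 0 < t := (norm₁_nonneg _).trans_lt h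
    have e1 : (alexander g t d).1 = t • (g (clamp (t⁻¹ • d.1))).1 := by
      rw [alexander_val ht1, max_eq_right h.le]
    have e2 : norm₁ (alexander g t d).1 ≤ t := by
      rw [e1, norm₁_smul h0.le]
      exact mul_le_of_le_one_right h0.le (g _).2
    refine Subtype.ext ?_
    rw [alexander_val ht1, max_eq_right e2, e1, inv_smul_smul₀ h0.ne', clamp_self, hgg]
    have := norm₁_inv_smul_le (d := d.1) (t := t)
    rw [max_eq_right h.le] at this
    rw [clamp_val this, smul_inv_smul₀ h0.ne']

theorem alexander_one (g : Dia → Dia) (d : Dia) : alexander g 1 d = g d := by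
  refine Subtype.ext ?_
  rw [alexander_val le_rfl, max_eq_right (show norm₁ d.1 ≤ 1 from d.2), inv_one, one_smul, one_smul, clamp_self]

/-- Continuity is at stake only where `max (norm₁ d) t` vanishes, and there it multiplies a bounded
value. -/
theorem continuous_alexander {W : Type*} [TopologicalSpace W] {g : W → Dia → Dia}
    (hg : Continuous fun q : W × Dia => g q.1 q.2) :
    Continuous fun q : ℝ × W × Dia => alexander (g q.2.1) q.1 q.2.2 := by
  unfold alexander
  refine continuous_clamp.comp ?_
  set m : ℝ × W × Dia → ℝ := fun q => max (norm₁ q.2.2.1) q.1 with hm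
  have hmc : Continuous m := by
    have := continuous_norm₁
    fun_prop
  have hG : ContinuousOn (fun q : ℝ × W × Dia => (g q.2.1 (clamp ((m q)⁻¹ • q.2.2.1))).1)
      {q | m q ≠ 0} := by
    refine continuous_subtype_val.comp_continuousOn (hg.comp_continuousOn
      (f := fun q : ℝ × W × Dia => (q.2.1, clamp ((m q)⁻¹ • q.2.2.1))) ?_)
    refine ContinuousOn.prodMk (by fun_prop) (continuous_clamp.comp_continuousOn ?_)
    exact ContinuousOn.smul (hmc.continuousOn.inv₀ fun q hq => hq) (by fun_prop)
  have h1 := continuous_mul_of_bounded (K := 1) hmc (continuous_fst.comp_continuousOn hG)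
    fun q => by
      have := (g q.2.1 (clamp ((m q)⁻¹ • q.2.2.1))).2
      simp only [Function.comp]; linarith [abs_nonneg (g q.2.1 (clamp ((m q)⁻¹ • q.2.2.1))).1.2]
  have h2 := continuous_mul_of_bounded (K := 1) hmc (continuous_snd.comp_continuousOn hG)
    fun q => abs_snd_le _
  refine (h1.prodMk h2).congr fun q => ?_
  ext <;> simp [mul_comm, hm]

end Dia

/-! ### Vertical motions of the sides -/

namespace Dia

theorem eq_chord_of_abs_snd {d : Dia} (h : |d.1.2| = 1) (x : ℝ) : d.1 = chord x d.1.2 := by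
  have := d.abs_fst_le
  rw [h, sub_self, abs_nonpos_iff] at this
  ext
  · simp [chord, h, this]
  · rfl

theorem isLeft_of_abs_snd {d : Dia} (h : |d.1.2| = 1) : IsLeft d.1 := by
  rw [eq_chord_of_abs_snd h 0]; simp [IsLeft, chord, h]

theorem isRight_of_abs_snd {d : Dia} (h : |d.1.2| = 1) : IsRight d.1 := by
  rw [eq_chord_of_abs_snd h 0]; simp [IsRight, chord, h]

theorem isLeft_chord (s : ℝ) : IsLeft (chord (-1) s) := by simp [IsLeft, chord]

theorem isRight_chord (s : ℝ) : IsRight (chord 1 s) := by simp [IsRight, chord]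

theorem eq_of_isLeft {d d' : Dia} (h : IsLeft d.1) (h' : IsLeft d'.1) (e : d.1.2 = d'.1.2) :
    d = d' := by
  unfold IsLeft at h h'
  exact Subtype.ext (Prod.ext (by rw [h, h', e]) e)

theorem eq_of_isRight {d d' : Dia} (h : IsRight d.1) (h' : IsRight d'.1) (e : d.1.2 = d'.1.2) :
    d = d' := by
  unfold IsRight at h h'
  exact Subtype.ext (Prod.ext (by rw [h, h', e]) e)

/-- The point of slope `x` and height `s`. -/
noncomputable def point (x s : ℝ) : Dia := clamp (chord x s)

theorem point_val {x s : ℝ} (hx : |x| ≤ 1) (hs : |s| ≤ 1) : (point x s).1 = chord x s :=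
  clamp_val (chord_mem hx hs)

theorem continuous_point : Continuous fun q : ℝ × ℝ => point q.1 q.2 := by
  refine continuous_clamp.comp ?_
  unfold chord; fun_prop

end Dia

theorem strictMonoOn_of_injOn_Icc {a : ℝ → ℝ} (hc : ContinuousOn a (Icc (-1) 1))
    (hi : InjOn a (Icc (-1) 1)) (h1 : a 1 = 1) (h2 : a (-1) = -1) :
    StrictMonoOn a (Icc (-1) 1) :=
  hc.strictMonoOn_of_injOn_Icc (by norm_num) (by rw [h1, h2]; norm_num) hi

/-- Families of increasing bijections of `[-1,1]` by which the left and the right side of the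
strips are moved. -/
structure SideMotion (A B : Type*) [TopologicalSpace A] [TopologicalSpace B] where
  a : A × B → ℝ → ℝ
  b : A × B → ℝ → ℝ
  continuous_a : Continuous fun q : (A × B) × ℝ => a q.1 q.2
  continuous_b : Continuous fun q : (A × B) × ℝ => b q.1 q.2
  a_one : ∀ p, a p 1 = 1
  b_one : ∀ p, b p 1 = 1
  a_neg_one : ∀ p, a p (-1) = -1
  b_neg_one : ∀ p, b p (-1) = -1
  strictMonoOn_a : ∀ p, StrictMonoOn (a p) (Icc (-1) 1)
  strictMonoOn_b : ∀ p, StrictMonoOn (b p) (Icc (-1) 1)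
  a_congr : ∀ p p', p.1 = p'.1 → a p = a p'
  b_congr : ∀ p p', p.2 = p'.2 → b p = b p'

namespace SideMotion
variable {A B : Type*} [TopologicalSpace A] [TopologicalSpace B] (M : SideMotion A B)

/-- The new height at time `t` of the point of slope `x` and height `s`. -/
noncomputable def lift (t : ℝ) (p : A × B) (x s : ℝ) : ℝ :=
  (1 - t) * s + t * ((1 - x) / 2 * M.a p s + (1 + x) / 2 * M.b p s)

theorem lift_of_abs_eq_one (t : ℝ) (p : A × B) (x : ℝ) {s : ℝ} (hs : |s| = 1) :
    M.lift t p x s = s := by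
  unfold lift
  rcases (abs_eq zero_le_one).1 hs with rfl | rfl
  · rw [M.a_one, M.b_one]; ring
  · rw [M.a_neg_one, M.b_neg_one]; ring

/-- A convex combination of increasing functions is increasing, so linear interpolation between
heights remains injective. -/
theorem strictMonoOn_lift {t : ℝ} (ht : t ∈ Icc (0 : ℝ) 1) (p : A × B) {x : ℝ} (hx : |x| ≤ 1) :
    StrictMonoOn (M.lift t p x) (Icc (-1) 1) := by
  intro s hs s' hs' hss
  have ha := M.strictMonoOn_a p hs hs' hss
  have hb := M.strictMonoOn_b p hs hs' hss
  rw [abs_le] at hx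
  have h1 : (1 - x) / 2 * M.a p s + (1 + x) / 2 * M.b p s <
      (1 - x) / 2 * M.a p s' + (1 + x) / 2 * M.b p s' := by
    rcases hx.1.eq_or_lt with rfl | hx1
    · norm_num; exact ha
    · nlinarith
  unfold lift
  rcases ht.1.eq_or_lt with rfl | ht0
  · simpa using hss
  · have := ht.2
    nlinarith

theorem continuous_lift : Continuous fun q : ℝ × (A × B) × ℝ × ℝ =>
    M.lift q.1 q.2.1 q.2.2.1 q.2.2.2 := by
  have ha := M.continuous_a.comp (f := fun q : ℝ × (A × B) × ℝ × ℝ => (q.2.1, q.2.2.2))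
    (by fun_prop)
  have hb := M.continuous_b.comp (f := fun q : ℝ × (A × B) × ℝ × ℝ => (q.2.1, q.2.2.2))
    (by fun_prop)
  simp only [Function.comp_def] at ha hb
  unfold lift
  fun_prop

theorem bijOn_lift {t : ℝ} (ht : t ∈ Icc (0 : ℝ) 1) (p : A × B) {x : ℝ} (hx : |x| ≤ 1) :
    BijOn (M.lift t p x) (Icc (-1) 1) (Icc (-1) 1) := by
  have hm := M.strictMonoOn_lift ht p hx
  have e1 : M.lift t p x 1 = 1 := M.lift_of_abs_eq_one t p x (by simp)
  have e2 : M.lift t p x (-1) = -1 := M.lift_of_abs_eq_one t p x (by simp)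
  have hc : ContinuousOn (M.lift t p x) (Icc (-1) 1) := (M.continuous_lift.comp
    (f := fun s => (t, p, x, s)) (by fun_prop)).continuousOn
  refine ⟨fun s hs => ⟨?_, ?_⟩, hm.injOn, ?_⟩
  · rw [← e2]; exact hm.monotoneOn (by simp) hs hs.1
  · conv_rhs => rw [← e1]
    exact hm.monotoneOn hs (by simp) hs.2
  · have := intermediate_value_Icc (by norm_num : (-1 : ℝ) ≤ 1) hc
    rwa [e1, e2] at this

theorem abs_lift_le {t : ℝ} (ht : t ∈ Icc (0 : ℝ) 1) (p : A × B) {x s : ℝ} (hx : |x| ≤ 1)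
    (hs : |s| ≤ 1) : |M.lift t p x s| ≤ 1 :=
  abs_le.2 ((M.bijOn_lift ht p hx).mapsTo (abs_le.1 hs))

theorem abs_lift_eq_one_iff {t : ℝ} (ht : t ∈ Icc (0 : ℝ) 1) (p : A × B) {x s : ℝ}
    (hx : |x| ≤ 1) (hs : |s| ≤ 1) : |M.lift t p x s| = 1 ↔ |s| = 1 := by
  constructor
  · intro h
    have h1 := M.lift_of_abs_eq_one t p x h
    rwa [(M.bijOn_lift ht p hx).injOn (abs_le.1 (M.abs_lift_le ht p hx hs)) (abs_le.1 hs) h1] at h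
  · intro h; rw [M.lift_of_abs_eq_one t p x h, h]

/-- The family of maps of the strips that moves the points vertically. -/
noncomputable def move (t : ℝ) (p : A × B) (d : Dia) : Dia :=
  point (slope d.1) (M.lift t p (slope d.1) d.1.2)

variable {M}

theorem move_val {t : ℝ} (ht : t ∈ Icc (0 : ℝ) 1) (p : A × B) (d : Dia) :
    (M.move t p d).1 = chord (slope d.1) (M.lift t p (slope d.1) d.1.2) :=
  point_val d.abs_slope_le (M.abs_lift_le ht p d.abs_slope_le d.abs_snd_le)

theorem move_of_abs_eq_one {t : ℝ} (ht : t ∈ Icc (0 : ℝ) 1) (p : A × B) {d : Dia}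
    (h : |d.1.2| = 1) : M.move t p d = d := by
  refine Subtype.ext ?_
  rw [move_val ht, M.lift_of_abs_eq_one t p _ h, ← eq_chord_of_abs_snd h]

theorem abs_move_lt_iff {t : ℝ} (ht : t ∈ Icc (0 : ℝ) 1) (p : A × B) {d : Dia} :
    |(M.move t p d).1.2| < 1 ↔ |d.1.2| < 1 := by
  rw [lt_iff_le_and_ne, lt_iff_le_and_ne, move_val ht]
  exact and_congr (iff_of_true (M.abs_lift_le ht p d.abs_slope_le d.abs_snd_le) d.abs_snd_le)
    (not_congr (M.abs_lift_eq_one_iff ht p d.abs_slope_le d.abs_snd_le))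

theorem slope_move {t : ℝ} (ht : t ∈ Icc (0 : ℝ) 1) (p : A × B) {d : Dia} (h : |d.1.2| < 1) :
    slope (M.move t p d).1 = slope d.1 := by
  have := (abs_move_lt_iff (M := M) ht p).2 h
  rw [move_val ht] at this ⊢
  exact slope_chord this

theorem bijective_move {t : ℝ} (ht : t ∈ Icc (0 : ℝ) 1) (p : A × B) :
    Function.Bijective (M.move t p) := by
  constructor
  · intro d d' h
    by_cases hd : |d.1.2| < 1
    · have hd' : |d'.1.2| < 1 := by rw [← abs_move_lt_iff (M := M) ht p, ← h, abs_move_lt_iff ht p]; exact hd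
      have h1 : slope d.1 = slope d'.1 := by rw [← slope_move (M := M) ht p hd, h, slope_move ht p hd']
      have h2 := congrArg (fun e : Dia => e.1.2) h
      simp only [move_val ht, chord, h1] at h2
      have h3 := (M.bijOn_lift ht p d'.abs_slope_le).injOn (abs_le.1 d.abs_snd_le)
        (abs_le.1 d'.abs_snd_le) h2
      rw [← Subtype.coe_inj, ← chord_slope d, ← chord_slope d', h1, h3]
    · have hd' : ¬ |d'.1.2| < 1 := by rw [← abs_move_lt_iff (M := M) ht p, ← h, abs_move_lt_iff ht p]; exact hd
      rwa [move_of_abs_eq_one ht p (d.abs_snd_le.lt_or_eq.resolve_left hd),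
        move_of_abs_eq_one ht p (d'.abs_snd_le.lt_or_eq.resolve_left hd')] at h
  · intro e
    rcases e.abs_snd_le.lt_or_eq with he | he
    · obtain ⟨s, hs, hse⟩ := (M.bijOn_lift ht p e.abs_slope_le).surjOn (abs_le.1 e.abs_snd_le)
      have hs1 : |s| < 1 := by
        refine lt_of_le_of_ne (abs_le.2 hs) fun h => he.ne ?_
        rw [← hse, M.abs_lift_eq_one_iff ht p e.abs_slope_le (abs_le.2 hs), h]
      refine ⟨point (slope e.1) s, Subtype.ext ?_⟩
      rw [move_val ht, point_val e.abs_slope_le hs1.le, slope_chord hs1]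
      simp only [chord] at hse ⊢
      rw [hse]
      exact chord_slope e
    · exact ⟨e, move_of_abs_eq_one ht p he⟩

theorem stripCompatible_move {t : ℝ} (ht : t ∈ Icc (0 : ℝ) 1) : StripCompatible (M.move t) where
  bijective := bijective_move ht
  left_iff p d := by
    by_cases h : |d.1.2| < 1
    · rw [isLeft_iff ((abs_move_lt_iff ht p).2 h), isLeft_iff h, slope_move ht p h]
    · rw [move_of_abs_eq_one ht p (d.abs_snd_le.lt_or_eq.resolve_left h)]
  right_iff p d := by
    by_cases h : |d.1.2| < 1
    · rw [isRight_iff ((abs_move_lt_iff ht p).2 h), isRight_iff h, slope_move ht p h]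
    · rw [move_of_abs_eq_one ht p (d.abs_snd_le.lt_or_eq.resolve_left h)]
  eq_of_left p p' hp d hd := by
    by_cases h : |d.1.2| < 1
    · unfold move lift
      rw [(isLeft_iff h).1 hd, M.a_congr p p' hp]
      norm_num
    · have h' := d.abs_snd_le.lt_or_eq.resolve_left h
      rw [move_of_abs_eq_one ht p h', move_of_abs_eq_one ht p' h']
  eq_of_right p p' hp d hd := by
    by_cases h : |d.1.2| < 1
    · unfold move lift
      rw [(isRight_iff h).1 hd, M.b_congr p p' hp]
      norm_num
    · have h' := d.abs_snd_le.lt_or_eq.resolve_left h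
      rw [move_of_abs_eq_one ht p h', move_of_abs_eq_one ht p' h']

theorem move_zero (p : A × B) (d : Dia) : M.move 0 p d = d := by
  refine Subtype.ext ?_
  rw [move_val (by simp)]
  simp only [lift, sub_zero, one_mul, zero_mul, add_zero]
  exact chord_slope d

theorem continuous_move : Continuous fun q : I × (A × B) × Dia =>
    M.move q.1 q.2.1 q.2.2 := by
  have hslope : ContinuousOn (fun q : I × (A × B) × Dia => slope q.2.2.1)
      {q | |q.2.2.1.2| < 1} :=
    continuousOn_slope.comp (f := fun q : I × (A × B) × Dia => q.2.2.1) (by fun_prop)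
      fun q hq => hq
  have hb1 : ∀ q : I × (A × B) × Dia, |slope q.2.2.1| ≤ 1 := fun q => q.2.2.abs_slope_le
  have ha := M.continuous_a.comp (f := fun q : I × (A × B) × Dia => (q.2.1, q.2.2.1.2))
    (by fun_prop)
  have hb := M.continuous_b.comp (f := fun q : I × (A × B) × Dia => (q.2.1, q.2.2.1.2))
    (by fun_prop)
  simp only [Function.comp_def] at ha hb
  -- The slope is tamed by `b - a`, which vanishes at the suspension points; below, `1 - |lift|`
  -- plays the same role.
  have h1 : Continuous fun q : I × (A × B) × Dia =>
      slope q.2.2.1 * (M.b q.2.1 q.2.2.1.2 - M.a q.2.1 q.2.2.1.2) := by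
    refine continuous_mul_of_bounded (hb.sub ha) (hslope.mono fun q hq => ?_) hb1
    refine lt_of_le_of_ne q.2.2.abs_snd_le fun h => hq ?_
    rcases (abs_eq zero_le_one).1 h with h | h
    · simp only [h, M.a_one, M.b_one, sub_self]
    · simp only [h, M.a_neg_one, M.b_neg_one, sub_self]
  have h2 : Continuous fun q : I × (A × B) × Dia =>
      M.lift q.1 q.2.1 (slope q.2.2.1) q.2.2.1.2 := by
    have : (fun q : I × (A × B) × Dia => M.lift q.1 q.2.1 (slope q.2.2.1) q.2.2.1.2) =
        fun q : I × (A × B) × Dia => (1 - (q.1 : ℝ)) * q.2.2.1.2 + q.1 * ((M.a q.2.1 q.2.2.1.2 + M.b q.2.1 q.2.2.1.2) / 2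
          + (slope q.2.2.1 * (M.b q.2.1 q.2.2.1.2 - M.a q.2.1 q.2.2.1.2)) / 2) := by
      ext q; unfold lift; ring
    rw [this]
    fun_prop
  have h3 : Continuous fun q : I × (A × B) × Dia =>
      slope q.2.2.1 * (1 - |M.lift q.1 q.2.1 (slope q.2.2.1) q.2.2.1.2|) := by
    refine continuous_mul_of_bounded (by fun_prop) (hslope.mono fun q hq => ?_) hb1
    refine lt_of_le_of_ne q.2.2.abs_snd_le fun h => hq ?_
    have := (M.abs_lift_eq_one_iff q.1.2 q.2.1 q.2.2.abs_slope_le q.2.2.abs_snd_le).2 h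
    simp only [this, sub_self]
  exact continuous_clamp.comp (h3.prodMk h2)

theorem move_one_of_isLeft (p : A × B) {d : Dia} (h : IsLeft d.1) :
    (M.move 1 p d).1.2 = M.a p d.1.2 := by
  rw [move_val (by simp)]
  rcases d.abs_snd_le.lt_or_eq with h1 | h1
  · rw [(isLeft_iff h1).1 h]; simp only [chord, lift]; ring
  · rw [M.lift_of_abs_eq_one _ p _ h1]
    rcases (abs_eq zero_le_one).1 h1 with h1 | h1 <;> simp [chord, h1, M.a_one, M.a_neg_one]

theorem move_one_of_isRight (p : A × B) {d : Dia} (h : IsRight d.1) :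
    (M.move 1 p d).1.2 = M.b p d.1.2 := by
  rw [move_val (by simp)]
  rcases d.abs_snd_le.lt_or_eq with h1 | h1
  · rw [(isRight_iff h1).1 h]; simp only [chord, lift]; ring
  · rw [M.lift_of_abs_eq_one _ p _ h1]
    rcases (abs_eq zero_le_one).1 h1 with h1 | h1 <;> simp [chord, h1, M.b_one, M.b_neg_one]

end SideMotion

/-! ### Isotopy of compatible families to the identity -/

namespace StripCompatible
variable {A B : Type*} [TopologicalSpace A] [TopologicalSpace B] {g : A × B → Dia → Dia}

/-- The motion of the sides under a compatible family that keeps the suspension points. -/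
noncomputable def sideMotion (hg : StripCompatible g)
    (hc : Continuous fun q : (A × B) × Dia => g q.1 q.2)
    (h1 : ∀ p d, d.1.2 = 1 → (g p d).1.2 = 1) (h2 : ∀ p d, d.1.2 = -1 → (g p d).1.2 = -1) :
    SideMotion A B :=
  have hl : ∀ p, ∀ s ∈ Icc (-1 : ℝ) 1, IsLeft (g p (point (-1) s)).1 := fun p s hs => by
    rw [hg.left_iff, point_val (by simp) (abs_le.2 hs)]; exact isLeft_chord s
  have hr : ∀ p, ∀ s ∈ Icc (-1 : ℝ) 1, IsRight (g p (point 1 s)).1 := fun p s hs => by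
    rw [hg.right_iff, point_val (by simp) (abs_le.2 hs)]; exact isRight_chord s
  have hs : ∀ x s, |x| ≤ 1 → |s| ≤ 1 → (point x s).1.2 = s := fun x s hx hs => by
    rw [point_val hx hs]; rfl
  have hca : ∀ x, Continuous fun q : (A × B) × ℝ => (g q.1 (point x q.2)).1.2 := fun x =>
    continuous_snd.comp (continuous_subtype_val.comp (hc.comp (continuous_fst.prodMk
      (continuous_point.comp (f := fun q : (A × B) × ℝ => (x, q.2)) (by fun_prop)))))
  have hcl : ∀ x s, |s| = 1 → |x| ≤ 1 → ∀ p p', p.1 = p'.1 ∨ p.2 = p'.2 →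
      g p (point x s) = g p' (point x s) := fun x s hs1 hx p p' h => by
    have := hs x s hx hs1.le
    rcases h with h | h
    · exact hg.eq_of_left p p' h _ (isLeft_of_abs_snd (by rw [this, hs1]))
    · exact hg.eq_of_right p p' h _ (isRight_of_abs_snd (by rw [this, hs1]))
  { a := fun p s => (g p (point (-1) (projIcc (-1) 1 (by norm_num) s))).1.2
    b := fun p s => (g p (point 1 (projIcc (-1) 1 (by norm_num) s))).1.2
    continuous_a := (hca (-1)).comp (f := fun q : (A × B) × ℝ =>
      (q.1, (projIcc (-1 : ℝ) 1 (by norm_num) q.2 : ℝ))) (by fun_prop)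
    continuous_b := (hca 1).comp (f := fun q : (A × B) × ℝ =>
      (q.1, (projIcc (-1 : ℝ) 1 (by norm_num) q.2 : ℝ))) (by fun_prop)
    a_one := fun p => h1 _ _ (by rw [hs _ _ (by simp) (abs_le.2 (projIcc _ _ _ _).2)]; simp)
    b_one := fun p => h1 _ _ (by rw [hs _ _ (by simp) (abs_le.2 (projIcc _ _ _ _).2)]; simp)
    a_neg_one := fun p => h2 _ _ (by rw [hs _ _ (by simp) (abs_le.2 (projIcc _ _ _ _).2)]; simp)
    b_neg_one := fun p => h2 _ _ (by rw [hs _ _ (by simp) (abs_le.2 (projIcc _ _ _ _).2)]; simp)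
    strictMonoOn_a := fun p => by
      refine strictMonoOn_of_injOn_Icc ?_ ?_ ?_ ?_
      · exact ((hca (-1)).comp (f := fun s : ℝ =>
          (p, (projIcc (-1 : ℝ) 1 (by norm_num) s : ℝ))) (by fun_prop)).continuousOn
      · intro s i s' i' h
        simp only [projIcc_of_mem (by norm_num : (-1 : ℝ) ≤ 1) i,
          projIcc_of_mem (by norm_num : (-1 : ℝ) ≤ 1) i'] at h
        have := (hg.bijective p).1 (eq_of_isLeft (hl p s i) (hl p s' i') h)
        rw [← hs (-1) s (by simp) (abs_le.2 i), this, hs (-1) s' (by simp) (abs_le.2 i')]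
      · exact h1 _ _ (by rw [hs _ _ (by simp) (abs_le.2 (projIcc _ _ _ _).2)]; simp)
      · exact h2 _ _ (by rw [hs _ _ (by simp) (abs_le.2 (projIcc _ _ _ _).2)]; simp)
    strictMonoOn_b := fun p => by
      refine strictMonoOn_of_injOn_Icc ?_ ?_ ?_ ?_
      · exact ((hca 1).comp (f := fun s : ℝ =>
          (p, (projIcc (-1 : ℝ) 1 (by norm_num) s : ℝ))) (by fun_prop)).continuousOn
      · intro s i s' i' h
        simp only [projIcc_of_mem (by norm_num : (-1 : ℝ) ≤ 1) i,
          projIcc_of_mem (by norm_num : (-1 : ℝ) ≤ 1) i'] at h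
        have := (hg.bijective p).1 (eq_of_isRight (hr p s i) (hr p s' i') h)
        rw [← hs 1 s (by simp) (abs_le.2 i), this, hs 1 s' (by simp) (abs_le.2 i')]
      · exact h1 _ _ (by rw [hs _ _ (by simp) (abs_le.2 (projIcc _ _ _ _).2)]; simp)
      · exact h2 _ _ (by rw [hs _ _ (by simp) (abs_le.2 (projIcc _ _ _ _).2)]; simp)
    a_congr := fun p p' h => by
      ext s
      refine congrArg (fun e : Dia => e.1.2) (hg.eq_of_left p p' h _ ?_)
      rw [point_val (by simp) (abs_le.2 (projIcc _ _ _ _).2)]; exact isLeft_chord _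
    b_congr := fun p p' h => by
      ext s
      refine congrArg (fun e : Dia => e.1.2) (hg.eq_of_right p p' h _ ?_)
      rw [point_val (by simp) (abs_le.2 (projIcc _ _ _ _).2)]; exact isRight_chord _ }

theorem exists_sideMotion (hg : StripCompatible g)
    (hc : Continuous fun q : (A × B) × Dia => g q.1 q.2)
    (h1 : ∀ p d, d.1.2 = 1 → (g p d).1.2 = 1) (h2 : ∀ p d, d.1.2 = -1 → (g p d).1.2 = -1) :
    ∃ M : SideMotion A B, ∀ p d, (IsLeft d.1 ∨ IsRight d.1) → M.move 1 p d = g p d := by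
  refine ⟨hg.sideMotion hc h1 h2, fun p d hd => ?_⟩
  have hi := abs_le.1 d.abs_snd_le
  have hcompat := (hg.sideMotion hc h1 h2).stripCompatible_move (t := 1) (by simp)
  rcases hd with hd | hd
  · refine eq_of_isLeft ((hcompat.left_iff p d).2 hd) ((hg.left_iff p d).2 hd) ?_
    rw [SideMotion.move_one_of_isLeft p hd]
    show (g p (point (-1) (projIcc (-1) 1 _ d.1.2))).1.2 = _
    rw [projIcc_of_mem _ hi]
    congr 3
    refine eq_of_isLeft ?_ hd ?_ <;> rw [point_val (by simp) d.abs_snd_le]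
    exacts [isLeft_chord _, rfl]
  · refine eq_of_isRight ((hcompat.right_iff p d).2 hd) ((hg.right_iff p d).2 hd) ?_
    rw [SideMotion.move_one_of_isRight p hd]
    show (g p (point 1 (projIcc (-1) 1 _ d.1.2))).1.2 = _
    rw [projIcc_of_mem _ hi]
    congr 3
    refine eq_of_isRight ?_ hd ?_ <;> rw [point_val (by simp) d.abs_snd_le]
    exacts [isRight_chord _, rfl]

/-- A compatible family that keeps the suspension points is isotopic to the identity. -/
theorem exists_isotopy [CompactSpace A] [T2Space A] [CompactSpace B] [T2Space B]
    (hg : StripCompatible g) (hc : Continuous fun q : (A × B) × Dia => g q.1 q.2)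
    (h1 : ∀ p d, d.1.2 = 1 → (g p d).1.2 = 1) (h2 : ∀ p d, d.1.2 = -1 → (g p d).1.2 = -1) :
    ∃ f : I → A × B → Dia → Dia, (Continuous fun q : I × (A × B) × Dia => f q.1 q.2.1 q.2.2) ∧
      (∀ t, StripCompatible (f t)) ∧ (∀ p d, f 0 p d = d) ∧ (∀ p d, f 1 p d = g p d) := by
  obtain ⟨M, hM⟩ := hg.exists_sideMotion hc h1 h2
  have i1 : (1 : ℝ) ∈ Icc (0 : ℝ) 1 := by simp
  -- Inverting the time-one motion for all `p` at once, as a homeomorphism of a compact space, makes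
  -- the quotient `k` of `g` by it continuous in `p` as well. It fixes the boundary, so the
  -- Alexander isotopy applies.
  let V : (A × B) × Dia → (A × B) × Dia := fun q => (q.1, M.move 1 q.1 q.2)
  have hVc : Continuous V := continuous_fst.prodMk
    (M.continuous_move.comp (f := fun q : (A × B) × Dia => ((1 : I), q.1, q.2)) (by fun_prop))
  have hVb : Function.Bijective V := by
    constructor
    · rintro ⟨p, d⟩ ⟨p', d'⟩ h
      obtain rfl : p = p' := congrArg Prod.fst h
      have h' : M.move 1 p d = M.move 1 p d' := congrArg Prod.snd h
      rw [(SideMotion.bijective_move i1 p).1 h']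
    · rintro ⟨p, e⟩
      obtain ⟨d, hd⟩ := (SideMotion.bijective_move (M := M) i1 p).2 e
      exact ⟨(p, d), Prod.ext rfl hd⟩
  let W : (A × B) × Dia ≃ₜ (A × B) × Dia :=
    Continuous.homeoOfEquivCompactToT2 (f := Equiv.ofBijective V hVb) hVc
  let k : A × B → Dia → Dia := fun p d => (W.symm (p, g p d)).2
  have hWk : ∀ p d, M.move 1 p (k p d) = g p d := by
    intro p d
    have h : V (W.symm (p, g p d)) = (p, g p d) := W.apply_symm_apply _
    have h1 : (W.symm (p, g p d)).1 = p := congrArg Prod.fst h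
    have h2 := congrArg Prod.snd h
    simp only [V, h1] at h2
    exact h2
  have hkc : Continuous fun q : (A × B) × Dia => k q.1 q.2 :=
    continuous_snd.comp (W.symm.continuous.comp (continuous_fst.prodMk hc))
  have hkb : ∀ p, Function.Bijective (k p) := by
    intro p
    constructor
    · intro d d' h
      exact (hg.bijective p).1 (by rw [← hWk p d, h, hWk])
    · intro e
      obtain ⟨d, hd⟩ := (hg.bijective p).2 (M.move 1 p e)
      exact ⟨d, (SideMotion.bijective_move i1 p).1 (by rw [hWk, hd])⟩
  have hkfix : ∀ p (d : Dia), (IsLeft d.1 ∨ IsRight d.1) → k p d = d := fun p d hd =>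
    (SideMotion.bijective_move i1 p).1 (by rw [hWk, hM p d hd])
  have hnorm : ∀ d : Dia, norm₁ d.1 = 1 ↔ (IsLeft d.1 ∨ IsRight d.1) := by
    intro d
    have := lt_one_iff (d := d)
    have hd : norm₁ d.1 ≤ 1 := d.2
    have e : norm₁ d.1 < 1 ↔ ¬ (IsLeft d.1 ∨ IsRight d.1) := by rw [not_or]; exact this
    rw [← not_iff_not, ← e, lt_iff_le_and_ne]
    exact ⟨fun h => ⟨hd, h⟩, fun h => h.2⟩
  have hk1 : ∀ p (d : Dia), norm₁ d.1 = 1 → k p d = d := fun p d hd => hkfix p d ((hnorm d).1 hd)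
  have hcompat : ∀ t : I, StripCompatible fun p => alexander (k p) t := by
    intro t
    have hle : (t : ℝ) ≤ 1 := t.2.2
    refine of_fixes_sides (fun p => ?_)
      (fun p d hd => alexander_of_le (hk1 p) hle (((hnorm d).2 (Or.inl hd)).symm ▸ hle))
      (fun p d hd => alexander_of_le (hk1 p) hle (((hnorm d).2 (Or.inr hd)).symm ▸ hle))
    let e := Equiv.ofBijective (k p) (hkb p)
    have he : ∀ d : Dia, norm₁ d.1 = 1 → e.symm d = d := fun d hd =>
      (Equiv.symm_apply_eq e).2 (hk1 p d hd).symm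
    refine Function.bijective_iff_has_inverse.2 ⟨alexander e.symm t, fun d => ?_, fun d => ?_⟩
    · exact alexander_alexander (hk1 p) he (fun d => e.symm_apply_apply d) hle d
    · exact alexander_alexander he (hk1 p) (fun d => e.apply_symm_apply d) hle d
  refine ⟨fun t p d => M.move t p (alexander (k p) t d), ?_, fun t => ?_, fun p d => ?_,
    fun p d => ?_⟩
  · have := (continuous_alexander hkc).comp (f := fun q : I × (A × B) × Dia =>
      ((q.1 : ℝ), q.2.1, q.2.2)) (by fun_prop)
    exact M.continuous_move.comp (f := fun q : I × (A × B) × Dia =>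
      (q.1, q.2.1, alexander (k q.2.1) q.1 q.2.2))
      (continuous_fst.prodMk ((continuous_fst.comp continuous_snd).prodMk this))
  · exact (SideMotion.stripCompatible_move t.2).comp (hcompat t)
  · simp only [Icc.coe_zero]
    rw [SideMotion.move_zero, alexander_of_le (hk1 p) zero_le_one (norm₁_nonneg _)]
  · simp only [Icc.coe_one]
    rw [alexander_one, hWk]

end StripCompatible

/-! ### Straightening the lines -/

namespace SuspensionLines
variable {A B : Type*} [TopologicalSpace A] [TopologicalSpace B]
variable [CompactSpace A] [T2Space A] [CompactSpace B] [T2Space B]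
variable [TotallyDisconnectedSpace A] [TotallyDisconnectedSpace B]
variable [∀ a : A, (𝓝[≠] a).NeBot] [∀ b : B, (𝓝[≠] b).NeBot]
variable {Z : Set (TopSusp (TopJoin A B))} (L : SuspensionLines Z)

/-- There is a compatible family of maps of the strips that carries `Z` to the base. -/
theorem exists_stripCompatible : ∃ g : A × B → Dia → Dia, StripCompatible g ∧
    (Continuous fun q : (A × B) × Dia => g q.1 q.2) ∧
    ∀ p d, (g p d).1.2 = L.height (strip p d) := by
  obtain ⟨U, hUc, hU1, hUr, hUl, hUrt⟩ := L.planeLines.exists_transverse_coordinate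
  -- The value at the suspension points is irrelevant, as the chord there is a point.
  let u : A × B → Dia → ℝ := fun p d => if h : |d.1.2| < 1 then U (p, ⟨d.1, d.2, h⟩) else 0
  have hu : ∀ p (d : Dia) (h : |d.1.2| < 1), u p d = U (p, ⟨d.1, d.2, h⟩) := fun p d h => dif_pos h
  have hu1 : ∀ p d, |u p d| ≤ 1 := by
    intro p d
    simp only [u]
    split_ifs
    · exact hU1 _
    · simp
  have hlt : ∀ p d, |L.height (strip p d)| < 1 ↔ |d.1.2| < 1 := fun p d => by
    rw [L.height_lt_iff, ht_strip]
  have hheight : Continuous fun q : (A × B) × Dia => L.height (strip q.1 q.2) :=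
    L.continuous_height.comp continuous_strip
  have huc : ContinuousOn (fun q : (A × B) × Dia => u q.1 q.2) {q | |q.2.1.2| < 1} := by
    rw [continuousOn_iff_continuous_domRestrict]
    have : Continuous fun q : {q : (A × B) × Dia | |q.2.1.2| < 1} =>
        U (q.1.1, ⟨q.1.2.1, q.1.2.2, q.2⟩) := hUc.comp (by fun_prop)
    exact this.congr fun q => (hu q.1.1 q.1.2 q.2).symm
  have hur : ∀ p (d d' : Dia), |d.1.2| < 1 → |d'.1.2| < 1 →
      (u p d = u p d' ↔ L.foot (strip p d) = L.foot (strip p d')) := by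
    intro p d d' h h'
    rw [hu p d h, hu p d' h', hUr]
    refine ⟨fun e => ?_, fun e => congrArg (fun z : Z => coord (z : TopSusp (TopJoin A B))) e⟩
    have e' := congrArg (strip p) e
    simp only [planeLines] at e'
    rw [Subtype.coe_eta, Subtype.coe_eta, L.strip_coord_foot p h, L.strip_coord_foot p h',
      Subtype.coe_inj] at e'
    exact e'
  have hul : ∀ p (d : Dia), |d.1.2| < 1 → (u p d = -1 ↔ IsLeft d.1) := by
    intro p d h
    rw [hu p d h, ← hUl p, hUr]
    exact (L.planeLines.left_iff p _ ⟨d.1, d.2, h⟩ Str.isLeft_leftPt).symm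
  have hurt : ∀ p (d : Dia), |d.1.2| < 1 → (u p d = 1 ↔ IsRight d.1) := by
    intro p d h
    have e := hUr p ⟨d.1, d.2, h⟩ Str.rightPt
    rw [hUrt] at e
    rw [hu p d h, e]
    exact (L.planeLines.right_iff p _ ⟨d.1, d.2, h⟩ Str.isRight_rightPt).symm
  -- The new slope labels the line and the new height is the one along it, so the lines become
  -- straight.
  let g : A × B → Dia → Dia := fun p d => point (u p d) (L.height (strip p d))
  have hg : ∀ p d, (g p d).1 = chord (u p d) (L.height (strip p d)) := fun p d =>
    point_val (hu1 p d) (L.abs_height_le _)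
  have hsnd : ∀ p d, (g p d).1.2 = L.height (strip p d) := fun p d => by rw [hg]; rfl
  have hslope : ∀ p (d : Dia), |d.1.2| < 1 → Dia.slope (g p d).1 = u p d := fun p d h => by
    rw [hg, slope_chord ((hlt p d).2 h)]
  have hpole : ∀ p (d : Dia), |d.1.2| = 1 → g p d = d := by
    intro p d h
    have e : L.height (strip p d) = d.1.2 := by
      rcases (abs_eq zero_le_one).1 h with h | h
      · rw [h, L.height_eq_one_iff, ht_strip, h]
      · rw [h, L.height_eq_neg_one_iff, ht_strip, h]
    refine Subtype.ext ?_
    rw [hg, e, ← eq_chord_of_abs_snd h]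
  have hleft : ∀ p d, IsLeft (g p d).1 ↔ IsLeft d.1 := by
    intro p d
    rcases d.abs_snd_le.lt_or_eq with h | h
    · rw [isLeft_iff (by rw [hsnd]; exact (hlt p d).2 h), hslope p d h, hul p d h]
    · rw [hpole p d h]
  have hright : ∀ p d, IsRight (g p d).1 ↔ IsRight d.1 := by
    intro p d
    rcases d.abs_snd_le.lt_or_eq with h | h
    · rw [isRight_iff (by rw [hsnd]; exact (hlt p d).2 h), hslope p d h, hurt p d h]
    · rw [hpole p d h]
  have hinj : ∀ p, Function.Injective (g p) := by
    intro p d d' h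
    have h2 : L.height (strip p d) = L.height (strip p d') := by rw [← hsnd, h, hsnd]
    rcases d.abs_snd_le.lt_or_eq with hd | hd
    · have hd' : |d'.1.2| < 1 := by rw [← hlt p, ← h2, hlt p]; exact hd
      have h1 : u p d = u p d' := by rw [← hslope p d hd, h, hslope p d' hd']
      exact (strip_eq_strip_iff.1 (L.eq_of_foot_eq ((hur p d d' hd hd').1 h1) h2)).1
    · have hd' : |d'.1.2| = 1 := d'.abs_snd_le.lt_or_eq.resolve_left fun hd' => hd.not_lt (by
        rwa [← hlt p, h2, hlt p])
      rwa [hpole p d hd, hpole p d' hd'] at h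
  have hsurj : ∀ p, Function.Surjective (g p) := by
    intro p e
    rcases e.abs_snd_le.lt_or_eq with he | he
    -- The diagonal meets a line with the required transverse coordinate; following this line to the
    -- required height gives the preimage.
    · let δ : Icc (-1 : ℝ) 1 → ℝ := fun t => U (p, Str.diag t)
      have hδ : Continuous δ := hUc.comp (continuous_const.prodMk Str.continuous_diag)
      have i1 : (1 : ℝ) ∈ Icc (-1 : ℝ) 1 := by simp
      have i2 : (-1 : ℝ) ∈ Icc (-1 : ℝ) 1 := by simp
      have hpc : PreconnectedSpace (Icc (-1 : ℝ) 1) :=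
        isPreconnected_iff_preconnectedSpace.1 isPreconnected_Icc
      have hmem : Dia.slope e.1 ∈ Icc (δ ⟨-1, i2⟩) (δ ⟨1, i1⟩) := by
        have e1 : δ ⟨-1, i2⟩ = -1 := hUl p
        have e2 : δ ⟨1, i1⟩ = 1 := hUrt p
        rw [e1, e2]; exact abs_le.1 e.abs_slope_le
      obtain ⟨t, ht⟩ := intermediate_value_univ _ _ hδ hmem
      set d₀ : Dia := ⟨(Str.diag t).1, (Str.diag t).2.1⟩ with hd₀
      have h0 : |d₀.1.2| < 1 := (Str.diag t).2.2
      have hu0 : u p d₀ = Dia.slope e.1 := by rw [hu p d₀ h0]; exact ht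
      set x := L.line (L.foot (strip p d₀)) e.1.2 with hx
      have hxs : strip p (coord x) = x := L.strip_coord_line p h0 he
      have hxlt : |(coord x).1.2| < 1 := by rw [coord_snd]; exact L.ht_line_lt _ he
      refine ⟨coord x, Subtype.ext ?_⟩
      have hux : u p (coord x) = Dia.slope e.1 := by
        rw [← hu0, hur p _ _ hxlt h0, hxs, hx, L.foot_line _ he]
      rw [hg, hux, hxs, hx, L.height_line _ _ he.le, chord_slope]
    · exact ⟨e, hpole p e he⟩
  refine ⟨g, ⟨fun p => ⟨hinj p, hsurj p⟩, hleft, hright, ?_, ?_⟩, ?_, hsnd⟩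
  -- A point of a side is determined by its height, and the height is a function on the suspension,
  -- where the two sides are identified.
  · intro p p' h d hd
    refine eq_of_isLeft ((hleft p d).2 hd) ((hleft p' d).2 hd) ?_
    rw [hsnd, hsnd, strip_eq_strip_iff.2 ⟨rfl, Or.inl h, Or.inr hd⟩]
  · intro p p' h d hd
    refine eq_of_isRight ((hright p d).2 hd) ((hright p' d).2 hd) ?_
    rw [hsnd, hsnd, strip_eq_strip_iff.2 ⟨rfl, Or.inr hd, Or.inl h⟩]
  · have h3 : Continuous fun q : (A × B) × Dia =>
        u q.1 q.2 * (1 - |L.height (strip q.1 q.2)|) := by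
      refine continuous_mul_of_bounded (by fun_prop) (huc.mono fun q hq => ?_) fun q => hu1 q.1 q.2
      rw [mem_ofPred_eq, ← hlt q.1]
      exact lt_of_le_of_ne (L.abs_height_le _) fun h => hq (by simp [h])
    exact continuous_clamp.comp (h3.prodMk hheight)

theorem isIsotopicIn_base (L : SuspensionLines Z) : IsIsotopicIn Z (base (TopJoin A B)) := by
  obtain ⟨g, hg, hc, hsnd⟩ := L.exists_stripCompatible
  obtain ⟨f, hfc, hf, hf0, hf1⟩ := hg.exists_isotopy hc
    (fun p d h => by rw [hsnd, L.height_eq_one_iff, ht_strip, h])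
    (fun p d h => by rw [hsnd, L.height_eq_neg_one_iff, ht_strip, h])
  obtain ⟨F, hFc, hF⟩ := exists_isotopy_of_stripCompatible hfc hf
  -- The final map turns the second height into the first, and `Z` and the base are the respective
  -- zero sets.
  have hF1 : ∀ x, ht (F 1 x) = L.height x := by
    intro x
    obtain ⟨p, d, rfl⟩ := exists_strip x
    rw [hF, hf1, ht_strip, hsnd]
  refine ⟨F, hFc, ?_, ?_⟩
  · ext x
    obtain ⟨p, d, rfl⟩ := exists_strip x
    rw [hF, hf0]; rfl
  · ext y
    rw [mem_base_iff]
    constructor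
    · rintro ⟨x, hx, rfl⟩
      rw [hF1]; exact (L.mem_iff x).1 hx
    · intro hy
      refine ⟨(F 1).symm y, ?_, (F 1).apply_symm_apply y⟩
      rw [L.mem_iff, ← hF1, (F 1).apply_symm_apply, hy]

end SuspensionLines

/-! ### Cantor sets and the conclusion -/

namespace IsCantorSet
variable {C : Type*} [TopologicalSpace C]

theorem compactSpace (h : IsCantorSet C) : CompactSpace C := h.some.symm.compactSpace

theorem t2Space (h : IsCantorSet C) : T2Space C := h.some.symm.t2Space

theorem totallyDisconnectedSpace (h : IsCantorSet C) : TotallyDisconnectedSpace C :=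
  h.some.symm.totallyDisconnectedSpace

theorem nonempty (h : IsCantorSet C) : Nonempty C := ⟨h.some.symm fun _ => true⟩

theorem neBot_nhdsNE_of_bool (c : ℕ → Bool) : (𝓝[≠] c).NeBot := by
  have h : Tendsto (fun n => Function.update c n (!c n)) atTop (𝓝[≠] c) := by
    refine tendsto_nhdsWithin_iff.2 ⟨tendsto_pi_nhds.2 fun k => ?_, Eventually.of_forall fun n he => ?_⟩
    · refine tendsto_const_nhds.congr' ?_
      filter_upwards [eventually_gt_atTop k] with n hn
      rw [Function.update_of_ne hn.ne]
    · have := congrFun he n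
      simp at this
  exact h.neBot

theorem neBot_nhdsNE (h : IsCantorSet C) (c : C) : (𝓝[≠] c).NeBot := by
  have := neBot_nhdsNE_of_bool (h.some c)
  have e := h.some.isEmbedding.map_nhdsWithin_eq {c}ᶜ c
  rw [image_compl_eq h.some.bijective, image_singleton] at e
  rw [← e] at this
  exact this.of_map

end IsCantorSet

theorem mainTheorem7 {C₁ C₂ : Type*} [TopologicalSpace C₁] [TopologicalSpace C₂]
    (hC₁ : IsCantorSet C₁) (hC₂ : IsCantorSet C₂) :
    (∀ f : TopSusp (TopJoin C₁ C₂) ≃ₜ TopSusp (TopJoin C₁ C₂),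
      f '' TopSusp.points (TopJoin C₁ C₂) = TopSusp.points (TopJoin C₁ C₂)) ∧
    (∀ (Z : Set (TopSusp (TopJoin C₁ C₂))) (S : SuspensionStructure Z),
      S.points = TopSusp.points (TopJoin C₁ C₂) ∧
      IsIsotopicIn Z (TopSusp.base (TopJoin C₁ C₂))) := by
  have := hC₁.compactSpace
  have := hC₂.compactSpace
  have := hC₁.t2Space
  have := hC₂.t2Space
  have := hC₁.totallyDisconnectedSpace
  have := hC₂.totallyDisconnectedSpace
  have := hC₁.nonempty
  have := hC₂.nonempty
  have := hC₁.neBot_nhdsNE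
  have := hC₂.neBot_nhdsNE
  exact ⟨image_points_eq, fun Z S => ⟨S.points_eq, S.nonempty_lines.some.isIsotopicIn_base⟩⟩
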